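/- Let $0<k_1<k_2$ and let $e_1,e_2,e_3\in\mathbb R$ be given by $k_1^2=e_2-e_3$, $k_2^2=e_1-e_3$, $e_1+e_2+e_3=0$. Then there are $\omega,\omega'>0$ such that the Weierstrass function $\wp$ with half-periods $\omega$ and $i\omega'$ satisfies $\wp(\omega)=e_1$, $\wp(\omega+i\omega')=e_2$, $\wp(i\omega')=e_3$. For any such $\omega,\omega'$, let $\Lambda=2\omega\mathbb Z+2i\omega'\mathbb Z$, let $\sigma,\zeta$ be the Weierstrass functions of $\Lambda$, and let $$\varphi(x,z)=\frac{\sigma(x-\omega-i\omega'+z)\,\sigma(\omega+i\omega')}{\sigma(x-\omega-i\omega')\,\sigma(\omega+i\omega'-z)}\,e^{-\zeta(z)x}.$$ Let $D=\mathbb C\setminus([ik_1,ik_2]\cup[-ik_2,-ik_1])$. On $D$ the relation $k^2=e_3-\wp(z)$ has a branch $z=z(k)\notin\Lambda$ that is holomorphic modulo $\Lambda$ and satisfies $k\,z(k)\to -i$ as $|k|\to\infty$. For any such branch the function $$\chi(k,x)=\left(\frac{k^2+k_1^2}{k^2+k_2^2}\right)^{1/4}\varphi(x,z(k))\,e^{ikx},\qquad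 k\in D,\ x\in\mathbb R,$$ with the principal branch of the fourth root, has the following properties, for a function $Q:\mathbb R\to\mathbb C$ and every $x\in\mathbb R$. 1. $\chi(\cdot,x)$ is analytic on $D$, and for $p\in(-k_2,-k_1)\cup(k_1,k_2)$ it has non-tangential limits $\chi^{\pm}(ip,x)=\lim_{\varepsilon\to0^+}\chi(ip\pm\varepsilon,x)$ from the right ($+$) and from the left ($-$). 2. For $p\in(k_1,k_2)$, $$\chi^+(ip,x)-\chi^-(ip,x)=ie^{-2px}\,[\chi^+(-ip,x)+\chi^-(-ip,x)],$$ $$\chi^+(-ip,x)-\chi^-(-ip,x)=-ie^{2px}\,[\chi^+(ip,x)+\chi^-(ip,x)].$$ 3. $\chi(k,x)=1+\frac{i}{2k}Q(x)+O(k^{-2})$ as $|k|\to\infty$, $\operatorname{Im}k\ne0$. 4. There are a constant $\alpha<1$, independent of $x$, and constants $C(x)$ such that $|\chi(k,x)|<C(x)\,|k-c|^{-\alpha}$ for $k\in D$ near each $c\in\{\pm ik_1,\pm ik_2\}$. That is, $\chi$ satisfies the contour problem of primitive potentials on $[k_1,k_2]$ with dressing functions $R_1=R_2=1$ at $t=0$.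 Moreover, $Q$ is differentiable, and the potential $u(x)=Q'(x)$ is the elliptic one-gap potential $$u(x)=2\wp(x+i\omega'-\omega)+e_3 .$$ -/

import Mathlib

open Filter Topology Asymptotics

noncomputable section

namespace PrimitivePotential

/-- The Weierstrass zeta function
`ζ(z) = 1/z + ∑_{l ≠ 0} (1/(z - l) + 1/l + z/l²)`, summed over the nonzero periods `l`. -/
def weierstrassZeta (L : PeriodPair) (z : ℂ) : ℂ :=
  1 / z + ∑' l : {l : ℂ // l ∈ L.lattice ∧ l ≠ 0},
    (1 / (z - l) + 1 / (l : ℂ) + z / (l : ℂ) ^ 2)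

/-- The Weierstrass sigma function
`σ(z) = z ∏_{l ≠ 0} (1 - z/l) exp(z/l + z²/(2l²))`, the product over the nonzero periods `l`. -/
def weierstrassSigma (L : PeriodPair) (z : ℂ) : ℂ :=
  z * ∏' l : {l : ℂ // l ∈ L.lattice ∧ l ≠ 0},
    ((1 - z / l) * Complex.exp (z / l + z ^ 2 / (2 * (l : ℂ) ^ 2)))

/-- The pair of periods `2ω`, `2iω'` (that is, half-periods `ω` and `iω'`), `ω, ω' > 0`. -/
def rectPeriods (ω ω' : ℝ) (hω : 0 < ω) (hω' : 0 < ω') : PeriodPair where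
  ω₁ := 2 * ω
  ω₂ := 2 * (Complex.I * ω')
  indep := by
    rw [LinearIndependent.pair_iff]
    intro s t h
    have h1 := congrArg Complex.re h
    have h2 := congrArg Complex.im h
    simp at h1 h2
    exact ⟨h1.resolve_right hω.ne', h2.resolve_right hω'.ne'⟩

/-- `e₃`, where `e₁ + e₂ + e₃ = 0`, `k₁² = e₂ - e₃`, `k₂² = e₁ - e₃`. -/
def e₃ (k₁ k₂ : ℝ) : ℝ := -(k₁ ^ 2 + k₂ ^ 2) / 3

/-- `e₂ = e₃ + k₁²`. -/
def e₂ (k₁ k₂ : ℝ) : ℝ := e₃ k₁ k₂ + k₁ ^ 2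

/-- `e₁ = e₃ + k₂²`. -/
def e₁ (k₁ k₂ : ℝ) : ℝ := e₃ k₁ k₂ + k₂ ^ 2

/-- `ω` and `iω'` are half-periods of the Weierstrass function with
`℘(ω) = e₁`, `℘(ω + iω') = e₂`, `℘(iω') = e₃`. -/
def AreHalfPeriods (k₁ k₂ ω ω' : ℝ) (hω : 0 < ω) (hω' : 0 < ω') : Prop :=
  (rectPeriods ω ω' hω hω').weierstrassP ω = e₁ k₁ k₂ ∧
  (rectPeriods ω ω' hω hω').weierstrassP (ω + Complex.I * ω') = e₂ k₁ k₂ ∧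
  (rectPeriods ω ω' hω hω').weierstrassP (Complex.I * ω') = e₃ k₁ k₂

/-- The complex plane without the two closed cuts `[ik₁, ik₂]` and `[-ik₂, -ik₁]`. -/
def cutPlane (k₁ k₂ : ℝ) : Set ℂ :=
  {k : ℂ | ¬ (k.re = 0 ∧ k₁ ≤ |k.im| ∧ |k.im| ≤ k₂)}

/-- The solution
`φ(x,z) = σ(x - ω - iω' + z) σ(ω + iω') / (σ(x - ω - iω') σ(ω + iω' - z)) · exp(-ζ(z) x)`
of the Lamé equation; here `w = ω + iω'`. -/
def lamePhi (L : PeriodPair) (w : ℂ) (x : ℝ) (z : ℂ) : ℂ :=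
  weierstrassSigma L (x - w + z) * weierstrassSigma L w /
    (weierstrassSigma L (x - w) * weierstrassSigma L (w - z)) *
    Complex.exp (-weierstrassZeta L z * x)

/-- `k ↦ z k` is the branch, on the cut plane, of the relation `k² = e - ℘(z)` normalized by
`z ∼ -i/k` as `k → ∞` (so that `φ(x, z) ∼ e^{-x/z}` behaves like `e^{-ikx}`).
The branch is holomorphic modulo the period lattice: near each point of the cut plane it differs
from a holomorphic function by periods. -/
structure IsSpectralBranch (L : PeriodPair) (k₁ k₂ : ℝ) (e : ℂ) (z : ℂ → ℂ) : Prop where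
  notMem_lattice : ∀ k ∈ cutPlane k₁ k₂, z k ∉ L.lattice
  sq_eq : ∀ k ∈ cutPlane k₁ k₂, k ^ 2 = e - L.weierstrassP (z k)
  analytic_mod_lattice : ∀ k₀ ∈ cutPlane k₁ k₂, ∃ f : ℂ → ℂ, AnalyticAt ℂ f k₀ ∧
    ∀ᶠ k in 𝓝 k₀, z k - f k ∈ L.lattice
  at_infinity : Tendsto (fun k : ℂ => k * z k) (Bornology.cobounded ℂ) (𝓝 (-Complex.I))

/-- `χ(k,x) = ((k² + k₁²)/(k² + k₂²))^{1/4} φ(x, z(k)) e^{ikx}`, with the principal branch of the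
fourth root. -/
def chi (L : PeriodPair) (w : ℂ) (k₁ k₂ : ℝ) (z : ℂ → ℂ) (k : ℂ) (x : ℝ) : ℂ :=
  ((k ^ 2 + (k₁ : ℂ) ^ 2) / (k ^ 2 + (k₂ : ℂ) ^ 2)) ^ (1 / 4 : ℂ) *
    lamePhi L w x (z k) * Complex.exp (Complex.I * k * x)

/-- `f` has the non-tangential limit `l` at the point `ip` of the imaginary axis,
from the right if `s = 1` and from the left if `s = -1`. -/
def HasNontangentialLimit (s : ℝ) (f : ℂ → ℂ) (p : ℝ) (l : ℂ) : Prop :=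
  ∀ M : ℝ, 0 < M →
    Tendsto f (𝓝[{k : ℂ | 0 < s * k.re ∧ |k.im - p| ≤ M * (s * k.re)}] (Complex.I * p)) (𝓝 l)

/-- The contour problem of primitive potentials with dressing functions `R₁`, `R₂`, at the
moment of time `t`, for `χ(k,x) = χ(k,x,t)`, with coefficient `Q(x) = Q(x,t)` at infinity. -/
structure SolvesContourProblem (k₁ k₂ : ℝ) (R₁ R₂ : ℝ → ℝ) (t : ℝ)
    (χ : ℂ → ℝ → ℂ) (Q : ℝ → ℂ) : Prop where
  /-- Analyticity off the cuts. -/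
  analytic : ∀ x : ℝ, AnalyticOnNhd ℂ (fun k => χ k x) (cutPlane k₁ k₂)
  /-- Existence of the boundary values `χ⁺(ip,x)`, `χ⁻(ip,x)` (denoted `χp p x`, `χm p x`),
  and the jump relations. -/
  jumps : ∃ χp χm : ℝ → ℝ → ℂ,
    (∀ x p : ℝ, k₁ < |p| → |p| < k₂ →
      HasNontangentialLimit 1 (fun k => χ k x) p (χp p x) ∧
      HasNontangentialLimit (-1) (fun k => χ k x) p (χm p x)) ∧
    (∀ x p : ℝ, k₁ < p → p < k₂ →
      χp p x - χm p x =
        Complex.I * R₁ p * Real.exp (-2 * p * x + 8 * p ^ 3 * t) * (χp (-p) x + χm (-p) x)) ∧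
    (∀ x p : ℝ, k₁ < p → p < k₂ →
      χp (-p) x - χm (-p) x =
        -Complex.I * R₂ p * Real.exp (2 * p * x - 8 * p ^ 3 * t) * (χp p x + χm p x))
  /-- `χ = 1 + (i/2k) Q + O(1/k²)` as `|k| → ∞`, `Im k ≠ 0`. -/
  asymptotic : ∀ x : ℝ,
    (fun k : ℂ => χ k x - (1 + Complex.I / (2 * k) * Q x))
      =O[Bornology.cobounded ℂ ⊓ 𝓟 {k : ℂ | k.im ≠ 0}] (fun k : ℂ => 1 / k ^ 2)
  /-- Near each endpoint `c = ±ik₁, ±ik₂` one has `|χ| < C(x) / |k - c|^α`, with `α < 1`. -/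
  endpoints : ∃ α : ℝ, α < 1 ∧ ∀ x : ℝ, ∃ C : ℝ,
    ∀ c ∈ ({Complex.I * k₁, -(Complex.I * k₁), Complex.I * k₂, -(Complex.I * k₂)} : Set ℂ),
      ∀ᶠ k in 𝓝[cutPlane k₁ k₂] c, ‖χ k x‖ < C / ‖k - c‖ ^ α

end PrimitivePotential

end

/-! The relation k² = e₃ - ℘(z), with ℘'(z)² = -4k²(k² + k₁²)(k² + k₂²), is a double cover of the
k-plane whose points over k are ±z modulo Λ. On D they are told apart by the sign in ℘'(z) =
±2ikS(k), where S is the square root of (k² + k₁²)(k² + k₂²) with S ~ k² at infinity. The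
normalization k z(k) → -i selects the plus sign (`derivWeierstrassP_branch`), so the branch is
unique modulo Λ. Since φ is Λ-periodic in z (`lamePhi_add_mem`), χ does not see the lattice jumps of
z and is analytic on D.

Jumps: S is even and changes sign across the cuts. If f is a local solution representing z to the
right of ip, then modulo Λ the boundary value of z is f(ip) on the right of both ip and -ip, and
-f(ip) on the left of both. The fourth root tends to ρe^{iπ/4} or ρe^{-iπ/4}, and these differ by
the factor i. The four limits (`exists_tendsto_chi`) then satisfy the jump relations by algebra.

Endpoints: the pole of φ at w = ω + iω' lies over k = ±ik₁, where ℘ - e₂ has a double zero. Hence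
|φ|²|k² + k₁²| stays bounded, and with the fourth root this gives the exponent α = 1/4 at all four
endpoints (`exists_norm_chi_lt`).

Infinity: z is a local coordinate there and ik - ζ(z) is regular at z = 0, so χ is an analytic
function of z (`chiLocal`). Its first Taylor coefficient gives Q(x) = -2ζ(x - w) - 2ζ(w) + e₃x
(`chi_isBigO`), and ζ' = -℘ gives the potential.

Half-periods: summing ℘ along rows and along columns of the lattice makes e₂ - e₃ and e₁ - e₂
positive series depending, up to scale, on t = ω'/ω only. Their ratio takes every positive value by
continuity, and scaling does the rest (`exists_areHalfPeriods`). -/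

namespace PrimitivePotential

/-- The nonzero periods. -/
abbrev NonzeroPeriod (L : PeriodPair) : Type := {l : ℂ // l ∈ L.lattice ∧ l ≠ 0}

/-! ### Weierstrass ζ and σ: convergence, derivatives, zeros. -/

section ZetaSigma

variable (L : PeriodPair)

/-- Bridges two conventions: sums over the whole lattice with the term at 0 suppressed, as for
`weierstrassPExcept 0`, and sums over the nonzero periods. -/
lemma hasSum_nonzeroPeriod {g : ℂ → ℂ} {a : ℂ}
    (h : HasSum (fun l : L.lattice => if l.1 = 0 then 0 else g l) a) :
    HasSum (fun l : NonzeroPeriod L => g l) a := by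
  let i : NonzeroPeriod L → L.lattice := fun l => ⟨l.1, l.2.1⟩
  have hi : Function.Injective i := by
    intro a b hab
    exact Subtype.ext (congrArg (fun l : L.lattice => (l : ℂ)) hab)
  have h' := (hi.hasSum_iff (f := fun l : L.lattice => if l.1 = 0 then 0 else g l) ?_).mpr h
  · convert! h' using 2 with l
    simp [i, l.2.2]
  · intro l hl
    have : l.1 = 0 := by
      by_contra h0
      exact hl ⟨⟨l.1, l.2, h0⟩, rfl⟩
    simp [this]

lemma summable_norm_nonzeroPeriod :
    Summable fun l : NonzeroPeriod L => ‖(l : ℂ)‖⁻¹ ^ 3 := by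
  have h := ZLattice.summable_norm_pow_inv L.lattice 3 (by simp)
  exact h.comp_injective (i := fun l : NonzeroPeriod L => (⟨l.1, l.2.1⟩ : L.lattice))
    (fun a b hab => Subtype.ext (congrArg (fun l : L.lattice => (l : ℂ)) hab))

lemma eventually_le_norm_nonzeroPeriod (R : ℝ) :
    ∀ᶠ l : NonzeroPeriod L in cofinite, R ≤ ‖(l : ℂ)‖ := by
  have h : (Metric.closedBall (0 : L.lattice) R).Finite :=
    isCompact_iff_finite.mp (isCompact_closedBall (0 : L.lattice) R)
  have hi : Function.Injective (fun l : NonzeroPeriod L => (⟨l.1, l.2.1⟩ : L.lattice)) :=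
    fun a b hab => Subtype.ext (congrArg (fun l : L.lattice => (l : ℂ)) hab)
  refine (h.preimage hi.injOn).subset ?_
  intro l hl
  simp only [Set.mem_compl_iff, Set.mem_ofPred_eq, not_le] at hl
  simpa using hl.le

/-- `ζ(z) - 1/z`. -/
noncomputable def zetaRegular (z : ℂ) : ℂ :=
  ∑' l : NonzeroPeriod L, (1 / (z - l) + 1 / (l : ℂ) + z / (l : ℂ) ^ 2)

lemma weierstrassZeta_eq (z : ℂ) : weierstrassZeta L z = 1 / z + zetaRegular L z := rfl

/-- The three terms collapse to z²/(l²(z - l)), which decays like |l|⁻³, and such a series over a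
planar lattice converges. -/
lemma norm_zeta_summand_le {r : ℝ} {z l : ℂ} (hz : ‖z‖ ≤ r) (hr : 0 < r)
    (hl : 2 * r ≤ ‖l‖) :
    ‖1 / (z - l) + 1 / l + z / l ^ 2‖ ≤ 2 * r ^ 2 * ‖l‖⁻¹ ^ 3 := by
  have hl0 : 0 < ‖l‖ := by linarith
  have hl1 : l ≠ 0 := norm_pos_iff.mp hl0
  have h1 : ‖l‖ / 2 ≤ ‖z - l‖ := by
    have := norm_sub_norm_le l z
    rw [norm_sub_rev] at this
    linarith
  have h2 : z - l ≠ 0 := norm_pos_iff.mp (by linarith)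
  have h3 : 1 / (z - l) + 1 / l + z / l ^ 2 = z ^ 2 / (l ^ 2 * (z - l)) := by
    field_simp
    ring
  rw [h3, norm_div, norm_mul, norm_pow, norm_pow]
  calc ‖z‖ ^ 2 / (‖l‖ ^ 2 * ‖z - l‖) ≤ r ^ 2 / (‖l‖ ^ 2 * (‖l‖ / 2)) := by gcongr
    _ = _ := by field_simp

lemma hasSumLocallyUniformlyOn_zetaRegular (s : Set ℂ) (hs : IsOpen s) :
    HasSumLocallyUniformlyOn
      (fun (l : NonzeroPeriod L) (z : ℂ) => 1 / (z - l) + 1 / (l : ℂ) + z / (l : ℂ) ^ 2)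
      (zetaRegular L) s := by
  apply hasSumLocallyUniformlyOn_of_forall_compact hs
  intro K _ hK
  rw [hasSumUniformlyOn_iff_tendstoUniformlyOn]
  obtain ⟨r, hr0, hr⟩ := hK.isBounded.exists_pos_norm_le
  refine tendstoUniformlyOn_tsum_of_cofinite_eventually
    ((summable_norm_nonzeroPeriod L).mul_left (2 * r ^ 2)) ?_
  filter_upwards [eventually_le_norm_nonzeroPeriod L (2 * r)] with l hl z hz
  exact norm_zeta_summand_le (hr z hz) hr0 hl

lemma isOpen_regular : IsOpen ((L.lattice \ {0} : Set ℂ)ᶜ) := L.isOpen_compl_lattice_sdiff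

lemma sub_ne_zero_of_regular {z : ℂ} (hz : z ∈ (L.lattice \ {0} : Set ℂ)ᶜ)
    (l : NonzeroPeriod L) : z - l ≠ 0 := by
  intro h
  apply hz
  rw [sub_eq_zero.mp h]
  exact ⟨l.2.1, l.2.2⟩

lemma differentiableOn_zetaRegular :
    DifferentiableOn ℂ (zetaRegular L) ((L.lattice \ {0} : Set ℂ)ᶜ) := by
  refine (hasSumLocallyUniformlyOn_zetaRegular L _ (isOpen_regular L)).differentiableOn
    (.of_forall fun s => .fun_sum fun l _ => ?_) (isOpen_regular L)
  intro z hz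
  have := sub_ne_zero_of_regular L hz l
  exact DifferentiableAt.differentiableWithinAt (by fun_prop (disch := assumption))

lemma hasDerivAt_zeta_summand {z l : ℂ} (h : z - l ≠ 0) :
    HasDerivAt (fun z => 1 / (z - l) + 1 / l + z / l ^ 2) (-(1 / (z - l) ^ 2 - 1 / l ^ 2)) z := by
  have h1 := ((hasDerivAt_id z).sub_const l).inv h
  have h2 := (hasDerivAt_id z).div_const (l ^ 2)
  have h3 := (h1.add_const (1 / l)).add h2
  convert! h3 using 1
  · ext; simp
  · simp; ring

/-- Locally uniform convergence of holomorphic partial sums allows termwise differentiation; the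
result is the series of ℘ without its pole at 0. -/
lemma hasDerivAt_zetaRegular {z : ℂ} (hz : z ∈ (L.lattice \ {0} : Set ℂ)ᶜ) :
    HasDerivAt (zetaRegular L) (-L.weierstrassPExcept 0 z) z := by
  have hd := ((differentiableOn_zetaRegular L).differentiableAt
    ((isOpen_regular L).mem_nhds hz)).hasDerivAt
  have h0 := hasSumLocallyUniformlyOn_iff_tendstoLocallyUniformlyOn.mp
    (hasSumLocallyUniformlyOn_zetaRegular L _ (isOpen_regular L))
  have hdiff : ∀ᶠ s : Finset (NonzeroPeriod L) in atTop, DifferentiableOn ℂ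
      (fun z => ∑ l ∈ s, (1 / (z - l) + 1 / (l : ℂ) + z / (l : ℂ) ^ 2))
      ((L.lattice \ {0} : Set ℂ)ᶜ) :=
    .of_forall fun s => .fun_sum fun l _ => fun z hz => (hasDerivAt_zeta_summand
      (sub_ne_zero_of_regular L hz l)).differentiableAt.differentiableWithinAt
  have h1 := (h0.deriv hdiff (isOpen_regular L)).tendsto_at hz
  have h2 : HasSum (fun l : NonzeroPeriod L => -(1 / (z - l) ^ 2 - 1 / (l : ℂ) ^ 2))
      (deriv (zetaRegular L) z) := by
    have h4 : ∀ s : Finset (NonzeroPeriod L),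
        deriv (fun z => ∑ l ∈ s, (1 / (z - l) + 1 / (l : ℂ) + z / (l : ℂ) ^ 2)) z =
          ∑ l ∈ s, -(1 / (z - l) ^ 2 - 1 / (l : ℂ) ^ 2) := fun s =>
      (HasDerivAt.fun_sum fun l _ =>
        hasDerivAt_zeta_summand (sub_ne_zero_of_regular L hz l)).deriv
    exact Tendsto.congr h4 h1
  have h3 := (hasSum_nonzeroPeriod L (g := fun l => 1 / (z - l) ^ 2 - 1 / l ^ 2)
    (L.hasSum_weierstrassPExcept 0 z)).neg
  rw [← h2.unique h3]
  exact hd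

/-- The factors of the product for the sigma function. -/
noncomputable def primaryFactor (w : ℂ) : ℂ := (1 - w) * Complex.exp (w + w ^ 2 / 2)

/-- The exponent cancels the terms of order 0 and 1 of the derivative. Its double zero at 0 makes
`primaryFactor w - 1` cubically small. -/
lemma hasDerivAt_primaryFactor (w : ℂ) :
    HasDerivAt primaryFactor (-w ^ 2 * Complex.exp (w + w ^ 2 / 2)) w := by
  have h1 := (hasDerivAt_id w).const_sub 1
  have h2 := ((hasDerivAt_id w).add (((hasDerivAt_id w).pow 2).div_const 2)).cexp
  convert! h1.mul h2 using 1
  simp; ring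

lemma norm_primaryFactor_sub_one_le {w : ℂ} (hw : ‖w‖ ≤ 1) :
    ‖primaryFactor w - 1‖ ≤ Real.exp 2 * ‖w‖ ^ 3 := by
  have h := (convex_closedBall (0 : ℂ) ‖w‖).norm_image_sub_le_of_norm_hasDerivWithin_le
    (f := primaryFactor) (C := ‖w‖ ^ 2 * Real.exp 2)
    (fun u _ => (hasDerivAt_primaryFactor u).hasDerivWithinAt)
    (fun u hu => ?_) (x := 0) (y := w) (by simp) (by simp)
  · simp only [sub_zero] at h
    have h0 : primaryFactor 0 = 1 := by simp [primaryFactor]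
    rw [h0] at h
    linarith
  · have hu' : ‖u‖ ≤ ‖w‖ := by simpa using hu
    rw [norm_mul, norm_neg, norm_pow]
    -- Here |u| ≤ 1, so the exponent has norm at most 2.
    have : ‖Complex.exp (u + u ^ 2 / 2)‖ ≤ Real.exp 2 := by
      rw [Complex.norm_exp]
      apply Real.exp_le_exp.mpr
      have h1 := Complex.re_le_norm (u + u ^ 2 / 2)
      have h2 := norm_add_le u (u ^ 2 / 2)
      have h3 : ‖u ^ 2 / 2‖ ≤ 1 := by
        rw [norm_div, norm_pow]
        simp only [Complex.norm_ofNat]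
        nlinarith [norm_nonneg u]
      linarith
    gcongr

lemma sigma_factor_eq (z l : ℂ) :
    (1 - z / l) * Complex.exp (z / l + z ^ 2 / (2 * l ^ 2)) = primaryFactor (z / l) := by
  rw [primaryFactor]
  congr 3
  rw [div_pow, div_div, mul_comm]

lemma norm_sigma_factor_sub_one_le {r : ℝ} {z l : ℂ} (hz : ‖z‖ ≤ r) (hr : 0 < r)
    (hl : r ≤ ‖l‖) :
    ‖primaryFactor (z / l) - 1‖ ≤ Real.exp 2 * r ^ 3 * ‖l‖⁻¹ ^ 3 := by
  have hl0 : 0 < ‖l‖ := by linarith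
  have h1 : ‖z / l‖ ≤ 1 := by
    rw [norm_div, div_le_one hl0]
    linarith
  refine (norm_primaryFactor_sub_one_le h1).trans ?_
  rw [norm_div, div_eq_mul_inv, mul_pow, mul_assoc]
  gcongr

/-- `σ(z)/z`. -/
noncomputable def sigmaProduct (z : ℂ) : ℂ := ∏' l : NonzeroPeriod L, primaryFactor (z / l)

lemma weierstrassSigma_eq (z : ℂ) : weierstrassSigma L z = z * sigmaProduct L z := by
  simp only [weierstrassSigma, sigmaProduct, sigma_factor_eq]

lemma differentiable_primaryFactor : Differentiable ℂ primaryFactor :=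
  fun w => (hasDerivAt_primaryFactor w).differentiableAt

lemma hasProdLocallyUniformlyOn_sigmaProduct :
    HasProdLocallyUniformlyOn (fun (l : NonzeroPeriod L) (z : ℂ) => primaryFactor (z / l))
      (sigmaProduct L) Set.univ := by
  apply hasProdLocallyUniformlyOn_of_forall_compact isOpen_univ
  intro K _ hK
  obtain ⟨r, hr0, hr⟩ := hK.isBounded.exists_pos_norm_le
  have h := Summable.hasProdUniformlyOn_one_add hK
    (f := fun (l : NonzeroPeriod L) (z : ℂ) => primaryFactor (z / l) - 1)
    ((summable_norm_nonzeroPeriod L).mul_left (Real.exp 2 * r ^ 3)) ?_ ?_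
  · simp only [add_sub_cancel] at h
    exact h
  · filter_upwards [eventually_le_norm_nonzeroPeriod L r] with l hl z hz
    exact norm_sigma_factor_sub_one_le (hr z hz) hr0 hl
  · intro l
    exact (((differentiable_primaryFactor.comp (differentiable_id.div_const _)).sub_const
      1).continuous).continuousOn

lemma differentiable_sigmaProduct : Differentiable ℂ (sigmaProduct L) := by
  rw [← differentiableOn_univ]
  refine (hasProdLocallyUniformlyOn_sigmaProduct L).differentiableOn
    (.of_forall fun s => ?_) isOpen_univ
  refine DifferentiableOn.fun_finsetProd fun l _ => ?_
  exact (differentiable_primaryFactor.comp (differentiable_id.div_const _)).differentiableOn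

lemma differentiable_weierstrassSigma : Differentiable ℂ (weierstrassSigma L) := by
  have h : weierstrassSigma L = fun z => z * sigmaProduct L z := funext (weierstrassSigma_eq L)
  rw [h]
  exact differentiable_id.mul (differentiable_sigmaProduct L)

lemma primaryFactor_eq_zero_iff {w : ℂ} : primaryFactor w = 0 ↔ w = 1 := by
  simp [primaryFactor, Complex.exp_ne_zero, sub_eq_zero, eq_comm (a := w)]

lemma primaryFactor_period_ne_zero {z : ℂ} (hz : z ∈ (L.lattice \ {0} : Set ℂ)ᶜ)
    (l : NonzeroPeriod L) : primaryFactor (z / l) ≠ 0 := by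
  rw [ne_eq, primaryFactor_eq_zero_iff, div_eq_one_iff_eq l.2.2]
  exact sub_ne_zero.mp (sub_ne_zero_of_regular L hz l)

lemma summable_norm_primaryFactor_sub_one (z : ℂ) :
    Summable fun l : NonzeroPeriod L => ‖primaryFactor (z / l) - 1‖ := by
  have hr : 0 < ‖z‖ + 1 := by positivity
  refine Summable.of_norm_bounded_eventually
    ((summable_norm_nonzeroPeriod L).mul_left (Real.exp 2 * (‖z‖ + 1) ^ 3)) ?_
  filter_upwards [eventually_le_norm_nonzeroPeriod L (‖z‖ + 1)] with l hl
  rw [norm_norm]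
  exact norm_sigma_factor_sub_one_le (by linarith) hr hl

lemma sigmaProduct_ne_zero {z : ℂ} (hz : z ∈ (L.lattice \ {0} : Set ℂ)ᶜ) :
    sigmaProduct L z ≠ 0 := by
  have h := tprod_one_add_ne_zero_of_summable
    (f := fun l : NonzeroPeriod L => primaryFactor (z / l) - 1)
    (fun l => by simpa using primaryFactor_period_ne_zero L hz l)
    (summable_norm_primaryFactor_sub_one L z)
  simpa [sigmaProduct] using h

lemma sigmaProduct_zero : sigmaProduct L 0 = 1 := by
  simp [sigmaProduct, primaryFactor]

@[simp]
lemma weierstrassSigma_zero : weierstrassSigma L 0 = 0 := by simp [weierstrassSigma_eq]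

lemma weierstrassSigma_eq_zero_iff {z : ℂ} : weierstrassSigma L z = 0 ↔ z ∈ L.lattice := by
  constructor
  · intro h
    by_contra hz
    rw [weierstrassSigma_eq, mul_eq_zero] at h
    rcases h with h | h
    · exact hz (h ▸ L.lattice.zero_mem)
    · exact sigmaProduct_ne_zero L (fun hz' => hz hz'.1) h
  · intro hz
    by_cases h0 : z = 0
    · simp [h0]
    · rw [weierstrassSigma_eq, sigmaProduct,
        (hasProd_zero_of_exists_eq_zero ⟨⟨z, hz, h0⟩, ?_⟩).tprod_eq, mul_zero]
      exact primaryFactor_eq_zero_iff.mpr (div_self h0)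

lemma hasDerivAt_weierstrassSigma_zero : HasDerivAt (weierstrassSigma L) 1 0 := by
  have h : weierstrassSigma L = fun z => z * sigmaProduct L z := funext (weierstrassSigma_eq L)
  rw [h]
  have := (hasDerivAt_id (0 : ℂ)).mul ((differentiable_sigmaProduct L) 0).hasDerivAt
  convert! this using 1
  simp [sigmaProduct_zero]

/-- Negation of nonzero periods. -/
def negPeriod : NonzeroPeriod L ≃ NonzeroPeriod L where
  toFun l := ⟨-l.1, neg_mem l.2.1, neg_ne_zero.mpr l.2.2⟩
  invFun l := ⟨-l.1, neg_mem l.2.1, neg_ne_zero.mpr l.2.2⟩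
  left_inv l := by simp
  right_inv l := by simp

@[simp]
lemma weierstrassSigma_neg (z : ℂ) : weierstrassSigma L (-z) = -weierstrassSigma L z := by
  rw [weierstrassSigma_eq, weierstrassSigma_eq, neg_mul]
  congr 2
  rw [sigmaProduct, ← (negPeriod L).tprod_eq]
  simp [negPeriod, sigmaProduct, neg_div_neg_eq]

lemma hasDerivAt_weierstrassZeta {z : ℂ} (hz : z ∉ L.lattice) :
    HasDerivAt (weierstrassZeta L) (-L.weierstrassP z) z := by
  have hz0 : z ≠ 0 := fun h => hz (h ▸ L.lattice.zero_mem)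
  have h1 := (hasDerivAt_id z).inv hz0
  have h2 := hasDerivAt_zetaRegular L (z := z) (fun h => hz h.1)
  have h3 := h1.add h2
  convert! h3 using 1
  · ext u; simp [weierstrassZeta_eq]
  · have := L.weierstrassPExcept_add 0 z
    simp at this
    rw [← this]
    simp
    ring

lemma logDeriv_sigmaProduct {z : ℂ} (hz : z ∈ (L.lattice \ {0} : Set ℂ)ᶜ) :
    logDeriv (sigmaProduct L) z = zetaRegular L z := by
  have hl : ∀ l : NonzeroPeriod L, logDeriv (fun z => primaryFactor (z / l)) z =
      1 / (z - l) + 1 / (l : ℂ) + z / (l : ℂ) ^ 2 := by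
    intro l
    have h1 : HasDerivAt (fun z => primaryFactor (z / l))
        (-(z / l) ^ 2 * Complex.exp (z / l + (z / l) ^ 2 / 2) * (1 / l)) z :=
      HasDerivAt.comp (h := fun z => z / (l : ℂ)) z (hasDerivAt_primaryFactor (z / l))
        ((hasDerivAt_id z).div_const (l : ℂ))
    have hl0 : (l : ℂ) ≠ 0 := l.2.2
    have hzl := sub_ne_zero_of_regular L hz l
    have hzl' : (l : ℂ) - z ≠ 0 := by rwa [← neg_sub, neg_ne_zero]
    rw [logDeriv_apply, h1.deriv, primaryFactor]
    have he := Complex.exp_ne_zero (z / l + (z / l) ^ 2 / 2)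
    have h2 : 1 - z / l ≠ 0 := by
      rw [one_sub_div hl0]
      exact div_ne_zero hzl' hl0
    rw [mul_assoc, mul_comm (Complex.exp _), ← mul_assoc, mul_div_mul_right _ _ he]
    field_simp
    rw [← neg_sub z (l : ℂ)]
    field_simp
    ring
  have hs : HasSum (fun l : NonzeroPeriod L =>
      (1 / (z - l) + 1 / (l : ℂ) + z / (l : ℂ) ^ 2)) (zetaRegular L z) :=
    (hasSumLocallyUniformlyOn_zetaRegular L _ (isOpen_regular L)).hasSum hz
  have h := logDeriv_tprod_eq_tsum (s := Set.univ) isOpen_univ (Set.mem_univ z)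
    (f := fun (l : NonzeroPeriod L) (z : ℂ) => primaryFactor (z / l))
    (primaryFactor_period_ne_zero L hz)
    (fun l => (differentiable_primaryFactor.comp
      (differentiable_id.div_const _)).differentiableOn)
    (by simp_rw [hl]; exact hs.summable)
    (hasProdLocallyUniformlyOn_sigmaProduct L).multipliableLocallyUniformlyOn
    (sigmaProduct_ne_zero L hz)
  simp_rw [hl] at h
  exact h

lemma hasDerivAt_weierstrassSigma {z : ℂ} (hz : z ∉ L.lattice) :
    HasDerivAt (weierstrassSigma L) (weierstrassZeta L z * weierstrassSigma L z) z := by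
  have hz0 : z ≠ 0 := fun h => hz (h ▸ L.lattice.zero_mem)
  have hz' : z ∈ (L.lattice \ {0} : Set ℂ)ᶜ := fun h => hz h.1
  have h : weierstrassSigma L = fun z => z * sigmaProduct L z := funext (weierstrassSigma_eq L)
  have h1 := (hasDerivAt_id z).mul ((differentiable_sigmaProduct L) z).hasDerivAt
  have h2 := logDeriv_sigmaProduct L hz'
  rw [logDeriv_apply, div_eq_iff (sigmaProduct_ne_zero L hz')] at h2
  rw [h, weierstrassZeta_eq]
  convert! h1 using 1
  rw [h2]
  simp only [id]
  field_simp

end ZetaSigma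

end PrimitivePotential

namespace PrimitivePotential

/-! ### Quasi-periodicity and Liouville's theorem. -/

section Quasiperiodicity

variable (L : PeriodPair)

lemma countable_lattice : (L.lattice : Set ℂ).Countable := by
  have : Countable L.lattice := L.latticeEquivProd.toEquiv.countable_iff.mpr inferInstance
  exact Set.to_countable _

lemma isOpen_compl_lattice : IsOpen ((L.lattice : Set ℂ)ᶜ) := L.isClosed_lattice.isOpen_compl

lemma isPreconnected_compl_lattice : IsPreconnected ((L.lattice : Set ℂ)ᶜ) :=
  ((countable_lattice L).isPathConnected_compl_of_one_lt_rank
    (by simp [Complex.rank_real_complex])).isConnected.isPreconnected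

lemma eventually_notMem_lattice {z : ℂ} (hz : z ∉ L.lattice) : ∀ᶠ u in 𝓝 z, u ∉ L.lattice :=
  (isOpen_compl_lattice L).mem_nhds hz

lemma eventually_notMem_lattice_zero : ∀ᶠ u in 𝓝[≠] (0 : ℂ), u ∉ L.lattice := by
  have h := (isOpen_regular L).mem_nhds (x := 0) (by simp)
  filter_upwards [mem_nhdsWithin_of_mem_nhds h, self_mem_nhdsWithin] with u hu hu0 hu'
  exact hu ⟨hu', hu0⟩

lemma add_notMem_lattice {z l : ℂ} (hl : l ∈ L.lattice) (hz : z ∉ L.lattice) :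
    z + l ∉ L.lattice := by
  rwa [Submodule.add_mem_iff_left _ hl]

/-- The complement of a countable set in the plane is connected. -/
lemma exists_eq_const_of_hasDerivAt_zero {f : ℂ → ℂ}
    (hf : ∀ z, z ∉ L.lattice → HasDerivAt f 0 z) : ∃ c, ∀ z, z ∉ L.lattice → f z = c :=
  (isOpen_compl_lattice L).exists_is_const_of_deriv_eq_zero (isPreconnected_compl_lattice L)
    (fun z hz => (hf z hz).differentiableAt.differentiableWithinAt)
    (fun z hz => (hf z hz).deriv)

lemma weierstrassP_add_mem {l : ℂ} (hl : l ∈ L.lattice) (z : ℂ) :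
    L.weierstrassP (z + l) = L.weierstrassP z := L.weierstrassP_add_coe z ⟨l, hl⟩

lemma derivWeierstrassP_add_mem {l : ℂ} (hl : l ∈ L.lattice) (z : ℂ) :
    L.derivWeierstrassP (z + l) = L.derivWeierstrassP z := L.derivWeierstrassP_add_coe z ⟨l, hl⟩

/-- Quasi-periodicity of the Weierstrass zeta and sigma functions. -/
lemma exists_quasiperiod {l : ℂ} (hl : l ∈ L.lattice) :
    ∃ η c : ℂ, c ≠ 0 ∧ c ^ 2 = Complex.exp (η * l) ∧
      (∀ z, z ∉ L.lattice → weierstrassZeta L (z + l) = weierstrassZeta L z + η) ∧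
      ∀ z, weierstrassSigma L (z + l) = c * Complex.exp (η * z) * weierstrassSigma L z := by
  obtain ⟨η, hη⟩ := exists_eq_const_of_hasDerivAt_zero L
    (f := fun z => weierstrassZeta L (z + l) - weierstrassZeta L z) (fun z hz => by
      have h1 := (hasDerivAt_weierstrassZeta L (add_notMem_lattice L hl hz)).comp_add_const z l
      convert! h1.sub (hasDerivAt_weierstrassZeta L hz) using 1
      rw [weierstrassP_add_mem L hl, sub_self])
  have hη' : ∀ z, z ∉ L.lattice → weierstrassZeta L (z + l) = weierstrassZeta L z + η :=
    fun z hz => by rw [← hη z hz]; ring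
  have hne : ∀ z, z ∉ L.lattice → weierstrassSigma L z ≠ 0 :=
    fun z hz h => hz ((weierstrassSigma_eq_zero_iff L).mp h)
  obtain ⟨c, hc⟩ := exists_eq_const_of_hasDerivAt_zero L
    (f := fun z => weierstrassSigma L (z + l) * Complex.exp (-(η * z)) / weierstrassSigma L z)
    (fun z hz => by
      have h1 := (hasDerivAt_weierstrassSigma L (add_notMem_lattice L hl hz)).comp_add_const z l
      have h2 : HasDerivAt (fun z => Complex.exp (-(η * z))) _ z :=
        ((hasDerivAt_id z).const_mul η).fun_neg.cexp
      convert! (h1.mul h2).div (hasDerivAt_weierstrassSigma L hz) (hne z hz) using 1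
      rw [hη' z hz]
      simp only [id, Pi.mul_apply]
      ring)
  have hσ : ∀ z, weierstrassSigma L (z + l) = c * Complex.exp (η * z) * weierstrassSigma L z := by
    intro z
    by_cases hz : z ∈ L.lattice
    · rw [(weierstrassSigma_eq_zero_iff L).mpr hz,
        (weierstrassSigma_eq_zero_iff L).mpr (add_mem hz hl), mul_zero]
    · rw [← hc z hz, Complex.exp_neg]
      have := hne z hz
      have := Complex.exp_ne_zero (η * z)
      field_simp
  have hw := L.ω₁_div_two_notMem_lattice
  have hc0 : c ≠ 0 := by
    rintro rfl
    apply hne _ (add_notMem_lattice L hl hw)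
    rw [hσ]
    ring
  refine ⟨η, c, hc0, ?_, hη', hσ⟩
  -- Any point off the lattice would do. Evaluating the σ relation at -u - l and at u, and using
  -- that σ is odd, gives 1 = c²e^{-ηl}; this value of c² is what makes φ periodic.
  set u := L.ω₁ / 2
  have h1 := hσ (-u - l)
  rw [sub_add_cancel, ← neg_add', weierstrassSigma_neg, weierstrassSigma_neg, hσ u] at h1
  have h2 := hne u hw
  have h3 : (1 : ℂ) = c ^ 2 * (Complex.exp (η * -(u + l)) * Complex.exp (η * u)) := by
    apply mul_right_cancel₀ h2
    linear_combination -h1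
  rw [← Complex.exp_add, show η * -(u + l) + η * u = -(η * l) by ring, Complex.exp_neg] at h3
  have := Complex.exp_ne_zero (η * l)
  field_simp at h3
  exact h3.symm

/-- Liouville's theorem for elliptic functions. -/
lemma exists_eq_const_of_periodic {f g : ℂ → ℂ} (hper : ∀ l ∈ L.lattice, ∀ z, f (z + l) = f z)
    (hf : ∀ z, z ∉ L.lattice → DifferentiableAt ℂ f z) (hg : DifferentiableAt ℂ g 0)
    (hfg : f =ᶠ[𝓝[≠] 0] g) : ∀ z, z ∉ L.lattice → f z = g 0 := by
  classical
  -- F fills in the removable singularities. It is entire and periodic, hence bounded by its values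
  -- on a compact fundamental domain.
  let F : ℂ → ℂ := fun z => if z ∈ L.lattice then g 0 else f z
  have hFper : ∀ l ∈ L.lattice, ∀ z, F (z + l) = F z := by
    intro l hl z
    simp only [F, Submodule.add_mem_iff_left _ hl, hper l hl]
  have hF0 : DifferentiableAt ℂ F 0 := by
    refine hg.congr_of_eventuallyEq ?_
    rw [eventuallyEq_nhdsWithin_iff] at hfg
    filter_upwards [hfg, eventually_nhdsWithin_iff.mp (eventually_notMem_lattice_zero L)]
      with u hu hu'
    by_cases h0 : u = 0
    · simp [F, h0]
    · simp [F, hu' h0, hu h0]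
  have hF : Differentiable ℂ F := by
    intro z
    by_cases hz : z ∈ L.lattice
    · have h1 : F = fun u => F (u - z) := by
        ext u
        conv_lhs => rw [← sub_add_cancel u z]
        rw [hFper z hz]
      rw [h1]
      exact DifferentiableAt.comp (f := fun u => u - z) z (by simpa using hF0) (by fun_prop)
    · refine (hf z hz).congr_of_eventuallyEq ?_
      filter_upwards [eventually_notMem_lattice L hz] with u hu
      simp [F, hu]
  have hb := (IsZLattice.isCompact_range_of_periodic L.lattice F hF.continuous
    fun z w hw => hFper w hw z).isBounded
  intro z hz
  have h2 := hF.apply_eq_apply_of_bounded hb z 0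
  simpa [F, hz] using h2

end Quasiperiodicity

/-- Two divided differences at 0 remove the double zero. They are defined everywhere, so the
factorization holds for all u although N is analytic only near 0. -/
lemma exists_eq_sq_mul {N : ℂ → ℂ} (hN : AnalyticAt ℂ N 0) (h0 : N 0 = 0)
    (h1 : HasDerivAt N 0 0) :
    ∃ g, AnalyticAt ℂ g 0 ∧ ∀ u, N u = u ^ 2 * g u := by
  have hslope : ∀ {F : ℂ → ℂ}, AnalyticAt ℂ F 0 → AnalyticAt ℂ (dslope F 0) 0 := by
    rintro F ⟨p, hp⟩
    exact ⟨_, hp.has_fpower_series_dslope_fslope⟩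
  refine ⟨dslope (dslope N 0) 0, hslope (hslope hN), fun u => ?_⟩
  have h2 : dslope N 0 0 = 0 := by rw [dslope_same, h1.deriv]
  have h3 := sub_smul_dslope N 0 u
  have h4 := sub_smul_dslope (dslope N 0) 0 u
  rw [h2] at h4
  rw [h0] at h3
  simp only [sub_zero, smul_eq_mul] at h3 h4
  rw [← h3, ← h4]
  ring

lemma hasDerivAt_zero_of_even {N : ℂ → ℂ} (hN : DifferentiableAt ℂ N 0)
    (heven : ∀ u, N (-u) = N u) : HasDerivAt N 0 0 := by
  have h1 := hN.hasDerivAt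
  have h2 : HasDerivAt (fun u => N (-u)) (deriv N 0 * -1) 0 :=
    HasDerivAt.comp (h := fun u : ℂ => -u) 0 (by simpa using h1) (hasDerivAt_neg 0)
  simp only [heven] at h2
  have h3 := h1.unique h2
  have h4 : deriv N 0 = 0 := by linear_combination h3 / 2
  rwa [h4] at h1

/-! ### Identities for ℘ and σ. -/

section Elliptic

variable (L : PeriodPair)

lemma sq_mul_weierstrassP {u : ℂ} (hu : u ≠ 0) :
    u ^ 2 * L.weierstrassP u = 1 + u ^ 2 * L.weierstrassPExcept 0 u := by
  have := L.weierstrassPExcept_add 0 u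
  simp at this
  rw [← this]
  field_simp
  ring

lemma weierstrassSigma_ne_zero {z : ℂ} (hz : z ∉ L.lattice) : weierstrassSigma L z ≠ 0 :=
  fun h => hz ((weierstrassSigma_eq_zero_iff L).mp h)

lemma hasDerivAt_weierstrassP {z : ℂ} (hz : z ∉ L.lattice) :
    HasDerivAt L.weierstrassP (L.derivWeierstrassP z) z := by
  rw [← L.deriv_weierstrassP]
  exact (L.analyticOnNhd_weierstrassP z hz).differentiableAt.hasDerivAt

/-- As a function of u, the σ-quotient plus ℘(u) is elliptic. Its double pole at 0 cancels and
evenness excludes a simple pole, so it is constant; at u = v the quotient vanishes and the constant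
is ℘(v). -/
lemma weierstrassSigma_add_mul_sub {u v : ℂ} (hu : u ∉ L.lattice) (hv : v ∉ L.lattice) :
    weierstrassSigma L (u + v) * weierstrassSigma L (u - v) =
      (L.weierstrassP v - L.weierstrassP u) *
        (weierstrassSigma L u ^ 2 * weierstrassSigma L v ^ 2) := by
  have hσ := differentiable_weierstrassSigma L
  have hσv := weierstrassSigma_ne_zero L hv
  let f : ℂ → ℂ := fun u => weierstrassSigma L (u + v) * weierstrassSigma L (u - v) /
    (weierstrassSigma L u ^ 2 * weierstrassSigma L v ^ 2) + L.weierstrassP u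
  have hper : ∀ l ∈ L.lattice, ∀ z, f (z + l) = f z := by
    intro l hl z
    simp only [f, weierstrassP_add_mem L hl]
    congr 1
    obtain ⟨η, c, hc0, -, -, h⟩ := exists_quasiperiod L hl
    rw [add_right_comm, add_sub_right_comm, h, h, h]
    have h1 : Complex.exp (η * (z + v)) * Complex.exp (η * (z - v)) =
        Complex.exp (η * z) ^ 2 := by
      rw [← Complex.exp_add, ← Complex.exp_nat_mul]
      congr 1
      push_cast
      ring
    have h2 := Complex.exp_ne_zero (η * z)
    rw [show c * Complex.exp (η * (z + v)) * weierstrassSigma L (z + v) *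
      (c * Complex.exp (η * (z - v)) * weierstrassSigma L (z - v)) = (c * Complex.exp (η * z)) ^ 2 *
        (weierstrassSigma L (z + v) * weierstrassSigma L (z - v)) by
        rw [mul_pow, ← h1]; ring, mul_pow (c * Complex.exp (η * z)), mul_assoc]
    exact mul_div_mul_left _ _ (pow_ne_zero 2 (mul_ne_zero hc0 h2))
  have hf : ∀ z, z ∉ L.lattice → DifferentiableAt ℂ f z := by
    intro z hz
    refine DifferentiableAt.add (DifferentiableAt.div (by fun_prop) (by fun_prop) ?_)
      (hasDerivAt_weierstrassP L hz).differentiableAt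
    exact mul_ne_zero (pow_ne_zero 2 (weierstrassSigma_ne_zero L hz)) (pow_ne_zero 2 hσv)
  -- This is u²(f(u) - `weierstrassPExcept 0 u`), written with σ(u)/u so as to be analytic at 0. It
  -- is even and vanishes at 0, hence is divisible by u².
  let n : ℂ → ℂ := fun u => weierstrassSigma L (u + v) * weierstrassSigma L (u - v) /
    (sigmaProduct L u ^ 2 * weierstrassSigma L v ^ 2) + 1
  have hP := differentiable_sigmaProduct L
  have hP0 := sigmaProduct_zero L
  have hPeven : ∀ u, sigmaProduct L (-u) = sigmaProduct L u := by
    intro u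
    by_cases h0 : u = 0
    · simp [h0]
    · have := weierstrassSigma_neg L u
      rw [weierstrassSigma_eq, weierstrassSigma_eq, neg_mul, neg_inj] at this
      exact mul_left_cancel₀ h0 this
  have hn : AnalyticAt ℂ n 0 := by
    refine AnalyticAt.add (AnalyticAt.div ?_ ?_ ?_) analyticAt_const
    · exact Differentiable.analyticAt (by fun_prop) 0
    · exact Differentiable.analyticAt (by fun_prop) 0
    · simp [hP0, hσv]
  have hn0 : n 0 = 0 := by
    simp [n, hP0]
    field_simp
    ring
  have hneven : ∀ u, n (-u) = n u := by
    intro u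
    simp only [n, hPeven]
    rw [show -u + v = -(u - v) by ring, show -u - v = -(u + v) by ring, weierstrassSigma_neg,
      weierstrassSigma_neg, neg_mul_neg, mul_comm (weierstrassSigma L (u - v))]
  obtain ⟨g, hg, hng⟩ := exists_eq_sq_mul hn hn0
    (hasDerivAt_zero_of_even hn.differentiableAt hneven)
  have hfg : f =ᶠ[𝓝[≠] 0] fun u => g u + L.weierstrassPExcept 0 u := by
    filter_upwards [eventually_notMem_lattice_zero L, self_mem_nhdsWithin] with u hu (hu0 : u ≠ 0)
    have h1 := hng u
    have hPu : sigmaProduct L u ≠ 0 := sigmaProduct_ne_zero L fun h => hu h.1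
    have h2 := sq_mul_weierstrassP L hu0
    have h3 : u ^ 2 * f u = u ^ 2 * (g u + L.weierstrassPExcept 0 u) := by
      rw [mul_add _ (g u), ← h1]
      simp only [f, n]
      rw [mul_add, h2, weierstrassSigma_eq L u]
      field_simp
      ring
    exact mul_left_cancel₀ (pow_ne_zero 2 hu0) h3
  have h := exists_eq_const_of_periodic L hper hf (g := fun u => g u + L.weierstrassPExcept 0 u)
    (hg.differentiableAt.add (L.analyticAt_weierstrassPExcept 0).differentiableAt) hfg
  have h1 : f u = f v := (h u hu).trans (h v hv).symm
  simp only [f, sub_self, weierstrassSigma_zero, mul_zero, zero_div, zero_add] at h1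
  have hσu := weierstrassSigma_ne_zero L hu
  rw [← h1]
  field_simp
  ring

lemma sub_or_add_mem_of_weierstrassP_eq {u v : ℂ} (hu : u ∉ L.lattice) (hv : v ∉ L.lattice)
    (h : L.weierstrassP u = L.weierstrassP v) : u - v ∈ L.lattice ∨ u + v ∈ L.lattice := by
  have h1 := weierstrassSigma_add_mul_sub L hu hv
  rw [h, sub_self, zero_mul, mul_eq_zero] at h1
  rcases h1 with h1 | h1
  · exact .inr ((weierstrassSigma_eq_zero_iff L).mp h1)
  · exact .inl ((weierstrassSigma_eq_zero_iff L).mp h1)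

/-- If a were omitted, 1/(℘ - a) would be elliptic without poles and vanish at the periods, hence be
identically 0. -/
lemma exists_weierstrassP_eq (a : ℂ) : ∃ z, z ∉ L.lattice ∧ L.weierstrassP z = a := by
  by_contra! hne
  have h := exists_eq_const_of_periodic L (f := fun z => 1 / (L.weierstrassP z - a))
    (g := fun u => u ^ 2 / (1 + u ^ 2 * (L.weierstrassPExcept 0 u - a)))
    (fun l hl z => by simp only [weierstrassP_add_mem L hl])
    (fun z hz => DifferentiableAt.div (by fun_prop)
      ((hasDerivAt_weierstrassP L hz).differentiableAt.sub_const _)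
      (sub_ne_zero.mpr (hne z hz))) ?_ ?_
  · have h1 := h _ L.ω₁_div_two_notMem_lattice
    have h2 := hne _ L.ω₁_div_two_notMem_lattice
    simp [sub_eq_zero, h2] at h1
  · have := (L.analyticAt_weierstrassPExcept 0).differentiableAt
    exact DifferentiableAt.div (by fun_prop) (by fun_prop) (by simp)
  · filter_upwards [eventually_notMem_lattice_zero L, self_mem_nhdsWithin] with u hu (hu0 : u ≠ 0)
    have h2 := sq_mul_weierstrassP L hu0
    have h3 := sub_ne_zero.mpr (hne u hu)
    have h4 : 1 + u ^ 2 * (L.weierstrassPExcept 0 u - a) = u ^ 2 * (L.weierstrassP u - a) := by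
      linear_combination -h2
    rw [h4]
    field_simp

lemma derivWeierstrassP_half {h : ℂ} (hh : 2 * h ∈ L.lattice) : L.derivWeierstrassP h = 0 := by
  have h1 := derivWeierstrassP_add_mem L hh (-h)
  rw [show -h + 2 * h = h by ring, L.derivWeierstrassP_neg] at h1
  linear_combination h1 / 2

/-- `℘ - ℘(h)` is a square for a half-period `h`. -/
lemma weierstrassP_sub_half {h : ℂ} (hh : 2 * h ∈ L.lattice) (hh' : h ∉ L.lattice) :
    ∃ η d : ℂ, d ≠ 0 ∧ ∀ z, z ∉ L.lattice → L.weierstrassP z - L.weierstrassP h =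
      (d * Complex.exp (η * z) * weierstrassSigma L (z - h) / weierstrassSigma L z) ^ 2 := by
  obtain ⟨η, c, hc, -, -, hσ⟩ := exists_quasiperiod L hh
  have hσh := weierstrassSigma_ne_zero L hh'
  -- As z + h and z - h differ by the period 2h, the product σ(z + h)σ(z - h) is an exponential
  -- times σ(z - h)²; d absorbs the constants.
  obtain ⟨d, hd⟩ := IsAlgClosed.exists_pow_nat_eq
    (-c * Complex.exp (-(η * h)) / weierstrassSigma L h ^ 2) two_pos
  refine ⟨η / 2, d, ?_, fun z hz => ?_⟩
  · rintro rfl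
    have h1 := Complex.exp_ne_zero (-(η * h))
    have : -c * Complex.exp (-(η * h)) / weierstrassSigma L h ^ 2 ≠ 0 :=
      div_ne_zero (mul_ne_zero (neg_ne_zero.mpr hc) h1) (pow_ne_zero 2 hσh)
    exact this (by rw [← hd]; ring)
  · have hσz := weierstrassSigma_ne_zero L hz
    have h1 := weierstrassSigma_add_mul_sub L hz hh'
    have h2 := hσ (z - h)
    rw [show z - h + 2 * h = z + h by ring] at h2
    rw [h2] at h1
    have h3 : Complex.exp (η / 2 * z) ^ 2 = Complex.exp (η * z) := by
      rw [← Complex.exp_nat_mul]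
      congr 1
      push_cast
      ring
    have h4 : Complex.exp (η * (z - h)) = Complex.exp (η * z) * Complex.exp (-(η * h)) := by
      rw [← Complex.exp_add]
      congr 1
      ring
    rw [h4] at h1
    rw [div_pow, mul_pow, mul_pow, hd, h3]
    field_simp
    linear_combination h1

end Elliptic

end PrimitivePotential

namespace PrimitivePotential

/-! ### The function φ as a function of z. -/

section LamePhi

variable (L : PeriodPair)

/-- The two σ factors and the exponential contribute c²e^{-ηl} in total, which is 1. -/
lemma lamePhi_add_mem {w l z : ℂ} (hl : l ∈ L.lattice) (hz : z ∉ L.lattice) (x : ℝ) :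
    lamePhi L w x (z + l) = lamePhi L w x z := by
  obtain ⟨η, c, hc0, hc2, hζ, hσ⟩ := exists_quasiperiod L hl
  have h1 : weierstrassSigma L (w - z) = c * Complex.exp (η * (w - (z + l))) *
      weierstrassSigma L (w - (z + l)) := by
    rw [← hσ]
    congr 1
    ring
  rw [lamePhi, lamePhi, hζ z hz, h1, ← add_assoc, hσ]
  have h2 : Complex.exp (-(weierstrassZeta L z + η) * x) =
      Complex.exp (-weierstrassZeta L z * x) * Complex.exp (-(η * x)) := by
    rw [← Complex.exp_add]
    congr 1
    ring
  have h3 : c * Complex.exp (η * (x - w + z)) * Complex.exp (-(η * x)) *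
      (c * Complex.exp (η * (w - (z + l)))) = 1 := by
    rw [show c * Complex.exp (η * (x - w + z)) * Complex.exp (-(η * x)) *
      (c * Complex.exp (η * (w - (z + l)))) = c ^ 2 * (Complex.exp (η * (x - w + z)) *
        Complex.exp (-(η * x)) * Complex.exp (η * (w - (z + l)))) by ring, hc2,
      ← Complex.exp_add, ← Complex.exp_add, ← Complex.exp_add]
    convert Complex.exp_zero using 2
    ring
  have h4 : c * Complex.exp (η * (w - (z + l))) ≠ 0 := mul_ne_zero hc0 (Complex.exp_ne_zero _)
  rw [h2, eq_comm, ← sub_eq_zero]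
  rw [mul_comm (weierstrassSigma L (x - w)), mul_assoc (c * Complex.exp (η * (w - (z + l)))),
    ← div_div, div_eq_mul_inv _ (c * Complex.exp (η * (w - (z + l)))), ← eq_inv_of_mul_eq_one_left h3]
  ring

lemma analyticAt_weierstrassZeta {z : ℂ} (hz : z ∉ L.lattice) :
    AnalyticAt ℂ (weierstrassZeta L) z := by
  have h : DifferentiableOn ℂ (weierstrassZeta L) ((L.lattice : Set ℂ)ᶜ) := fun z hz =>
    (hasDerivAt_weierstrassZeta L hz).differentiableAt.differentiableWithinAt
  exact h.analyticAt ((isOpen_compl_lattice L).mem_nhds hz)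

lemma analyticAt_weierstrassSigma (z : ℂ) : AnalyticAt ℂ (weierstrassSigma L) z :=
  (differentiable_weierstrassSigma L).analyticAt z

lemma analyticAt_lamePhi {w z : ℂ} {x : ℝ} (hx : x - w ∉ L.lattice) (hz : z ∉ L.lattice)
    (hwz : w - z ∉ L.lattice) : AnalyticAt ℂ (lamePhi L w x) z := by
  have h1 := analyticAt_weierstrassZeta L hz
  have h2 : AnalyticAt ℂ (fun z => weierstrassSigma L (x - w + z)) z :=
    Differentiable.analyticAt ((differentiable_weierstrassSigma L).comp (by fun_prop)) z
  have h3 : AnalyticAt ℂ (fun z => weierstrassSigma L (w - z)) z :=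
    Differentiable.analyticAt ((differentiable_weierstrassSigma L).comp (by fun_prop)) z
  have h4 := weierstrassSigma_ne_zero L hwz
  have h5 := weierstrassSigma_ne_zero L hx
  exact ((h2.mul analyticAt_const).div (analyticAt_const.mul h3) (mul_ne_zero h5 h4)).mul
    ((h1.neg.mul analyticAt_const).cexp)

/-- The pole of `φ²` at a half-period `w` is compensated by the double zero of `℘ - ℘(w)`. -/
lemma exists_norm_sq_lamePhi_le {w : ℂ} (hw2 : 2 * w ∈ L.lattice) (hw : w ∉ L.lattice) (x : ℝ) :
    ∃ K : ℂ → ℂ, (∀ u, u ∉ L.lattice → ContinuousAt K u) ∧ ∀ u, u ∉ L.lattice →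
      ‖lamePhi L w x u‖ ^ 2 * ‖L.weierstrassP u - L.weierstrassP w‖ ≤ ‖K u‖ := by
  obtain ⟨η, d, -, h⟩ := weierstrassP_sub_half L hw2 hw
  refine ⟨fun u => (weierstrassSigma L (x - w + u) * weierstrassSigma L w /
    weierstrassSigma L (x - w) * Complex.exp (-weierstrassZeta L u * x) *
      (d * Complex.exp (η * u) / weierstrassSigma L u)) ^ 2, fun u hu => ?_, fun u hu => ?_⟩
  · have h1 := (analyticAt_weierstrassZeta L hu).continuousAt
    have h2 := (differentiable_weierstrassSigma L).continuous
    have h3 := weierstrassSigma_ne_zero L hu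
    fun_prop (disch := assumption)
  · rw [← norm_pow, ← norm_mul, h u hu, lamePhi]
    -- At the pole itself division by zero makes φ equal to 0, hence an inequality instead of an
    -- equality.
    by_cases h0 : weierstrassSigma L (w - u) = 0
    · simp only [h0, mul_zero, div_zero, zero_mul, norm_zero, ne_eq, OfNat.ofNat_ne_zero,
        not_false_eq_true, zero_pow, norm_nonneg]
    · have h1 : weierstrassSigma L (u - w) = -weierstrassSigma L (w - u) := by
        rw [← weierstrassSigma_neg, neg_sub]
      rw [h1]
      apply le_of_eq
      congr 1
      by_cases h5 : weierstrassSigma L (x - w) = 0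
      · simp [h5]
      have h3 := weierstrassSigma_ne_zero L hu
      field_simp

end LamePhi

/-- The numbers `e₁, e₂, e₃` determined by `k₁, k₂` are the values of `℘` at the half-periods
`h₁, w, h₃`. -/
structure HalfPeriodValues (L : PeriodPair) (k₁ k₂ : ℝ) (h₁ w h₃ : ℂ) : Prop where
  pos : 0 < k₁
  lt : k₁ < k₂
  two_mul_h₁ : 2 * h₁ ∈ L.lattice
  two_mul_w : 2 * w ∈ L.lattice
  two_mul_h₃ : 2 * h₃ ∈ L.lattice
  h₁_notMem : h₁ ∉ L.lattice
  w_notMem : w ∉ L.lattice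
  h₃_notMem : h₃ ∉ L.lattice
  weierstrassP_h₁ : L.weierstrassP h₁ = e₁ k₁ k₂
  weierstrassP_w : L.weierstrassP w = e₂ k₁ k₂
  weierstrassP_h₃ : L.weierstrassP h₃ = e₃ k₁ k₂

lemma e₁_eq (k₁ k₂ : ℝ) : ((e₁ k₁ k₂ : ℝ) : ℂ) = e₃ k₁ k₂ + (k₂ : ℂ) ^ 2 := by
  simp [e₁]

lemma e₂_eq (k₁ k₂ : ℝ) : ((e₂ k₁ k₂ : ℝ) : ℂ) = e₃ k₁ k₂ + (k₁ : ℂ) ^ 2 := by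
  simp [e₂]

lemma e₃_eq (k₁ k₂ : ℝ) : ((e₃ k₁ k₂ : ℝ) : ℂ) = -((k₁ : ℂ) ^ 2 + (k₂ : ℂ) ^ 2) / 3 := by
  simp [e₃]

/-! ### The spectral curve and the separation of its points. -/

namespace HalfPeriodValues

variable {L : PeriodPair} {k₁ k₂ : ℝ} {h₁ w h₃ : ℂ} (H : HalfPeriodValues L k₁ k₂ h₁ w h₃)
include H

lemma sq_sub_sq_ne_zero : (k₁ : ℂ) ^ 2 - (k₂ : ℂ) ^ 2 ≠ 0 := by
  have h1 := H.pos
  have h2 := H.lt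
  have : k₁ ^ 2 - k₂ ^ 2 ≠ 0 := by nlinarith
  exact_mod_cast this

lemma k₁_ne_zero : (k₁ : ℂ) ≠ 0 := by exact_mod_cast H.pos.ne'

lemma k₂_ne_zero : (k₂ : ℂ) ≠ 0 := by exact_mod_cast (H.pos.trans H.lt).ne'

/-- The differential equation of `℘` in terms of the spectral parameter. -/
lemma derivWeierstrassP_sq {z k : ℂ} (hz : z ∉ L.lattice)
    (hk : k ^ 2 = e₃ k₁ k₂ - L.weierstrassP z) :
    L.derivWeierstrassP z ^ 2 =
      -4 * k ^ 2 * ((k ^ 2 + (k₁ : ℂ) ^ 2) * (k ^ 2 + (k₂ : ℂ) ^ 2)) := by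
  have r1 := L.derivWeierstrassP_sq h₁ H.h₁_notMem
  have r2 := L.derivWeierstrassP_sq w H.w_notMem
  have r3 := L.derivWeierstrassP_sq h₃ H.h₃_notMem
  rw [derivWeierstrassP_half L H.two_mul_h₁, H.weierstrassP_h₁, e₁_eq, e₃_eq] at r1
  rw [derivWeierstrassP_half L H.two_mul_w, H.weierstrassP_w, e₂_eq, e₃_eq] at r2
  rw [derivWeierstrassP_half L H.two_mul_h₃, H.weierstrassP_h₃, e₃_eq] at r3
  have hP : L.weierstrassP z = e₃ k₁ k₂ - k ^ 2 := by rw [hk]; ring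
  rw [L.derivWeierstrassP_sq z hz, hP, e₃_eq]
  have hne := H.sq_sub_sq_ne_zero
  set a := (k₁ : ℂ) ^ 2
  set b := (k₂ : ℂ) ^ 2
  -- Subtracting the cubic equations at e₁ and e₂ eliminates g₃; the equation at e₃ later eliminates
  -- g₃ from the claim.
  have hg2 : L.g₂ = 4 / 3 * (a ^ 2 - a * b + b ^ 2) := by
    apply mul_left_cancel₀ hne
    linear_combination r2 - r1
  rw [hg2] at r3 ⊢
  linear_combination -r3

/-- A zero of ℘' makes one of the three factors of ℘'² vanish, so v has the same ℘-value as a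
half-period h, and v ≡ ±h. -/
lemma two_mul_mem_of_derivWeierstrassP_eq_zero {v : ℂ} (hv : v ∉ L.lattice)
    (h : L.derivWeierstrassP v = 0) : 2 * v ∈ L.lattice := by
  have key : ∀ h : ℂ, h ∉ L.lattice → 2 * h ∈ L.lattice → L.weierstrassP v = L.weierstrassP h →
      2 * v ∈ L.lattice := by
    intro h hh hh2 he
    rcases sub_or_add_mem_of_weierstrassP_eq L hv hh he with h1 | h1
    · convert! add_mem (add_mem h1 h1) hh2 using 1
      ring
    · convert! sub_mem (add_mem h1 h1) hh2 using 1
      ring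
  obtain ⟨k, hk⟩ := IsAlgClosed.exists_pow_nat_eq
    ((e₃ k₁ k₂ : ℂ) - L.weierstrassP v) two_pos
  have h1 := H.derivWeierstrassP_sq hv hk
  rw [h] at h1
  have h2 : (k ^ 2) * ((k ^ 2 + (k₁ : ℂ) ^ 2) * (k ^ 2 + (k₂ : ℂ) ^ 2)) = 0 := by
    linear_combination h1 / 4
  rw [mul_eq_zero, mul_eq_zero, hk] at h2
  rcases h2 with h2 | h2 | h2
  · refine key h₃ H.h₃_notMem H.two_mul_h₃ ?_
    rw [H.weierstrassP_h₃]
    linear_combination -h2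
  · refine key w H.w_notMem H.two_mul_w ?_
    rw [H.weierstrassP_w, e₂_eq]
    linear_combination -h2
  · refine key h₁ H.h₁_notMem H.two_mul_h₁ ?_
    rw [H.weierstrassP_h₁, e₁_eq]
    linear_combination -h2

/-- Equal ℘-values give u ≡ ±v. If u ≡ -v, oddness of ℘' forces ℘'(v) = 0, so v is a half-period and
-v ≡ v. -/
lemma sub_mem_of_eq {u v : ℂ} (hu : u ∉ L.lattice) (hv : v ∉ L.lattice)
    (h : L.weierstrassP u = L.weierstrassP v)
    (h' : L.derivWeierstrassP u = L.derivWeierstrassP v) : u - v ∈ L.lattice := by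
  rcases sub_or_add_mem_of_weierstrassP_eq L hu hv h with h1 | h1
  · exact h1
  · have h2 := derivWeierstrassP_add_mem L h1 (-v)
    rw [show -v + (u + v) = u by ring, L.derivWeierstrassP_neg, h'] at h2
    have h3 := H.two_mul_mem_of_derivWeierstrassP_eq_zero hv (by linear_combination h2 / 2)
    convert! sub_mem h1 h3 using 1
    ring

end HalfPeriodValues

end PrimitivePotential

/-! ### Local inversion of k² = e₃ - ℘(z). -/

namespace PrimitivePotential
/-- `f` is, near `k₀`, a holomorphic solution of `k² = e₃ - ℘(f(k))`. -/
def IsLocalSolution (L : PeriodPair) (k₁ k₂ : ℝ) (f : ℂ → ℂ) (k₀ : ℂ) : Prop :=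
  AnalyticAt ℂ f k₀ ∧ ∀ᶠ k in 𝓝 k₀, f k ∉ L.lattice ∧
    k ^ 2 = e₃ k₁ k₂ - L.weierstrassP (f k) ∧
    deriv f k ^ 2 * ((k ^ 2 + (k₁ : ℂ) ^ 2) * (k ^ 2 + (k₂ : ℂ) ^ 2)) = -1 ∧
    L.derivWeierstrassP (f k) * deriv f k = -2 * k

lemma IsLocalSolution.neg {L : PeriodPair} {k₁ k₂ : ℝ} {f : ℂ → ℂ} {k₀ : ℂ}
    (hf : IsLocalSolution L k₁ k₂ f k₀) : IsLocalSolution L k₁ k₂ (-f) k₀ := by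
  refine ⟨hf.1.neg, ?_⟩
  filter_upwards [hf.2] with k ⟨h1, h2, h3, h4⟩
  refine ⟨by simpa using h1, by simpa using h2, ?_, ?_⟩
  · rw [deriv.neg]
    linear_combination h3
  · rw [deriv.neg, Pi.neg_apply, L.derivWeierstrassP_neg]
    linear_combination h4

namespace HalfPeriodValues

variable {L : PeriodPair} {k₁ k₂ : ℝ} {h₁ w h₃ : ℂ} (H : HalfPeriodValues L k₁ k₂ h₁ w h₃)
include H

/-- Away from the branch points the relation `k² = e₃ - ℘(z)` has a local holomorphic solution. -/
lemma exists_local_solution {k₀ : ℂ} (hk₁ : k₀ ^ 2 + (k₁ : ℂ) ^ 2 ≠ 0)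
    (hk₂ : k₀ ^ 2 + (k₂ : ℂ) ^ 2 ≠ 0) :
    ∃ f : ℂ → ℂ, IsLocalSolution L k₁ k₂ f k₀ := by
  obtain ⟨η, d, hd, hsq⟩ := weierstrassP_sub_half L H.two_mul_h₃ H.h₃_notMem
  rw [H.weierstrassP_h₃] at hsq
  -- The holomorphic square root s of ℘ - e₃ turns the relation into k = κs(z) with κ = ±i, to which
  -- the inverse function theorem applies. It applies at k₀ = 0 too: s has a simple zero at h₃,
  -- whereas ℘ - e₃ has a double one.
  let s : ℂ → ℂ := fun z =>
    d * Complex.exp (η * z) * weierstrassSigma L (z - h₃) / weierstrassSigma L z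
  have hsan : ∀ z, z ∉ L.lattice → AnalyticAt ℂ s z := fun z hz => by
    refine AnalyticAt.div (Differentiable.analyticAt ?_ z) (analyticAt_weierstrassSigma L z)
      (weierstrassSigma_ne_zero L hz)
    have := differentiable_weierstrassSigma L
    fun_prop
  have hsd : ∀ z, z ∉ L.lattice → 2 * s z * deriv s z = L.derivWeierstrassP z := by
    intro z hz
    have h1 : HasDerivAt (fun z => L.weierstrassP z - e₃ k₁ k₂) (L.derivWeierstrassP z) z :=
      (hasDerivAt_weierstrassP L hz).sub_const _
    have h2 := (hsan z hz).differentiableAt.hasDerivAt.fun_pow 2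
    have h3 : (fun z => L.weierstrassP z - e₃ k₁ k₂) =ᶠ[𝓝 z] fun z => s z ^ 2 := by
      filter_upwards [eventually_notMem_lattice L hz] with u hu
      exact hsq u hu
    have h4 := (h2.congr_of_eventuallyEq h3).unique h1
    rw [← h4]
    simp
  obtain ⟨z₀, hz₀, hk₀, hs₀⟩ : ∃ z₀, z₀ ∉ L.lattice ∧
      k₀ ^ 2 = e₃ k₁ k₂ - L.weierstrassP z₀ ∧ deriv s z₀ ≠ 0 := by
    by_cases h0 : k₀ = 0
    · refine ⟨h₃, H.h₃_notMem, by rw [H.weierstrassP_h₃, h0]; simp, ?_⟩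
      have h1 : HasDerivAt (fun z => weierstrassSigma L (z - h₃)) 1 h₃ :=
        HasDerivAt.comp_sub_const (f := weierstrassSigma L) h₃ h₃
          (by simpa using hasDerivAt_weierstrassSigma_zero L)
      have h2 : DifferentiableAt ℂ
          (fun z => d * Complex.exp (η * z) / weierstrassSigma L z) h₃ := by
        have := differentiable_weierstrassSigma L
        exact DifferentiableAt.div (by fun_prop) (by fun_prop)
          (weierstrassSigma_ne_zero L H.h₃_notMem)
      have h3 := h2.hasDerivAt.mul h1
      have h4 : s = (fun z => d * Complex.exp (η * z) / weierstrassSigma L z) *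
          fun z => weierstrassSigma L (z - h₃) := by
        ext z
        simp only [s, Pi.mul_apply]
        ring
      rw [h4, h3.deriv]
      simp only [sub_self, weierstrassSigma_zero, mul_zero, zero_add, mul_one]
      exact div_ne_zero (mul_ne_zero hd (Complex.exp_ne_zero _))
        (weierstrassSigma_ne_zero L H.h₃_notMem)
    · obtain ⟨z₀, hz₀, hP⟩ := exists_weierstrassP_eq L (e₃ k₁ k₂ - k₀ ^ 2)
      have hk : k₀ ^ 2 = e₃ k₁ k₂ - L.weierstrassP z₀ := by rw [hP]; ring
      refine ⟨z₀, hz₀, hk, fun hs => ?_⟩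
      have h1 := H.derivWeierstrassP_sq hz₀ hk
      rw [← hsd z₀ hz₀, hs] at h1
      have : k₀ ^ 2 * ((k₀ ^ 2 + (k₁ : ℂ) ^ 2) * (k₀ ^ 2 + (k₂ : ℂ) ^ 2)) ≠ 0 :=
        mul_ne_zero (pow_ne_zero 2 h0) (mul_ne_zero hk₁ hk₂)
      apply this
      linear_combination h1 / 4
  obtain ⟨κ, hκ, hκs⟩ : ∃ κ : ℂ, κ ^ 2 = -1 ∧ κ * s z₀ = k₀ := by
    have h1 : (Complex.I * s z₀) ^ 2 = k₀ ^ 2 := by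
      have := hsq z₀ hz₀
      rw [hk₀, mul_pow, Complex.I_sq]
      linear_combination this
    rcases sq_eq_sq_iff_eq_or_eq_neg.mp h1 with h2 | h2
    · exact ⟨Complex.I, Complex.I_sq, h2⟩
    · exact ⟨-Complex.I, by simp, by linear_combination -h2⟩
  have hκ0 : κ ≠ 0 := by rintro rfl; simp at hκ
  have hF : AnalyticAt ℂ (fun z => κ * s z) z₀ := analyticAt_const.mul (hsan z₀ hz₀)
  have hF' : deriv (fun z => κ * s z) z₀ ≠ 0 := by
    rw [deriv_const_mul _ (hsan z₀ hz₀).differentiableAt]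
    exact mul_ne_zero hκ0 hs₀
  have hfan := hF.analyticAt_localInverse hF'
  have hfr := hF.hasStrictDerivAt.eventually_right_inverse hF'
  have hf0 : hF.hasStrictDerivAt.localInverse _ _ _ hF' (κ * s z₀) = z₀ :=
    HasStrictFDerivAt.localInverse_apply_image ..
  set f := hF.hasStrictDerivAt.localInverse _ _ _ hF'
  rw [hκs] at hfan hfr hf0
  have hmem : ∀ᶠ k in 𝓝 k₀, f k ∉ L.lattice :=
    hfan.continuousAt.eventually (by rw [hf0]; exact eventually_notMem_lattice L hz₀)
  have hrel : ∀ᶠ k in 𝓝 k₀, k ^ 2 = e₃ k₁ k₂ - L.weierstrassP (f k) := by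
    filter_upwards [hmem, hfr] with k hk hk'
    have h1 : L.weierstrassP (f k) - e₃ k₁ k₂ = s (f k) ^ 2 := hsq (f k) hk
    have h2 : κ * s (f k) = k := hk'
    linear_combination (-(κ * s (f k) + k)) * h2 + s (f k) ^ 2 * hκ + h1
  have hder : ∀ᶠ k in 𝓝 k₀, L.derivWeierstrassP (f k) * deriv f k = -2 * k := by
    filter_upwards [hmem, hrel.eventually_nhds, hfan.eventually_analyticAt] with k hk hk' hka
    have h1 : HasDerivAt (fun k => (e₃ k₁ k₂ : ℂ) - L.weierstrassP (f k)) _ k :=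
      (HasDerivAt.comp k (hasDerivAt_weierstrassP L hk) hka.differentiableAt.hasDerivAt).const_sub _
    have h2 : HasDerivAt (fun k : ℂ => k ^ 2) (2 * k) k := by
      simpa using (hasDerivAt_id k).fun_pow 2
    have h3 := (h1.congr_of_eventuallyEq hk').unique h2
    linear_combination -h3
  have hone : ∀ᶠ k in 𝓝 k₀,
      deriv f k ^ 2 * ((k ^ 2 + (k₁ : ℂ) ^ 2) * (k ^ 2 + (k₂ : ℂ) ^ 2)) = -1 := by
    have hc : ContinuousAt (fun k =>
        deriv f k ^ 2 * ((k ^ 2 + (k₁ : ℂ) ^ 2) * (k ^ 2 + (k₂ : ℂ) ^ 2))) k₀ := by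
      have := hfan.deriv.continuousAt
      fun_prop
    -- The identity is derived after division by 4k², so the point k = 0 is reached by continuity.
    refine (hc.eventuallyEq_nhds_iff_eventuallyEq_nhdsNE (g := fun _ => -1)
      continuousAt_const).mp ?_
    have hne : ∀ᶠ k in 𝓝[≠] k₀, k ≠ 0 := by
      by_cases h0 : k₀ = 0
      · rw [h0]
        exact self_mem_nhdsWithin
      · exact (isOpen_ne.mem_nhds h0 : {k : ℂ | k ≠ 0} ∈ 𝓝 k₀) |> mem_nhdsWithin_of_mem_nhds
    filter_upwards [hne, mem_nhdsWithin_of_mem_nhds hmem, mem_nhdsWithin_of_mem_nhds hrel,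
      mem_nhdsWithin_of_mem_nhds hder] with k h0 h1 h2 h3
    have h4 := H.derivWeierstrassP_sq h1 h2
    have h5 : (4 * k ^ 2) ≠ 0 := mul_ne_zero (by norm_num) (pow_ne_zero 2 h0)
    apply mul_left_cancel₀ h5
    linear_combination (deriv f k ^ 2) * h4 - (L.derivWeierstrassP (f k) * deriv f k - 2 * k) * h3
  refine ⟨f, hfan, ?_⟩
  filter_upwards [hmem, hrel, hone, hder] with k h1 h2 h3 h4
  exact ⟨h1, h2, h3, h4⟩

end HalfPeriodValues
end PrimitivePotential

namespace PrimitivePotential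

/-! ### The cut plane and the roots on it. -/

section CutPlane

/-- The quotient whose fourth root appears in `χ`. -/
noncomputable def branchRatio (k₁ k₂ : ℝ) (k : ℂ) : ℂ :=
  (k ^ 2 + (k₁ : ℂ) ^ 2) / (k ^ 2 + (k₂ : ℂ) ^ 2)

/-- The square root of `(k² + k₁²)(k² + k₂²)` on the cut plane that behaves like `k²` at `∞`. -/
noncomputable def spectralRoot (k₁ k₂ : ℝ) (k : ℂ) : ℂ :=
  (k ^ 2 + (k₂ : ℂ) ^ 2) * branchRatio k₁ k₂ k ^ (1 / 2 : ℂ)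

variable {k₁ k₂ : ℝ}

lemma isOpen_cutPlane : IsOpen (cutPlane k₁ k₂) := by
  have h : cutPlane k₁ k₂ = ({k : ℂ | k.re = 0} ∩ ({k : ℂ | k₁ ≤ |k.im|} ∩
      {k : ℂ | |k.im| ≤ k₂}))ᶜ := by
    ext k
    simp [cutPlane]
  rw [h, isOpen_compl_iff]
  refine (isClosed_eq Complex.continuous_re continuous_const).inter
    ((isClosed_le continuous_const ?_).inter (isClosed_le ?_ continuous_const)) <;>
  exact Complex.continuous_im.abs

lemma mem_cutPlane_of_re_ne_zero {k : ℂ} (hk : k.re ≠ 0) : k ∈ cutPlane k₁ k₂ :=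
  fun h => hk h.1

lemma eq_on_cut_of_sq {k : ℂ} {q : ℝ} (hq : 0 < q) (h : k ^ 2 = -(q : ℂ)) :
    k.re = 0 ∧ k.im ^ 2 = q := by
  have h1 := congrArg Complex.re h
  have h2 := congrArg Complex.im h
  simp only [sq, Complex.mul_re, Complex.mul_im, Complex.neg_re, Complex.neg_im,
    Complex.ofReal_re, Complex.ofReal_im, neg_zero] at h1 h2
  have h3 : k.re = 0 := by
    have h4 : k.re * k.im = 0 := by linarith
    rcases mul_eq_zero.mp h4 with h5 | h5
    · exact h5
    · rw [h5] at h1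
      nlinarith [mul_self_nonneg k.re]
  refine ⟨h3, ?_⟩
  rw [h3] at h1
  linarith

/-- The two cuts together are the preimage of [-k₂², -k₁²] under squaring. -/
lemma sq_ne_of_mem_cutPlane (hk₁ : 0 < k₁) (hk₂ : k₁ < k₂) {k : ℂ} (hk : k ∈ cutPlane k₁ k₂)
    {q : ℝ} (hq₁ : k₁ ^ 2 ≤ q) (hq₂ : q ≤ k₂ ^ 2) : k ^ 2 ≠ -(q : ℂ) := by
  intro h
  obtain ⟨h1, h2⟩ := eq_on_cut_of_sq (lt_of_lt_of_le (by positivity) hq₁) h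
  refine hk ⟨h1, ?_, ?_⟩
  · exact abs_le_of_sq_le_sq' (by rw [sq_abs, h2]; exact hq₁) (abs_nonneg _) |>.2
  · exact abs_le_of_sq_le_sq (by rw [h2]; exact hq₂) (hk₁.trans hk₂).le

lemma sq_add_sq_ne_zero₁ (hk₁ : 0 < k₁) (hk₂ : k₁ < k₂) {k : ℂ} (hk : k ∈ cutPlane k₁ k₂) :
    k ^ 2 + (k₁ : ℂ) ^ 2 ≠ 0 := by
  intro h
  refine sq_ne_of_mem_cutPlane hk₁ hk₂ hk (q := k₁ ^ 2) le_rfl (by nlinarith) ?_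
  push_cast
  linear_combination h

lemma sq_add_sq_ne_zero₂ (hk₁ : 0 < k₁) (hk₂ : k₁ < k₂) {k : ℂ} (hk : k ∈ cutPlane k₁ k₂) :
    k ^ 2 + (k₂ : ℂ) ^ 2 ≠ 0 := by
  intro h
  refine sq_ne_of_mem_cutPlane hk₁ hk₂ hk (q := k₂ ^ 2) (by nlinarith) le_rfl ?_
  push_cast
  linear_combination h

lemma branchRatio_mem_slitPlane (hk₁ : 0 < k₁) (hk₂ : k₁ < k₂) {k : ℂ}
    (hk : k ∈ cutPlane k₁ k₂) : branchRatio k₁ k₂ k ∈ Complex.slitPlane := by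
  by_contra h
  rw [Complex.mem_slitPlane_iff, not_or, not_lt, not_not] at h
  obtain ⟨t, ht⟩ : ∃ t : ℝ, branchRatio k₁ k₂ k = -(t : ℂ) := by
    refine ⟨-(branchRatio k₁ k₂ k).re, ?_⟩
    apply Complex.ext <;> simp [h.2]
  have ht0 : 0 ≤ t := by
    have := h.1
    rw [ht] at this
    simpa using this
  have h2 := sq_add_sq_ne_zero₂ hk₁ hk₂ hk
  rw [branchRatio, div_eq_iff h2] at ht
  have h3 : (1 + t : ℂ) ≠ 0 := by
    have : (1 + t : ℝ) ≠ 0 := by positivity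
    exact_mod_cast this
  -- Solving ratio = -t for k² gives minus a convex combination of k₁² and k₂², so k would lie on a
  -- cut.
  refine sq_ne_of_mem_cutPlane hk₁ hk₂ hk (q := (k₁ ^ 2 + t * k₂ ^ 2) / (1 + t)) ?_ ?_ ?_
  · rw [le_div_iff₀ (by positivity)]
    nlinarith [mul_nonneg ht0 (show 0 ≤ k₂ ^ 2 - k₁ ^ 2 by nlinarith)]
  · rw [div_le_iff₀ (by positivity)]
    nlinarith
  · push_cast
    field_simp
    linear_combination ht

lemma analyticAt_branchRatio {k : ℂ} (h : k ^ 2 + (k₂ : ℂ) ^ 2 ≠ 0) :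
    AnalyticAt ℂ (branchRatio k₁ k₂) k := by
  unfold branchRatio
  fun_prop (disch := assumption)

lemma spectralRoot_sq {k : ℂ} (h : k ^ 2 + (k₂ : ℂ) ^ 2 ≠ 0) :
    spectralRoot k₁ k₂ k ^ 2 = (k ^ 2 + (k₁ : ℂ) ^ 2) * (k ^ 2 + (k₂ : ℂ) ^ 2) := by
  have h1 : (branchRatio k₁ k₂ k ^ (1 / 2 : ℂ)) ^ 2 = branchRatio k₁ k₂ k := by
    simp
  rw [spectralRoot, mul_pow, h1, branchRatio]
  field_simp

lemma analyticAt_spectralRoot (hk₁ : 0 < k₁) (hk₂ : k₁ < k₂) {k : ℂ}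
    (hk : k ∈ cutPlane k₁ k₂) : AnalyticAt ℂ (spectralRoot k₁ k₂) k := by
  have h1 := analyticAt_branchRatio (k₁ := k₁) (sq_add_sq_ne_zero₂ hk₁ hk₂ hk)
  have h2 := branchRatio_mem_slitPlane hk₁ hk₂ hk
  unfold spectralRoot
  exact (by fun_prop : AnalyticAt ℂ (fun k : ℂ => k ^ 2 + (k₂ : ℂ) ^ 2) k).mul
    (h1.cpow analyticAt_const h2)

lemma spectralRoot_neg (k : ℂ) : spectralRoot k₁ k₂ (-k) = spectralRoot k₁ k₂ k := by
  simp [spectralRoot, branchRatio]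

lemma tendsto_inv_sq_cobounded :
    Tendsto (fun k : ℂ => (k ^ 2)⁻¹) (Bornology.cobounded ℂ) (𝓝 0) := by
  have h := (tendsto_inv₀_cobounded (α := ℂ)).pow 2
  simpa using h

lemma tendsto_sq_add_sq_div (a : ℂ) :
    Tendsto (fun k : ℂ => (k ^ 2 + a) / k ^ 2) (Bornology.cobounded ℂ) (𝓝 1) := by
  have h := (tendsto_inv_sq_cobounded.const_mul a).const_add 1
  rw [mul_zero, add_zero] at h
  refine h.congr' ?_
  filter_upwards [Bornology.eventually_ne_cobounded (0 : ℂ)] with k hk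
  field_simp

lemma tendsto_spectralRoot_div_sq :
    Tendsto (fun k => spectralRoot k₁ k₂ k / k ^ 2) (Bornology.cobounded ℂ) (𝓝 1) := by
  have h1 := tendsto_sq_add_sq_div ((k₁ : ℂ) ^ 2)
  have h2 := tendsto_sq_add_sq_div ((k₂ : ℂ) ^ 2)
  have h3 : Tendsto (branchRatio k₁ k₂) (Bornology.cobounded ℂ) (𝓝 1) := by
    have := h1.div h2 one_ne_zero
    rw [div_one] at this
    refine this.congr' ?_
    filter_upwards [Bornology.eventually_ne_cobounded (0 : ℂ)] with k hk
    simp only [Pi.div_apply, branchRatio]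
    exact div_div_div_cancel_right₀ (pow_ne_zero 2 hk) _ _
  have h4 : ContinuousAt (fun r : ℂ => r ^ (1 / 2 : ℂ)) 1 :=
    continuousAt_cpow_const (by simp)
  have h5 := h2.mul (h4.tendsto.comp h3)
  rw [Complex.one_cpow, mul_one] at h5
  refine h5.congr fun k => ?_
  simp only [spectralRoot, Function.comp_apply]
  ring

end CutPlane

/-! ### Behaviour at the pole and the sign of ℘' along a branch. -/

section Pole

variable (L : PeriodPair)

lemma tendsto_sq_mul_weierstrassP :
    Tendsto (fun u => u ^ 2 * L.weierstrassP u) (𝓝[≠] 0) (𝓝 (-(-1))) := by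
  have h := (L.analyticAt_weierstrassPExcept 0).continuousAt
  have h1 : ContinuousAt (fun u => 1 + u ^ 2 * L.weierstrassPExcept 0 u) 0 := by fun_prop
  have h2 := h1.tendsto.mono_left (nhdsWithin_le_nhds (s := {0}ᶜ))
  simp only [ne_eq, OfNat.ofNat_ne_zero, not_false_eq_true, zero_pow, zero_mul, add_zero] at h2
  rw [neg_neg]
  refine h2.congr' ?_
  filter_upwards [self_mem_nhdsWithin] with u hu
  exact (sq_mul_weierstrassP L hu).symm

lemma tendsto_cube_mul_derivWeierstrassP :
    Tendsto (fun u => u ^ 3 * L.derivWeierstrassP u) (𝓝[≠] 0) (𝓝 (-2)) := by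
  have h := (L.analyticAt_derivWeierstrassPExcept 0).continuousAt
  have h1 : ContinuousAt (fun u => u ^ 3 * L.derivWeierstrassPExcept 0 u - 2) 0 := by fun_prop
  have h2 := h1.tendsto.mono_left (nhdsWithin_le_nhds (s := {0}ᶜ))
  simp only [ne_eq, OfNat.ofNat_ne_zero, not_false_eq_true, zero_pow, zero_mul, zero_sub] at h2
  refine h2.congr' ?_
  filter_upwards [self_mem_nhdsWithin] with u (hu : u ≠ 0)
  have := L.derivWeierstrassPExcept_sub 0 u
  simp at this
  rw [← this]
  field_simp

lemma tendsto_of_mul_tendsto {z : ℂ → ℂ} {a : ℂ}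
    (h : Tendsto (fun k => k * z k) (Bornology.cobounded ℂ) (𝓝 a)) :
    Tendsto z (Bornology.cobounded ℂ) (𝓝 0) := by
  have h1 := (tendsto_inv₀_cobounded (α := ℂ)).mul h
  rw [zero_mul] at h1
  refine h1.congr' ?_
  filter_upwards [Bornology.eventually_ne_cobounded (0 : ℂ)] with k hk
  field_simp

end Pole

section Branch

variable {L : PeriodPair} {k₁ k₂ : ℝ} {z : ℂ → ℂ}
  (hz : IsSpectralBranch L k₁ k₂ (e₃ k₁ k₂) z)
include hz

/-- A periodic F does not see the lattice jumps of z, which may therefore be replaced by a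
holomorphic representative. -/
lemma IsSpectralBranch.analyticAt_comp {F : ℂ → ℂ} (hF : ∀ u, u ∉ L.lattice → ∀ l ∈ L.lattice,
    F (u + l) = F u) {k₀ : ℂ} (hk₀ : k₀ ∈ cutPlane k₁ k₂) (hFan : AnalyticAt ℂ F (z k₀)) :
    AnalyticAt ℂ (fun k => F (z k)) k₀ := by
  obtain ⟨f, hf, hzf⟩ := hz.analytic_mod_lattice k₀ hk₀
  set l := z k₀ - f k₀
  have hl : l ∈ L.lattice := hzf.self_of_nhds
  have h1 : AnalyticAt ℂ (fun k => F (f k + l)) k₀ := by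
    refine AnalyticAt.fun_comp (g := F) ?_ (hf.add analyticAt_const)
    simpa [l] using hFan
  refine h1.congr ?_
  filter_upwards [hzf, isOpen_cutPlane.mem_nhds hk₀] with k hk hkD
  have h2 := hF (z k) (hz.notMem_lattice k hkD) (f k + l - z k) (by
    convert! sub_mem hl hk using 1
    ring)
  rw [← h2]
  congr 1
  ring

lemma IsSpectralBranch.tendsto_derivWeierstrassP :
    Tendsto (fun k => L.derivWeierstrassP (z k) / k ^ 3) (Bornology.cobounded ℂ)
      (𝓝 (2 * Complex.I)) := by
  have h0 := tendsto_of_mul_tendsto hz.at_infinity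
  have hne : ∀ᶠ k in Bornology.cobounded ℂ, k * z k ≠ 0 :=
    hz.at_infinity.eventually_ne (by simp)
  have h1 : Tendsto z (Bornology.cobounded ℂ) (𝓝[≠] 0) := by
    refine tendsto_nhdsWithin_iff.mpr ⟨h0, ?_⟩
    filter_upwards [hne] with k hk
    exact right_ne_zero_of_mul hk
  have h2 := ((tendsto_cube_mul_derivWeierstrassP L).comp h1).div (hz.at_infinity.pow 3)
    (by simp)
  have h3 : (-2 : ℂ) / (-Complex.I) ^ 3 = 2 * Complex.I := by
    rw [div_eq_iff (by simp)]
    linear_combination (-2 + 2 * Complex.I ^ 2) * Complex.I_sq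
  rw [h3] at h2
  refine h2.congr' ?_
  filter_upwards [hne] with k hk
  have hk0 := left_ne_zero_of_mul hk
  have hz0 := right_ne_zero_of_mul hk
  simp only [Pi.div_apply, Function.comp_apply]
  field_simp

end Branch

namespace HalfPeriodValues

variable {L : PeriodPair} {k₁ k₂ : ℝ} {h₁ w h₃ : ℂ} (H : HalfPeriodValues L k₁ k₂ h₁ w h₃)
include H

lemma derivWeierstrassP_sq_eq_spectralRoot {z k : ℂ} (hk : k ∈ cutPlane k₁ k₂)
    (hz : z ∉ L.lattice) (h : k ^ 2 = e₃ k₁ k₂ - L.weierstrassP z) :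
    L.derivWeierstrassP z ^ 2 = (2 * Complex.I * k * spectralRoot k₁ k₂ k) ^ 2 := by
  rw [H.derivWeierstrassP_sq hz h, mul_pow,
    spectralRoot_sq (sq_add_sq_ne_zero₂ H.pos H.lt hk), mul_pow, mul_pow, Complex.I_sq]
  ring

lemma spectralRoot_ne_zero {k : ℂ} (hk : k ∈ cutPlane k₁ k₂) : spectralRoot k₁ k₂ k ≠ 0 := by
  have h2 := sq_add_sq_ne_zero₂ H.pos H.lt hk
  have h := spectralRoot_sq (k₁ := k₁) h2
  intro h0
  rw [h0] at h
  exact mul_ne_zero (sq_add_sq_ne_zero₁ H.pos H.lt hk) h2 (by rw [← h]; ring)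

variable {z : ℂ → ℂ} (hz : IsSpectralBranch L k₁ k₂ (e₃ k₁ k₂) z)
include hz

/-- Two continuous functions with equal squares and no zeros on a connected set agree up to one
global sign. A half-plane off the imaginary axis avoids the cuts and the zero at k = 0; the
asymptotics along s, 2s, 3s, … exclude the minus sign. -/
lemma derivWeierstrassP_branch_of_halfPlane {U : Set ℂ} (hU : IsPreconnected U)
    (hU0 : ∀ k ∈ U, k.re ≠ 0) {s : ℂ} (hs : s ≠ 0) (hsU : ∀ n : ℕ, s * (n + 1) ∈ U) :
    ∀ k ∈ U, L.derivWeierstrassP (z k) = 2 * Complex.I * k * spectralRoot k₁ k₂ k := by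
  have hUD : ∀ k ∈ U, k ∈ cutPlane k₁ k₂ := fun k hk => mem_cutPlane_of_re_ne_zero (hU0 k hk)
  have hT : ContinuousOn (fun k => L.derivWeierstrassP (z k)) U := fun k hk =>
    (hz.analyticAt_comp (fun u _ l hl => derivWeierstrassP_add_mem L hl u) (hUD k hk)
      (L.analyticOnNhd_derivWeierstrassP _
        (hz.notMem_lattice k (hUD k hk)))).continuousAt.continuousWithinAt
  have hS : ContinuousOn (fun k => 2 * Complex.I * k * spectralRoot k₁ k₂ k) U := fun k hk => by
    have := (analyticAt_spectralRoot H.pos H.lt (hUD k hk)).continuousAt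
    exact ContinuousAt.continuousWithinAt (by fun_prop)
  rcases hU.eq_or_eq_neg_of_sq_eq hT hS (fun k hk => by
      simpa using H.derivWeierstrassP_sq_eq_spectralRoot (hUD k hk)
        (hz.notMem_lattice k (hUD k hk)) (hz.sq_eq k (hUD k hk)))
    (fun {k} hk => by
      have hk0 : k ≠ 0 := fun h => hU0 k hk (by simp [h])
      exact mul_ne_zero (mul_ne_zero (by simp) hk0) (H.spectralRoot_ne_zero (hUD k hk))) with h | h
  · exact h
  · exfalso
    have hseq : Tendsto (fun n : ℕ => s * (n + 1 : ℂ)) atTop (Bornology.cobounded ℂ) := by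
      rw [← tendsto_norm_atTop_iff_cobounded]
      have h1 : Tendsto (fun n : ℕ => ‖s‖ * ((n : ℝ) + 1)) atTop atTop :=
        (tendsto_natCast_atTop_atTop.atTop_add tendsto_const_nhds).const_mul_atTop
          (norm_pos_iff.mpr hs)
      refine h1.congr fun n => ?_
      rw [norm_mul]
      congr 1
      rw [show (n + 1 : ℂ) = ((n + 1 : ℕ) : ℂ) by push_cast; ring, Complex.norm_natCast]
      push_cast
      ring
    have h1 := (hz.tendsto_derivWeierstrassP).comp hseq
    have h2 := ((tendsto_spectralRoot_div_sq (k₁ := k₁) (k₂ := k₂)).comp hseq).const_mul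
      (-(2 * Complex.I))
    have h3 := h1.congr' (f₂ := fun n : ℕ => -(2 * Complex.I) *
      ((fun k => spectralRoot k₁ k₂ k / k ^ 2) ∘ fun n : ℕ => s * (n + 1 : ℂ)) n) (by
        filter_upwards with n
        have h4 := h (hsU n)
        have h5 : s * (n + 1 : ℂ) ≠ 0 := fun h0 => hU0 _ (hsU n) (by simp [h0])
        simp only [Pi.neg_apply] at h4
        simp only [Function.comp_apply]
        rw [h4]
        generalize s * (n + 1 : ℂ) = k at h5
        field_simp)
    have h4 := tendsto_nhds_unique h2 h3
    have h5 : (4 : ℂ) * Complex.I = 0 := by linear_combination -h4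
    simp at h5

/-- A branch is determined modulo the periods by the value of `℘'`. -/
lemma derivWeierstrassP_branch {k : ℂ} (hk : k ∈ cutPlane k₁ k₂) :
    L.derivWeierstrassP (z k) = 2 * Complex.I * k * spectralRoot k₁ k₂ k := by
  have hright : ∀ k : ℂ, 0 < k.re →
      L.derivWeierstrassP (z k) = 2 * Complex.I * k * spectralRoot k₁ k₂ k :=
    H.derivWeierstrassP_branch_of_halfPlane hz (U := {k | 0 < k.re})
      (convex_halfSpace_re_gt 0).isPreconnected (fun k hk => ne_of_gt hk) (s := 1) one_ne_zero
      (fun n => by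
        have : (0 : ℝ) < n + 1 := by positivity
        simpa using this)
  have hleft : ∀ k : ℂ, k.re < 0 →
      L.derivWeierstrassP (z k) = 2 * Complex.I * k * spectralRoot k₁ k₂ k :=
    H.derivWeierstrassP_branch_of_halfPlane hz (U := {k | k.re < 0})
      (convex_halfSpace_re_lt 0).isPreconnected (fun k hk => ne_of_lt hk) (s := -1) (by simp)
      (fun n => by
        have : (0 : ℝ) < n + 1 := by positivity
        simp
        linarith)
  rcases lt_trichotomy k.re 0 with h | h | h
  · exact hleft k h
  -- Points of the imaginary axis off the cuts are reached by continuity from the right half-plane.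
  · have hT := (hz.analyticAt_comp (fun u _ l hl => derivWeierstrassP_add_mem L hl u) hk
      (L.analyticOnNhd_derivWeierstrassP _ (hz.notMem_lattice k hk))).continuousAt
    have hS : ContinuousAt (fun k => 2 * Complex.I * k * spectralRoot k₁ k₂ k) k := by
      have := (analyticAt_spectralRoot H.pos H.lt hk).continuousAt
      fun_prop
    have hcl : k ∈ closure {k : ℂ | 0 < k.re} := by
      rw [Complex.closure_setOfPred_lt_re]
      exact h.ge
    have := mem_closure_iff_nhdsWithin_neBot.mp hcl
    refine tendsto_nhds_unique (hT.tendsto.mono_left nhdsWithin_le_nhds)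
      ((hS.tendsto.mono_left nhdsWithin_le_nhds).congr' ?_) (l := 𝓝[{k : ℂ | 0 < k.re}] k)
    filter_upwards [self_mem_nhdsWithin] with u hu
    exact (hright u hu).symm
  · exact hright k h

lemma branch_sub_mem {k u : ℂ} (hk : k ∈ cutPlane k₁ k₂) (hu : u ∉ L.lattice)
    (h : k ^ 2 = e₃ k₁ k₂ - L.weierstrassP u)
    (h' : L.derivWeierstrassP u = 2 * Complex.I * k * spectralRoot k₁ k₂ k) :
    z k - u ∈ L.lattice :=
  H.sub_mem_of_eq (hz.notMem_lattice k hk) hu (by linear_combination hz.sq_eq k hk - h)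
    (by rw [H.derivWeierstrassP_branch hz hk, h'])

end HalfPeriodValues
end PrimitivePotential

/-! ### Fibers and existence of the branch. -/

namespace PrimitivePotential

lemma eventually_mem_cutPlane_cobounded {k₁ k₂ : ℝ} :
    ∀ᶠ k in Bornology.cobounded ℂ, k ∈ cutPlane k₁ k₂ := by
  filter_upwards [tendsto_norm_cobounded_atTop.eventually_gt_atTop k₂] with k hk
  rintro ⟨h2, -, h3⟩
  have h4 := Complex.norm_le_abs_re_add_abs_im k
  rw [h2, abs_zero] at h4
  linarith

namespace HalfPeriodValues

variable {L : PeriodPair} {k₁ k₂ : ℝ} {h₁ w h₃ : ℂ} (H : HalfPeriodValues L k₁ k₂ h₁ w h₃)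
include H

/-- The points over `k` of the spectral curve. -/
def fiber (_ : HalfPeriodValues L k₁ k₂ h₁ w h₃) (k : ℂ) : Set ℂ :=
  {u | u ∉ L.lattice ∧ k ^ 2 = e₃ k₁ k₂ - L.weierstrassP u ∧
    L.derivWeierstrassP u = 2 * Complex.I * k * spectralRoot k₁ k₂ k}

lemma mem_or_neg_mem_fiber {k u : ℂ} (hk : k ∈ cutPlane k₁ k₂) (hu : u ∉ L.lattice)
    (h : k ^ 2 = e₃ k₁ k₂ - L.weierstrassP u) : u ∈ H.fiber k ∨ -u ∈ H.fiber k := by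
  rcases sq_eq_sq_iff_eq_or_eq_neg.mp (H.derivWeierstrassP_sq_eq_spectralRoot hk hu h) with h1 | h1
  · exact .inl ⟨hu, h, h1⟩
  · refine .inr ⟨by simpa using hu, by simpa using h, ?_⟩
    rw [L.derivWeierstrassP_neg, h1, neg_neg]

lemma sub_mem_of_mem_fiber {k u v : ℂ} (hu : u ∈ H.fiber k) (hv : v ∈ H.fiber k) :
    u - v ∈ L.lattice :=
  H.sub_mem_of_eq hu.1 hv.1 (by linear_combination hu.2.1 - hv.2.1) (by rw [hu.2.2, hv.2.2])

lemma fiber_nonempty {k : ℂ} (hk : k ∈ cutPlane k₁ k₂) : (H.fiber k).Nonempty := by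
  obtain ⟨u, hu, hP⟩ := exists_weierstrassP_eq L (e₃ k₁ k₂ - k ^ 2)
  rcases H.mem_or_neg_mem_fiber hk hu (by rw [hP]; ring) with h | h
  exacts [⟨_, h⟩, ⟨_, h⟩]

/-- The sign of the local solution is detected by the (one-sided) limit of the root. -/
lemma eventually_mem_fiber {f : ℂ → ℂ} {k₀ S₀ : ℂ} (hf : IsLocalSolution L k₁ k₂ f k₀)
    {l : Filter ℂ} (hl : l ≤ 𝓝 k₀) (hlD : ∀ᶠ k in l, k ∈ cutPlane k₁ k₂)
    (hS : Tendsto (spectralRoot k₁ k₂) l (𝓝 S₀)) (h : deriv f k₀ * S₀ = Complex.I) :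
    ∀ᶠ k in l, f k ∈ H.fiber k := by
  have h1 : Tendsto (fun k => deriv f k * spectralRoot k₁ k₂ k) l (𝓝 Complex.I) := by
    rw [← h]
    exact (hf.1.deriv.continuousAt.tendsto.mono_left hl).mul hS
  filter_upwards [hl hf.2, hlD, h1.eventually_ne (b₂ := -Complex.I) (by
    intro h0
    have : (2 : ℂ) * Complex.I = 0 := by linear_combination h0
    simp at this)] with k ⟨h2, h3, h4, h5⟩ hkD h6
  refine ⟨h2, h3, ?_⟩
  have h7 : (deriv f k * spectralRoot k₁ k₂ k) ^ 2 = Complex.I ^ 2 := by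
    rw [mul_pow, spectralRoot_sq (sq_add_sq_ne_zero₂ H.pos H.lt hkD), h4, Complex.I_sq]
  rcases sq_eq_sq_iff_eq_or_eq_neg.mp h7 with h8 | h8
  -- Multiplying ℘'(f)f' = -2k by S and inserting f'S = i gives ℘'(f) = 2ikS.
  · linear_combination (-Complex.I * spectralRoot k₁ k₂ k) * h5 +
      Complex.I * L.derivWeierstrassP (f k) * h8 + L.derivWeierstrassP (f k) * Complex.I_sq
  · exact absurd h8 h6

lemma exists_mem_fiber_near {k₀ : ℂ} (hk₀ : k₀ ∈ cutPlane k₁ k₂) :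
    ∃ f, AnalyticAt ℂ f k₀ ∧ ∀ᶠ k in 𝓝 k₀, f k ∈ H.fiber k := by
  obtain ⟨f, hf⟩ := H.exists_local_solution (sq_add_sq_ne_zero₁ H.pos H.lt hk₀)
    (sq_add_sq_ne_zero₂ H.pos H.lt hk₀)
  have h1 : (deriv f k₀ * spectralRoot k₁ k₂ k₀) ^ 2 = Complex.I ^ 2 := by
    rw [mul_pow, spectralRoot_sq (sq_add_sq_ne_zero₂ H.pos H.lt hk₀), hf.2.self_of_nhds.2.2.1,
      Complex.I_sq]
  have hS := (analyticAt_spectralRoot H.pos H.lt hk₀).continuousAt.tendsto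
  have hD := isOpen_cutPlane.mem_nhds hk₀
  rcases sq_eq_sq_iff_eq_or_eq_neg.mp h1 with h2 | h2
  · exact ⟨f, hf.1, H.eventually_mem_fiber hf le_rfl hD hS h2⟩
  · refine ⟨-f, hf.1.neg, H.eventually_mem_fiber hf.neg le_rfl hD hS ?_⟩
    rw [deriv.neg, neg_mul, h2, neg_neg]

/-- Near 0 the function 1/(℘ - e₃) extends to the nonconstant analytic function u²/A(u), which is
open there and so attains every small value -1/k² close to 0. -/
lemma eventually_exists_mem_fiber_norm_lt {ε : ℝ} (hε : 0 < ε) :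
    ∀ᶠ k in Bornology.cobounded ℂ, ∃ u ∈ H.fiber k, ‖u‖ < ε := by
  let A : ℂ → ℂ := fun u => 1 + u ^ 2 * (L.weierstrassPExcept 0 u - e₃ k₁ k₂)
  have hP := L.analyticAt_weierstrassPExcept 0
  have hA : AnalyticAt ℂ A 0 := by
    simp only [A]
    fun_prop
  have hA0 : A 0 = 1 := by simp [A]
  have hAne : ∀ᶠ u in 𝓝 0, A u ≠ 0 := hA.continuousAt.eventually_ne (by simp [hA0])
  have hB : AnalyticAt ℂ (fun u => u ^ 2 / A u) 0 :=
    (analyticAt_id.pow 2).div hA (by simp [hA0])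
  have hopen : 𝓝 (0 : ℂ) ≤ map (fun u => u ^ 2 / A u) (𝓝 0) := by
    rcases hB.eventually_constant_or_nhds_le_map_nhds with h | h
    · exfalso
      have h1 : ∀ᶠ u in 𝓝[≠] (0 : ℂ), False := by
        filter_upwards [mem_nhdsWithin_of_mem_nhds h, mem_nhdsWithin_of_mem_nhds hAne,
          self_mem_nhdsWithin] with u h1 h2 (h3 : u ≠ 0)
        simp [h2, h3] at h1
      simpa using h1.exists
    · simpa using h
  have hV : ∀ᶠ u in 𝓝 (0 : ℂ), A u ≠ 0 ∧ (u ≠ 0 → u ∉ L.lattice) ∧ ‖u‖ < ε := by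
    have h1 : ∀ᶠ u in 𝓝 (0 : ℂ), ‖u‖ < ε := by
      filter_upwards [Metric.ball_mem_nhds (0 : ℂ) hε] with u hu
      simpa using hu
    filter_upwards [hAne, eventually_nhdsWithin_iff.mp (eventually_notMem_lattice_zero L), h1]
      with u h2 h3 h4
    exact ⟨h2, h3, h4⟩
  have himg := hopen (image_mem_map hV)
  have hlim := tendsto_inv_sq_cobounded.neg
  rw [neg_zero] at hlim
  have hD : ∀ᶠ k in Bornology.cobounded ℂ, k ∈ cutPlane k₁ k₂ :=
    eventually_mem_cutPlane_cobounded
  filter_upwards [hlim.eventually himg, hD, Bornology.eventually_ne_cobounded (0 : ℂ)]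
    with k ⟨u, ⟨hu1, hu2, hu3⟩, hu4⟩ hkD hk0
  have hu0 : u ≠ 0 := by
    rintro rfl
    simp at hu4
    exact hk0 hu4
  have hu := hu2 hu0
  have h1 : k ^ 2 = e₃ k₁ k₂ - L.weierstrassP u := by
    have h2 := sq_mul_weierstrassP L hu0
    have h3 : A u = u ^ 2 * (L.weierstrassP u - e₃ k₁ k₂) := by
      simp only [A]
      linear_combination -h2
    rw [div_eq_iff hu1, h3] at hu4
    apply mul_left_cancel₀ (pow_ne_zero 2 hu0)
    field_simp at hu4
    linear_combination u ^ 2 * hu4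
  rcases H.mem_or_neg_mem_fiber hkD hu h1 with h | h
  · exact ⟨u, h, hu3⟩
  · exact ⟨-u, h, by rwa [norm_neg]⟩

/-- Existence of the spectral branch: choose points of almost minimal norm in the fibers. -/
lemma exists_isSpectralBranch : ∃ z, IsSpectralBranch L k₁ k₂ (e₃ k₁ k₂) z := by
  -- The choice need not be continuous, since holomorphy is asked only modulo Λ. The slack 1/(1 +
  -- |k|) tends to 0, so z(k) → 0.
  have hch : ∀ k : ℂ, ∃ u, k ∈ cutPlane k₁ k₂ → u ∈ H.fiber k ∧
      ∀ v ∈ H.fiber k, ‖u‖ < ‖v‖ + (1 + ‖k‖)⁻¹ := by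
    intro k
    by_cases hk : k ∈ cutPlane k₁ k₂
    swap
    · exact ⟨0, fun h => absurd h hk⟩
    have hb : BddBelow (norm '' H.fiber k) :=
      ⟨0, by rintro _ ⟨u, -, rfl⟩; exact norm_nonneg u⟩
    obtain ⟨_, ⟨u, hu, rfl⟩, hlt⟩ := Real.lt_sInf_add_pos
      ((H.fiber_nonempty hk).image norm) (show 0 < (1 + ‖k‖)⁻¹ by positivity)
    refine ⟨u, fun _ => ⟨hu, fun v hv => ?_⟩⟩
    have := csInf_le hb ⟨v, hv, rfl⟩
    linarith
  choose z hz using hch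
  have hD : ∀ᶠ k in Bornology.cobounded ℂ, k ∈ cutPlane k₁ k₂ :=
    eventually_mem_cutPlane_cobounded
  have hk0 := Bornology.eventually_ne_cobounded (0 : ℂ)
  have hz0 : Tendsto z (Bornology.cobounded ℂ) (𝓝 0) := by
    rw [Metric.tendsto_nhds]
    intro ε hε
    have h1 : Tendsto (fun k : ℂ => (1 + ‖k‖)⁻¹) (Bornology.cobounded ℂ) (𝓝 0) :=
      (tendsto_atTop_add_const_left _ 1 tendsto_norm_cobounded_atTop).inv_tendsto_atTop
    filter_upwards [H.eventually_exists_mem_fiber_norm_lt (half_pos hε), hD,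
      h1.eventually_lt_const (half_pos hε)] with k ⟨u, hu, hu'⟩ hk hk'
    have := (hz k hk).2 u hu
    rw [dist_zero_right]
    linarith
  have hz1 : Tendsto z (Bornology.cobounded ℂ) (𝓝[≠] 0) := by
    refine tendsto_nhdsWithin_iff.mpr ⟨hz0, ?_⟩
    filter_upwards [hD] with k hk
    exact fun h => (hz k hk).1.1 ((Set.mem_singleton_iff.mp h) ▸ L.lattice.zero_mem)
  refine ⟨z, fun k hk => (hz k hk).1.1, fun k hk => (hz k hk).1.2.1, fun k₀ hk₀ => ?_, ?_⟩
  · obtain ⟨f, hf, hf'⟩ := H.exists_mem_fiber_near hk₀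
    refine ⟨f, hf, ?_⟩
    filter_upwards [hf', isOpen_cutPlane.mem_nhds hk₀] with k hk hkD
    exact H.sub_mem_of_mem_fiber (hz k hkD).1 hk
  · have h2 : Tendsto (fun k => (k * z k) ^ 2) (Bornology.cobounded ℂ) (𝓝 (-1)) := by
      have h3 := ((hz0.pow 2).const_mul (e₃ k₁ k₂ : ℂ)).sub
        ((tendsto_sq_mul_weierstrassP L).comp hz1)
      rw [show (e₃ k₁ k₂ : ℂ) * 0 ^ 2 - -(-1) = -1 by norm_num] at h3
      refine h3.congr' ?_
      filter_upwards [hD] with k hk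
      rw [Function.comp_apply, mul_pow, (hz k hk).1.2.1]
      ring
    have h3 : Tendsto (fun k => (k * z k) ^ 3) (Bornology.cobounded ℂ)
        (𝓝 (-2 / (2 * Complex.I * 1))) := by
      refine (((tendsto_cube_mul_derivWeierstrassP L).comp hz1).div
        ((tendsto_spectralRoot_div_sq (k₁ := k₁) (k₂ := k₂)).const_mul (2 * Complex.I))
        (by simp)).congr' ?_
      filter_upwards [hD, hk0] with k hk hk0
      have hS := H.spectralRoot_ne_zero hk
      rw [Pi.div_apply, Function.comp_apply, (hz k hk).1.2.2]
      field_simp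
    -- The relation alone gives (kz)² → -1; the cube, controlled by ℘', settles the sign of kz.
    have h4 := h3.div h2 (by simp)
    have h5 : (-2 / (2 * Complex.I * 1) / -1 : ℂ) = -Complex.I := by
      rw [div_div, div_eq_iff (by simp)]
      linear_combination (-2 : ℂ) * Complex.I_sq
    rw [h5] at h4
    refine h4.congr' ?_
    filter_upwards [hk0, h2.eventually_ne (b₂ := 0) (by simp)] with k hk hk'
    rw [Pi.div_apply, pow_succ, mul_div_right_comm, div_self hk', one_mul]

end HalfPeriodValues
end PrimitivePotential

namespace PrimitivePotential

/-! ### Boundary values on the cuts. -/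

section OneSided

variable {k₁ k₂ : ℝ}

/-- One-sided approach to the point `ip`, from the right if `s = 1` and from the left if
`s = -1`. -/
noncomputable def sideFilter (s p : ℝ) : Filter ℂ := 𝓝[{k : ℂ | 0 < s * k.re}] (Complex.I * p)

lemma sideFilter_le (s p : ℝ) : sideFilter s p ≤ 𝓝 (Complex.I * p) := nhdsWithin_le_nhds

lemma eventually_mem_cutPlane_sideFilter (s p : ℝ) :
    ∀ᶠ k in sideFilter s p, k ∈ cutPlane k₁ k₂ := by
  filter_upwards [self_mem_nhdsWithin] with k (hk : 0 < s * k.re)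
  exact mem_cutPlane_of_re_ne_zero (right_ne_zero_of_mul hk.ne')

lemma tendsto_neg_sideFilter (s p : ℝ) :
    Tendsto (fun k : ℂ => -k) (sideFilter s (-p)) (sideFilter (-s) p) := by
  refine tendsto_nhdsWithin_iff.mpr ⟨?_, ?_⟩
  · refine Tendsto.mono_left ?_ (sideFilter_le s (-p))
    convert (continuous_neg (G := ℂ)).tendsto (Complex.I * ((-p : ℝ) : ℂ)) using 2
    push_cast
    ring
  · filter_upwards [self_mem_nhdsWithin] with k (hk : 0 < s * k.re)
    simpa using hk

/-- The limit over a full half-neighbourhood is stronger than the limits over cones. -/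
lemma hasNontangentialLimit_of_tendsto {s p : ℝ} {f : ℂ → ℂ} {l : ℂ}
    (h : Tendsto f (sideFilter s p) (𝓝 l)) : HasNontangentialLimit s f p l :=
  fun _ _ => h.mono_left (nhdsWithin_mono _ fun _ hk => hk.1)

lemma eventually_sideFilter {s p : ℝ} (hp : p ≠ 0) :
    ∀ᶠ k in sideFilter s p, 0 < s * p * (k.re * k.im) := by
  have h1 : ∀ᶠ k : ℂ in 𝓝 (Complex.I * p), 0 < p * k.im := by
    have hc : ContinuousAt (fun k : ℂ => p * k.im) (Complex.I * p) :=
      (continuous_const.mul Complex.continuous_im).continuousAt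
    refine hc.eventually_const_lt ?_
    simpa using mul_self_pos.mpr hp
  filter_upwards [sideFilter_le s p h1, self_mem_nhdsWithin] with k hk (hk' : 0 < s * k.re)
  have := mul_pos hk' hk
  linarith

lemma I_mul_sq_add (p q : ℝ) :
    (Complex.I * (p : ℂ)) ^ 2 + (q : ℂ) ^ 2 = ((q ^ 2 - p ^ 2 : ℝ) : ℂ) := by
  rw [mul_pow, Complex.I_sq]
  push_cast
  ring

lemma I_mul_sq_add_ne_zero₁ {p : ℝ} (hk₁ : 0 < k₁) (hp₁ : k₁ < |p|) :
    (Complex.I * (p : ℂ)) ^ 2 + (k₁ : ℂ) ^ 2 ≠ 0 := by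
  rw [I_mul_sq_add, Complex.ofReal_ne_zero]
  nlinarith [sq_abs p]

lemma I_mul_sq_add_ne_zero₂ {p : ℝ} (hp₂ : |p| < k₂) :
    (Complex.I * (p : ℂ)) ^ 2 + (k₂ : ℂ) ^ 2 ≠ 0 := by
  rw [I_mul_sq_add, Complex.ofReal_ne_zero]
  nlinarith [sq_abs p, abs_nonneg p]

lemma branchRatio_I_mul {p : ℝ} :
    branchRatio k₁ k₂ (Complex.I * p) = (((k₁ ^ 2 - p ^ 2) / (k₂ ^ 2 - p ^ 2) : ℝ) : ℂ) := by
  rw [branchRatio, I_mul_sq_add, I_mul_sq_add, Complex.ofReal_div]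

lemma branchRatio_im {k : ℂ} (h : k ^ 2 + (k₂ : ℂ) ^ 2 ≠ 0) :
    (branchRatio k₁ k₂ k).im =
      2 * (k₂ ^ 2 - k₁ ^ 2) / Complex.normSq (k ^ 2 + (k₂ : ℂ) ^ 2) * (k.re * k.im) := by
  have h0 : Complex.normSq (k ^ 2 + (k₂ : ℂ) ^ 2) ≠ 0 := by simpa using h
  have h1 : ∀ q : ℝ, (k ^ 2 + (q : ℂ) ^ 2).re = k.re ^ 2 - k.im ^ 2 + q ^ 2 := by
    intro q
    simp [sq]
  have h2 : ∀ q : ℝ, (k ^ 2 + (q : ℂ) ^ 2).im = 2 * k.re * k.im := by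
    intro q
    simp [sq]
    ring
  rw [branchRatio, Complex.div_im, h1, h1, h2, h2]
  field_simp
  ring

/-- On the cuts the ratio is a negative real number. Nearby, its imaginary part has the sign of Re k
· Im k, that is of s·p, which decides whether the principal logarithm tends to log|·| + πi or log|·|
- πi. -/
lemma tendsto_branchRatio_cpow {s p : ℝ} (a : ℂ) (hk₁ : 0 < k₁) (hp₁ : k₁ < |p|)
    (hp₂ : |p| < k₂) :
    (0 < s * p → Tendsto (fun k => branchRatio k₁ k₂ k ^ a) (sideFilter s p)
      (𝓝 (Complex.exp ((Real.log ‖branchRatio k₁ k₂ (Complex.I * p)‖ + Real.pi * Complex.I) *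
        a)))) ∧
    (s * p < 0 → Tendsto (fun k => branchRatio k₁ k₂ k ^ a) (sideFilter s p)
      (𝓝 (Complex.exp ((Real.log ‖branchRatio k₁ k₂ (Complex.I * p)‖ - Real.pi * Complex.I) *
        a)))) := by
  have hp0 : p ≠ 0 := by
    rintro rfl
    simp at hp₁
    linarith
  have h2 := I_mul_sq_add_ne_zero₂ hp₂
  have hcont := (analyticAt_branchRatio (k₁ := k₁) h2).continuousAt
  have hsq1 : k₁ ^ 2 < p ^ 2 := by nlinarith [sq_abs p]
  have hsq2 : p ^ 2 < k₂ ^ 2 := by nlinarith [sq_abs p, abs_nonneg p]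
  have hre : (branchRatio k₁ k₂ (Complex.I * p)).re < 0 := by
    rw [branchRatio_I_mul, Complex.ofReal_re]
    exact div_neg_of_neg_of_pos (by linarith) (by linarith)
  have him : (branchRatio k₁ k₂ (Complex.I * p)).im = 0 := by
    rw [branchRatio_I_mul, Complex.ofReal_im]
  have hto : Tendsto (branchRatio k₁ k₂) (sideFilter s p)
      (𝓝 (branchRatio k₁ k₂ (Complex.I * p))) := hcont.tendsto.mono_left (sideFilter_le s p)
  have hne : ∀ᶠ k in sideFilter s p, branchRatio k₁ k₂ k ≠ 0 :=
    hto.eventually_ne (fun h => by rw [h] at hre; simp at hre)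
  have hden : ∀ᶠ k in sideFilter s p, k ^ 2 + (k₂ : ℂ) ^ 2 ≠ 0 :=
    sideFilter_le s p ((by fun_prop : ContinuousAt (fun k : ℂ => k ^ 2 + (k₂ : ℂ) ^ 2)
      (Complex.I * p)).eventually_ne h2)
  have hcoef : ∀ k : ℂ, k ^ 2 + (k₂ : ℂ) ^ 2 ≠ 0 →
      0 < 2 * (k₂ ^ 2 - k₁ ^ 2) / Complex.normSq (k ^ 2 + (k₂ : ℂ) ^ 2) := fun k hk =>
    div_pos (by linarith) (Complex.normSq_pos.mpr hk)
  have key : ∀ {l : ℂ}, Tendsto (fun k => Complex.log (branchRatio k₁ k₂ k)) (sideFilter s p)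
      (𝓝 l) → Tendsto (fun k => branchRatio k₁ k₂ k ^ a) (sideFilter s p)
        (𝓝 (Complex.exp (l * a))) := by
    intro l hl
    refine ((hl.mul_const a).cexp).congr' ?_
    filter_upwards [hne] with k hk
    rw [Complex.cpow_def_of_ne_zero hk]
  refine ⟨fun hs => key ?_, fun hs => key ?_⟩
  · refine (Complex.tendsto_log_nhdsWithin_im_nonneg_of_re_neg_of_im_zero hre him).comp
      (tendsto_nhdsWithin_iff.mpr ⟨hto, ?_⟩)
    filter_upwards [hden, eventually_sideFilter (s := s) hp0] with k hk hk'
    have h3 : 0 < k.re * k.im := pos_of_mul_pos_right hk' hs.le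
    change 0 ≤ (branchRatio k₁ k₂ k).im
    rw [branchRatio_im hk]
    exact (mul_pos (hcoef k hk) h3).le
  · refine (Complex.tendsto_log_nhdsWithin_im_neg_of_re_neg_of_im_zero hre him).comp
      (tendsto_nhdsWithin_iff.mpr ⟨hto, ?_⟩)
    filter_upwards [hden, eventually_sideFilter (s := s) hp0] with k hk hk'
    have h3 : k.re * k.im < 0 := by
      by_contra h
      rw [not_lt] at h
      nlinarith [mul_nonneg_of_nonpos_of_nonpos hs.le (neg_nonpos.mpr h)]
    change (branchRatio k₁ k₂ k).im < 0
    rw [branchRatio_im hk]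
    exact mul_neg_of_pos_of_neg (hcoef k hk) h3

end OneSided

namespace HalfPeriodValues

variable {L : PeriodPair} {k₁ k₂ : ℝ} {h₁ w h₃ : ℂ} (H : HalfPeriodValues L k₁ k₂ h₁ w h₃)
include H

/-- The pole of φ at w lies only over k = ±ik₁, because ℘(w) = e₂ = e₃ + k₁². -/
lemma w_sub_notMem {k u : ℂ} (h : k ^ 2 = e₃ k₁ k₂ - L.weierstrassP u)
    (hk : k ^ 2 + (k₁ : ℂ) ^ 2 ≠ 0) : w - u ∉ L.lattice := by
  intro hm
  have h1 := weierstrassP_add_mem L hm u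
  rw [add_sub_cancel, H.weierstrassP_w, e₂_eq] at h1
  exact hk (by linear_combination h + h1)

lemma neg_mem_fiber {k u : ℂ} (hu : u ∈ H.fiber k) : -u ∈ H.fiber (-k) := by
  refine ⟨by simpa using hu.1, by simpa using hu.2.1, ?_⟩
  rw [L.derivWeierstrassP_neg, hu.2.2, spectralRoot_neg]
  ring

variable {z : ℂ → ℂ} (hz : IsSpectralBranch L k₁ k₂ (e₃ k₁ k₂) z)
  (hw : ∀ x : ℝ, (x : ℂ) - w ∉ L.lattice)
include hz

lemma lamePhi_branch_eq {k u : ℂ} (hk : k ∈ cutPlane k₁ k₂) (hu : u ∈ H.fiber k) (x : ℝ) :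
    lamePhi L w x (z k) = lamePhi L w x u := by
  have h := lamePhi_add_mem L (w := w) (H.branch_sub_mem hz hk hu.1 hu.2.1 hu.2.2) hu.1 x
  rw [← h]
  congr 1
  ring

include hw

lemma analyticOnNhd_chi (x : ℝ) :
    AnalyticOnNhd ℂ (fun k => chi L w k₁ k₂ z k x) (cutPlane k₁ k₂) := by
  intro k hk
  have hzk := hz.notMem_lattice k hk
  have h1 := hz.analyticAt_comp (F := lamePhi L w x) (fun u hu l hl => lamePhi_add_mem L hl hu x)
    hk (analyticAt_lamePhi L (hw x) hzk
      (H.w_sub_notMem (hz.sq_eq k hk) (sq_add_sq_ne_zero₁ H.pos H.lt hk)))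
  have h2 := (analyticAt_branchRatio (k₁ := k₁) (sq_add_sq_ne_zero₂ H.pos H.lt hk)).cpow
    (analyticAt_const (v := (1 / 4 : ℂ))) (branchRatio_mem_slitPlane H.pos H.lt hk)
  have h3 : AnalyticAt ℂ (fun k : ℂ => Complex.exp (Complex.I * k * x)) k := by fun_prop
  exact (h2.mul h1).mul h3

lemma tendsto_lamePhi_branch {k₀ : ℂ} {l : Filter ℂ} (hl : l ≤ 𝓝 k₀)
    (hlD : ∀ᶠ k in l, k ∈ cutPlane k₁ k₂) {g : ℂ → ℂ} (hg : ContinuousAt g k₀)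
    (hgf : ∀ᶠ k in l, g k ∈ H.fiber k) (hg0 : g k₀ ∉ L.lattice) (hgw : w - g k₀ ∉ L.lattice)
    (x : ℝ) : Tendsto (fun k => lamePhi L w x (z k)) l (𝓝 (lamePhi L w x (g k₀))) := by
  have h1 := (analyticAt_lamePhi L (hw x) hg0 hgw).continuousAt
  refine ((ContinuousAt.comp (f := g) h1 hg).tendsto.mono_left hl).congr' ?_
  filter_upwards [hlD, hgf] with k hk hk'
  exact (H.lamePhi_branch_eq hz hk hk' x).symm

/-- The one-sided limits of `χ` on the cuts. -/
lemma exists_tendsto_chi {p : ℝ} (hp₁ : k₁ < p) (hp₂ : p < k₂) :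
    ∃ (ρ : ℂ) (A B : ℝ → ℂ), ∀ x : ℝ,
      Tendsto (fun k => chi L w k₁ k₂ z k x) (sideFilter 1 p)
        (𝓝 (ρ * Complex.exp (Real.pi * Complex.I / 4) * A x * Real.exp (-(p * x)))) ∧
      Tendsto (fun k => chi L w k₁ k₂ z k x) (sideFilter (-1) p)
        (𝓝 (ρ * Complex.exp (-(Real.pi * Complex.I / 4)) * B x * Real.exp (-(p * x)))) ∧
      Tendsto (fun k => chi L w k₁ k₂ z k x) (sideFilter 1 (-p))
        (𝓝 (ρ * Complex.exp (-(Real.pi * Complex.I / 4)) * A x * Real.exp (p * x))) ∧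
      Tendsto (fun k => chi L w k₁ k₂ z k x) (sideFilter (-1) (-p))
        (𝓝 (ρ * Complex.exp (Real.pi * Complex.I / 4) * B x * Real.exp (p * x))) := by
  have hp0 : 0 < p := H.pos.trans hp₁
  have ha₁ : k₁ < |p| := by rwa [abs_of_pos hp0]
  have ha₂ : |p| < k₂ := by rwa [abs_of_pos hp0]
  have hn₁ : k₁ < |-p| := by rwa [abs_neg]
  have hn₂ : |-p| < k₂ := by rwa [abs_neg]
  have hne₁ := I_mul_sq_add_ne_zero₁ H.pos ha₁
  have hne₂ := I_mul_sq_add_ne_zero₂ ha₂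
  set lam : ℝ := Real.log ‖branchRatio k₁ k₂ (Complex.I * p)‖ with hlam
  have hlam' : Real.log ‖branchRatio k₁ k₂ (Complex.I * (-p : ℝ))‖ = lam := by
    rw [hlam, branchRatio_I_mul, branchRatio_I_mul, neg_sq]
  -- the limits of the root
  have hSp : Tendsto (spectralRoot k₁ k₂) (sideFilter 1 p)
      (𝓝 (((Complex.I * p) ^ 2 + (k₂ : ℂ) ^ 2) * (Complex.exp (lam / 2) * Complex.I))) := by
    have h1 := (tendsto_branchRatio_cpow (s := 1) (1 / 2) H.pos ha₁ ha₂).1 (by simpa using hp0)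
    have h2 : Complex.exp ((lam + Real.pi * Complex.I) * (1 / 2)) =
        Complex.exp (lam / 2) * Complex.I := by
      conv_rhs => rw [← Complex.exp_pi_div_two_mul_I]
      rw [← Complex.exp_add]
      congr 1
      ring
    rw [h2] at h1
    exact ((by fun_prop : ContinuousAt (fun k : ℂ => k ^ 2 + (k₂ : ℂ) ^ 2)
      (Complex.I * p)).tendsto.mono_left (sideFilter_le 1 p)).mul h1
  have hSm : Tendsto (spectralRoot k₁ k₂) (sideFilter (-1) p)
      (𝓝 (-(((Complex.I * p) ^ 2 + (k₂ : ℂ) ^ 2) * (Complex.exp (lam / 2) * Complex.I)))) := by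
    have h1 := (tendsto_branchRatio_cpow (s := -1) (1 / 2) H.pos ha₁ ha₂).2 (by simpa using hp0)
    have h2 : Complex.exp ((lam - Real.pi * Complex.I) * (1 / 2)) =
        -(Complex.exp (lam / 2) * Complex.I) := by
      rw [← mul_neg, ← Complex.exp_neg_pi_div_two_mul_I, ← Complex.exp_add]
      congr 1
      ring
    rw [h2] at h1
    rw [← mul_neg]
    exact ((by fun_prop : ContinuousAt (fun k : ℂ => k ^ 2 + (k₂ : ℂ) ^ 2)
      (Complex.I * p)).tendsto.mono_left (sideFilter_le (-1) p)).mul h1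
  have hNeBot : (sideFilter 1 p).NeBot := by
    rw [sideFilter, ← mem_closure_iff_nhdsWithin_neBot]
    simp only [one_mul]
    rw [Complex.closure_setOfPred_lt_re]
    simp
  -- the local solution
  obtain ⟨f, hf, hfS⟩ : ∃ f, IsLocalSolution L k₁ k₂ f (Complex.I * p) ∧
      deriv f (Complex.I * p) * (((Complex.I * p) ^ 2 + (k₂ : ℂ) ^ 2) *
        (Complex.exp (lam / 2) * Complex.I)) = Complex.I := by
    obtain ⟨f, hf⟩ := H.exists_local_solution hne₁ hne₂
    have h1 := (hSp.pow 2).congr' (f₂ := fun k : ℂ => (k ^ 2 + (k₁ : ℂ) ^ 2) *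
      (k ^ 2 + (k₂ : ℂ) ^ 2)) (by
        filter_upwards [eventually_mem_cutPlane_sideFilter (k₁ := k₁) (k₂ := k₂) 1 p] with k hk
        exact spectralRoot_sq (sq_add_sq_ne_zero₂ H.pos H.lt hk))
    have h2 : ContinuousAt (fun k : ℂ => (k ^ 2 + (k₁ : ℂ) ^ 2) * (k ^ 2 + (k₂ : ℂ) ^ 2))
      (Complex.I * p) := by fun_prop
    have h3 := tendsto_nhds_unique h1 (h2.tendsto.mono_left (sideFilter_le 1 p))
    have h4 := hf.2.self_of_nhds.2.2.1
    rw [← h3, ← mul_pow, ← Complex.I_sq] at h4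
    -- Of the two solutions ±f, the one matching the right-hand limit of S is kept.
    rcases sq_eq_sq_iff_eq_or_eq_neg.mp h4 with h5 | h5
    · exact ⟨f, hf, h5⟩
    · refine ⟨-f, hf.neg, ?_⟩
      rw [deriv.neg, neg_mul, h5, neg_neg]
  have hDp := eventually_mem_cutPlane_sideFilter (k₁ := k₁) (k₂ := k₂)
  have hfib₁ : ∀ᶠ k in sideFilter 1 p, f k ∈ H.fiber k :=
    H.eventually_mem_fiber hf (sideFilter_le 1 p) (hDp 1 p) hSp hfS
  -- S has the opposite limit on the left lip, so the sign of f flips there. For the points near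
  -- -ip, the reflection k ↦ -k exchanges the sides and negates the fibers.
  have hfib₂ : ∀ᶠ k in sideFilter (-1) p, (-f) k ∈ H.fiber k := by
    refine H.eventually_mem_fiber hf.neg (sideFilter_le (-1) p) (hDp (-1) p) hSm ?_
    rw [deriv.neg, neg_mul_neg, hfS]
  have hfib₃ : ∀ᶠ k in sideFilter 1 (-p), f (-k) ∈ H.fiber k := by
    filter_upwards [(tendsto_neg_sideFilter 1 p).eventually hfib₂] with k hk
    simpa using H.neg_mem_fiber hk
  have hfib₄ : ∀ᶠ k in sideFilter (-1) (-p), -f (-k) ∈ H.fiber k := by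
    have h1 := tendsto_neg_sideFilter (-1) p
    rw [neg_neg] at h1
    filter_upwards [h1.eventually hfib₁] with k hk
    simpa using H.neg_mem_fiber hk
  have hf0 := hf.2.self_of_nhds
  have hf0' : -f (Complex.I * p) ∉ L.lattice := by simpa using hf0.1
  have hw1 := H.w_sub_notMem hf0.2.1 hne₁
  have hw2 : w - -f (Complex.I * p) ∉ L.lattice :=
    H.w_sub_notMem (k := Complex.I * p) (by simpa using hf0.2.1) hne₁
  have hc := hf.1.continuousAt
  have hpt : -(Complex.I * ((-p : ℝ) : ℂ)) = Complex.I * p := by push_cast; ring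
  have hc' : ContinuousAt (fun k => f (-k)) (Complex.I * ((-p : ℝ) : ℂ)) :=
    ContinuousAt.comp (g := f) (f := fun k : ℂ => -k) (by rwa [hpt]) continuous_neg.continuousAt
  have hexp : ∀ (s q x : ℝ), Tendsto (fun k : ℂ => Complex.exp (Complex.I * k * x))
      (sideFilter s q) (𝓝 (Real.exp (-(q * x)))) := by
    intro s q x
    have h1 : ContinuousAt (fun k : ℂ => Complex.exp (Complex.I * k * x)) (Complex.I * q) := by
      fun_prop
    have h2 : Complex.exp (Complex.I * (Complex.I * q) * x) = Real.exp (-(q * x)) := by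
      rw [← mul_assoc, Complex.I_mul_I]
      push_cast
      congr 1
      ring
    have h3 := h1.tendsto.mono_left (sideFilter_le s q)
    rwa [h2] at h3
  have hqp : Complex.exp ((lam + Real.pi * Complex.I) * (1 / 4)) =
      Complex.exp (lam / 4) * Complex.exp (Real.pi * Complex.I / 4) := by
    rw [← Complex.exp_add]
    congr 1
    ring
  have hqm : Complex.exp ((lam - Real.pi * Complex.I) * (1 / 4)) =
      Complex.exp (lam / 4) * Complex.exp (-(Real.pi * Complex.I / 4)) := by
    rw [← Complex.exp_add]
    congr 1
    ring
  refine ⟨Complex.exp (lam / 4), fun x => lamePhi L w x (f (Complex.I * p)),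
    fun x => lamePhi L w x (-f (Complex.I * p)), fun x => ⟨?_, ?_, ?_, ?_⟩⟩
  · have h1 := (tendsto_branchRatio_cpow (s := 1) (1 / 4) H.pos ha₁ ha₂).1 (by simpa using hp0)
    rw [← hlam, hqp] at h1
    exact (h1.mul (H.tendsto_lamePhi_branch hz hw (sideFilter_le 1 p) (hDp 1 p) hc hfib₁ hf0.1
      hw1 x)).mul (hexp 1 p x)
  · have h1 := (tendsto_branchRatio_cpow (s := -1) (1 / 4) H.pos ha₁ ha₂).2 (by simpa using hp0)
    rw [← hlam, hqm] at h1
    exact (h1.mul (H.tendsto_lamePhi_branch hz hw (sideFilter_le (-1) p) (hDp (-1) p) hc.neg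
      hfib₂ hf0' hw2 x)).mul (hexp (-1) p x)
  · have h1 := (tendsto_branchRatio_cpow (s := 1) (1 / 4) H.pos hn₁ hn₂).2 (by simpa using hp0)
    rw [hlam', hqm] at h1
    have h2 := H.tendsto_lamePhi_branch hz hw (sideFilter_le 1 (-p)) (hDp 1 (-p)) hc' hfib₃
      (by simpa only [hpt] using hf0.1) (by simpa only [hpt] using hw1) x
    simp only [hpt] at h2
    have h3 := hexp 1 (-p) x
    rw [neg_mul, neg_neg] at h3
    exact (h1.mul h2).mul h3
  · have h1 := (tendsto_branchRatio_cpow (s := -1) (1 / 4) H.pos hn₁ hn₂).1 (by simpa using hp0)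
    rw [hlam', hqp] at h1
    have h2 := H.tendsto_lamePhi_branch hz hw (sideFilter_le (-1) (-p)) (hDp (-1) (-p)) hc'.neg
      hfib₄ (by simpa only [Pi.neg_apply, hpt] using hf0')
      (by simpa only [Pi.neg_apply, hpt] using hw2) x
    simp only [Pi.neg_apply, hpt] at h2
    have h3 := hexp (-1) (-p) x
    rw [neg_mul, neg_neg] at h3
    exact (h1.mul h2).mul h3

end HalfPeriodValues
end PrimitivePotential

/-! ### Endpoint bounds and jump relations. -/

namespace PrimitivePotential
namespace HalfPeriodValues

variable {L : PeriodPair} {k₁ k₂ : ℝ} {h₁ w h₃ : ℂ} (H : HalfPeriodValues L k₁ k₂ h₁ w h₃)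
include H

/-- If ℘ were locally constant, every point near u₀ would be a half-period, against discreteness of
the lattice. -/
lemma nhds_le_map_weierstrassP {u₀ : ℂ} (hu₀ : u₀ ∉ L.lattice) :
    𝓝 (L.weierstrassP u₀) ≤ map L.weierstrassP (𝓝 u₀) := by
  rcases (L.analyticOnNhd_weierstrassP u₀ hu₀).eventually_constant_or_nhds_le_map_nhds with h | h
  · exfalso
    have h1 : ∀ᶠ u in 𝓝 u₀, 2 * u ∈ L.lattice := by
      filter_upwards [h.eventually_nhds, eventually_notMem_lattice L hu₀] with u hu hu'
      refine H.two_mul_mem_of_derivWeierstrassP_eq_zero hu' ?_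
      rw [← (hasDerivAt_weierstrassP L hu').deriv, EventuallyEq.deriv_eq hu, deriv_const]
    have h2 := h1.self_of_nhds
    have h3 : Tendsto (fun v : ℂ => u₀ + v / 2) (𝓝[≠] 0) (𝓝 u₀) := by
      have : ContinuousAt (fun v : ℂ => u₀ + v / 2) 0 := by fun_prop
      simpa [ContinuousAt] using this.tendsto.mono_left (nhdsWithin_le_nhds (s := {0}ᶜ))
    obtain ⟨v, hv, hv'⟩ := ((h3.eventually h1).and (eventually_notMem_lattice_zero L)).exists
    apply hv'
    convert! sub_mem hv h2 using 1
    ring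
  · exact h

lemma exists_mul_sub_eq {c : ℂ} (hc : c ∈ ({Complex.I * k₁, -(Complex.I * k₁), Complex.I * k₂,
    -(Complex.I * k₂)} : Set ℂ)) : ∃ g : ℂ → ℂ, Continuous g ∧ g c ≠ 0 ∧
      ∀ k, (k ^ 2 + (k₁ : ℂ) ^ 2) * (k ^ 2 + (k₂ : ℂ) ^ 2) = (k - c) * g k := by
  have h1 := H.k₁_ne_zero
  have h2 := H.k₂_ne_zero
  have h3 := H.sq_sub_sq_ne_zero
  have key : ∀ a b : ℂ, c ^ 2 = -a ^ 2 → a ≠ 0 → b ^ 2 - a ^ 2 ≠ 0 →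
      ∃ g : ℂ → ℂ, Continuous g ∧ g c ≠ 0 ∧
        ∀ k, (k ^ 2 + a ^ 2) * (k ^ 2 + b ^ 2) = (k - c) * g k := by
    intro a b hca ha hab
    have hc0 : c ≠ 0 := by
      rintro rfl
      simp [ha] at hca
    refine ⟨fun k => (k + c) * (k ^ 2 + b ^ 2), by fun_prop, mul_ne_zero ?_ ?_, fun k => ?_⟩
    · rw [← two_mul]
      exact mul_ne_zero two_ne_zero hc0
    · rw [hca]
      convert hab using 1
      ring
    · linear_combination (k ^ 2 + b ^ 2) * hca
  have h3' : (k₂ : ℂ) ^ 2 - (k₁ : ℂ) ^ 2 ≠ 0 := by rwa [← neg_sub, neg_ne_zero]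
  rcases hc with rfl | rfl | rfl | rfl
  · exact key k₁ k₂ (by rw [mul_pow, Complex.I_sq]; ring) h1 h3'
  · exact key k₁ k₂ (by rw [neg_sq, mul_pow, Complex.I_sq]; ring) h1 h3'
  · obtain ⟨g, hg⟩ := key k₂ k₁ (by rw [mul_pow, Complex.I_sq]; ring) h2 h3
    exact ⟨g, hg.1, hg.2.1, fun k => by rw [← hg.2.2, mul_comm]⟩
  · obtain ⟨g, hg⟩ := key k₂ k₁ (by rw [neg_sq, mul_pow, Complex.I_sq]; ring) h2 h3
    exact ⟨g, hg.1, hg.2.1, fun k => by rw [← hg.2.2, mul_comm]⟩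

variable {z : ℂ → ℂ} (hz : IsSpectralBranch L k₁ k₂ (e₃ k₁ k₂) z)
include hz

/-- Openness of ℘ at a point u₀ over c provides, for k near c, a point u near u₀ over k. The branch
is ±u modulo Λ, so it suffices to bound K near u₀ and -u₀. -/
lemma exists_norm_lamePhi_branch_le (c : ℂ) (x : ℝ) :
    ∃ C, 0 ≤ C ∧ ∀ᶠ k in 𝓝[cutPlane k₁ k₂] c,
      ‖lamePhi L w x (z k)‖ ^ 2 * ‖k ^ 2 + (k₁ : ℂ) ^ 2‖ ≤ C := by
  obtain ⟨K, hK, hKle⟩ := exists_norm_sq_lamePhi_le L H.two_mul_w H.w_notMem x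
  obtain ⟨u₀, hu₀, hP⟩ := exists_weierstrassP_eq L (e₃ k₁ k₂ - c ^ 2)
  have hu₀' : -u₀ ∉ L.lattice := by simpa using hu₀
  have hneg : ContinuousAt (fun u => K (-u)) u₀ :=
    ContinuousAt.comp (g := K) (f := fun u : ℂ => -u) (hK _ hu₀') continuous_neg.continuousAt
  set C := max (‖K u₀‖ + 1) (‖K (-u₀)‖ + 1)
  have hV : ∀ᶠ u in 𝓝 u₀, u ∉ L.lattice ∧ ‖K u‖ ≤ C ∧ ‖K (-u)‖ ≤ C := by
    filter_upwards [eventually_notMem_lattice L hu₀,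
      (hK u₀ hu₀).norm.eventually_le_const (lt_add_one _),
      hneg.norm.eventually_le_const (lt_add_one _)] with u h1 h2 h3
    exact ⟨h1, h2.trans (le_max_left _ _), h3.trans (le_max_right _ _)⟩
  have himg := H.nhds_le_map_weierstrassP hu₀ (image_mem_map hV)
  rw [hP] at himg
  have hcont : ContinuousAt (fun k : ℂ => (e₃ k₁ k₂ : ℂ) - k ^ 2) c := by fun_prop
  refine ⟨C, le_max_of_le_left (by positivity), ?_⟩
  filter_upwards [mem_nhdsWithin_of_mem_nhds (hcont.eventually himg), self_mem_nhdsWithin]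
    with k ⟨u, ⟨hu1, hu2, hu3⟩, hu4⟩ hkD
  have hk2 : k ^ 2 = e₃ k₁ k₂ - L.weierstrassP u := by
    rw [hu4]
    ring
  have hsub : ∀ v, L.weierstrassP v = L.weierstrassP u →
      ‖L.weierstrassP v - L.weierstrassP w‖ = ‖k ^ 2 + (k₁ : ℂ) ^ 2‖ := by
    intro v hv
    rw [hv, H.weierstrassP_w, e₂_eq, ← norm_neg]
    congr 1
    linear_combination -hk2
  rcases H.mem_or_neg_mem_fiber hkD hu1 hk2 with h | h
  · rw [H.lamePhi_branch_eq hz hkD h, ← hsub u rfl]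
    exact (hKle u hu1).trans hu2
  · rw [H.lamePhi_branch_eq hz hkD h, ← hsub (-u) (L.weierstrassP_neg u)]
    exact (hKle (-u) (by simpa using hu1)).trans hu3

/-- With g(k) = (k² + k₁²)(k² + k₂²)/(k - c), the quantity |χ|⁴|k - c| equals (|φ|²|k² +
k₁²|)²|e^{ikx}|⁴/|g(k)|, where every factor is controlled near c. -/
lemma exists_norm_chi_lt (x : ℝ) {c : ℂ} (hc : c ∈ ({Complex.I * k₁, -(Complex.I * k₁),
    Complex.I * k₂, -(Complex.I * k₂)} : Set ℂ)) :
    ∃ C, ∀ᶠ k in 𝓝[cutPlane k₁ k₂] c, ‖chi L w k₁ k₂ z k x‖ < C / ‖k - c‖ ^ (1 / 4 : ℝ) := by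
  obtain ⟨g, hg, hgc, hgk⟩ := H.exists_mul_sub_eq hc
  obtain ⟨C, hC, hφ⟩ := H.exists_norm_lamePhi_branch_le hz c x
  have hm : 0 < ‖g c‖ / 2 := half_pos (norm_pos_iff.mpr hgc)
  set m := ‖g c‖ / 2 with hmdef
  have hgm : ∀ᶠ k in 𝓝 c, m < ‖g k‖ :=
    hg.norm.continuousAt.eventually_const_lt (half_lt_self (norm_pos_iff.mpr hgc))
  have hE : ∀ᶠ k : ℂ in 𝓝 c, ‖Complex.exp (Complex.I * k * x)‖ <
      ‖Complex.exp (Complex.I * c * x)‖ + 1 :=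
    (by fun_prop : ContinuousAt (fun k : ℂ => ‖Complex.exp (Complex.I * k * x)‖)
      c).eventually_lt_const (lt_add_one _)
  set E := ‖Complex.exp (Complex.I * c * x)‖ + 1
  have hE0 : 0 ≤ E := by positivity
  set C' := C ^ 2 * E ^ 4 / m
  have hC' : 0 ≤ C' := by positivity
  refine ⟨C' + 1, ?_⟩
  filter_upwards [hφ, mem_nhdsWithin_of_mem_nhds hgm, mem_nhdsWithin_of_mem_nhds hE,
    self_mem_nhdsWithin] with k h1 h2 h3 hkD
  have hN := sq_add_sq_ne_zero₁ H.pos H.lt hkD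
  have hM := sq_add_sq_ne_zero₂ H.pos H.lt hkD
  have hkc : k - c ≠ 0 := by
    intro h0
    have := hgk k
    rw [h0, zero_mul] at this
    exact mul_ne_zero hN hM this
  have hkc' : 0 < ‖k - c‖ := norm_pos_iff.mpr hkc
  rw [lt_div_iff₀ (Real.rpow_pos_of_pos hkc' _)]
  have hroot : ∀ r : ℝ, 0 ≤ r → (r ^ (1 / 4 : ℝ)) ^ 4 = r := by
    intro r hr
    rw [← Real.rpow_natCast, ← Real.rpow_mul hr]
    norm_num
  refine lt_of_pow_lt_pow_left₀ 4 (by positivity) ?_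
  -- C' bounds a fourth power; using C' + 1 avoids taking a root and makes the inequality strict.
  have hlt : C' < (C' + 1) ^ 4 := by
    nlinarith [pow_nonneg hC' 2, pow_nonneg hC' 3, pow_nonneg hC' 4]
  refine lt_of_le_of_lt ?_ hlt
  have hq : (1 / 4 : ℂ) = ((1 / 4 : ℝ) : ℂ) := by norm_num
  rw [mul_pow, hroot _ (norm_nonneg _), chi, norm_mul, norm_mul, hq, Complex.norm_cpow_real,
    mul_pow, mul_pow, hroot _ (norm_nonneg _), norm_div]
  have h4 : ‖k ^ 2 + (k₁ : ℂ) ^ 2‖ * ‖k ^ 2 + (k₂ : ℂ) ^ 2‖ = ‖k - c‖ * ‖g k‖ := by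
    rw [← norm_mul, ← norm_mul, hgk]
  have hN' : 0 < ‖k ^ 2 + (k₁ : ℂ) ^ 2‖ := norm_pos_iff.mpr hN
  have hM' : 0 < ‖k ^ 2 + (k₂ : ℂ) ^ 2‖ := norm_pos_iff.mpr hM
  have hg' : 0 < ‖g k‖ := hm.trans h2
  set n := ‖k ^ 2 + (k₁ : ℂ) ^ 2‖
  set M := ‖k ^ 2 + (k₂ : ℂ) ^ 2‖
  set φ := ‖lamePhi L w x (z k)‖
  have h5 : n / M * φ ^ 4 * ‖Complex.exp (Complex.I * k * x)‖ ^ 4 * ‖k - c‖ =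
      (φ ^ 2 * n) ^ 2 * ‖Complex.exp (Complex.I * k * x)‖ ^ 4 / ‖g k‖ := by
    field_simp
    linear_combination -φ ^ 4 * h4
  rw [h5]
  simp only [C']
  gcongr

lemma exists_endpoint_bound : ∃ α : ℝ, α < 1 ∧ ∀ x : ℝ, ∃ C : ℝ,
    ∀ c ∈ ({Complex.I * k₁, -(Complex.I * k₁), Complex.I * k₂, -(Complex.I * k₂)} : Set ℂ),
      ∀ᶠ k in 𝓝[cutPlane k₁ k₂] c, ‖chi L w k₁ k₂ z k x‖ < C / ‖k - c‖ ^ α := by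
  refine ⟨1 / 4, by norm_num, fun x => ?_⟩
  choose! C hC using fun c => H.exists_norm_chi_lt hz x (c := c)
  have hfin : ({Complex.I * k₁, -(Complex.I * k₁), Complex.I * k₂,
    -(Complex.I * k₂)} : Set ℂ).Finite := by simp
  obtain ⟨B, hB⟩ := (hfin.image C).bddAbove
  refine ⟨B, fun c hc => ?_⟩
  filter_upwards [hC c hc] with k hk
  refine hk.trans_le ?_
  have := hB ⟨c, hc, rfl⟩
  gcongr

variable (hw : ∀ x : ℝ, (x : ℂ) - w ∉ L.lattice)
include hw

/-- Up to ρ and real exponentials, the boundary values are c₁A, c₂B at ip and c₂A, c₁B at -ip. From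
c₁ = ic₂ one gets c₁A - c₂B = i(c₂A + c₁B) and c₂A - c₁B = -i(c₁A + c₂B). -/
lemma exists_jumps : ∃ χp χm : ℝ → ℝ → ℂ,
    (∀ x p : ℝ, k₁ < |p| → |p| < k₂ →
      HasNontangentialLimit 1 (fun k => chi L w k₁ k₂ z k x) p (χp p x) ∧
      HasNontangentialLimit (-1) (fun k => chi L w k₁ k₂ z k x) p (χm p x)) ∧
    (∀ x p : ℝ, k₁ < p → p < k₂ →
      χp p x - χm p x = Complex.I * Real.exp (-2 * p * x) * (χp (-p) x + χm (-p) x)) ∧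
    (∀ x p : ℝ, k₁ < p → p < k₂ →
      χp (-p) x - χm (-p) x = -Complex.I * Real.exp (2 * p * x) * (χp p x + χm p x)) := by
  choose! ρ A B hlim using fun (p : ℝ) (hp : k₁ < p ∧ p < k₂) =>
    H.exists_tendsto_chi hz hw hp.1 hp.2
  set c₁ := Complex.exp (Real.pi * Complex.I / 4)
  set c₂ := Complex.exp (-(Real.pi * Complex.I / 4))
  have hc : c₁ = Complex.I * c₂ := by
    calc c₁ = Complex.exp (Real.pi / 2 * Complex.I) * c₂ := by
          simp only [c₁, c₂]
          rw [← Complex.exp_add]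
          congr 1
          ring
      _ = _ := by rw [Complex.exp_pi_div_two_mul_I]
  have hexp₁ : ∀ p x : ℝ, (Real.exp (-2 * p * x) : ℂ) * Real.exp (p * x) =
      Real.exp (-(p * x)) := by
    intro p x
    rw [← Complex.ofReal_mul, ← Real.exp_add]
    congr 2
    ring
  have hexp₂ : ∀ p x : ℝ, (Real.exp (2 * p * x) : ℂ) * Real.exp (-(p * x)) =
      Real.exp (p * x) := by
    intro p x
    rw [← Complex.ofReal_mul, ← Real.exp_add]
    congr 2
    ring
  refine ⟨fun p x => if 0 < p then ρ p * c₁ * A p x * Real.exp (-(p * x)) else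
      ρ (-p) * c₂ * A (-p) x * Real.exp (-p * x),
    fun p x => if 0 < p then ρ p * c₂ * B p x * Real.exp (-(p * x)) else
      ρ (-p) * c₁ * B (-p) x * Real.exp (-p * x), ?_, ?_, ?_⟩
  · intro x p hp₁ hp₂
    by_cases hp : 0 < p
    · rw [abs_of_pos hp] at hp₁ hp₂
      have h := hlim p ⟨hp₁, hp₂⟩ x
      simp only [hp, if_true]
      exact ⟨hasNontangentialLimit_of_tendsto h.1, hasNontangentialLimit_of_tendsto h.2.1⟩
    · rw [abs_of_nonpos (not_lt.mp hp)] at hp₁ hp₂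
      have h := hlim (-p) ⟨hp₁, hp₂⟩ x
      simp only [hp, if_false]
      rw [neg_neg] at h
      exact ⟨hasNontangentialLimit_of_tendsto h.2.2.1, hasNontangentialLimit_of_tendsto h.2.2.2⟩
  · intro x p hp₁ _
    have hp := H.pos.trans hp₁
    have hp' : ¬ 0 < -p := by linarith
    simp only [hp, hp', if_true, if_false, neg_neg]
    rw [← hexp₁ p x, hc]
    linear_combination (-(ρ p * c₂ * B p x * Real.exp (-2 * p * x) * Real.exp (p * x))) *
      Complex.I_sq
  · intro x p hp₁ _
    have hp := H.pos.trans hp₁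
    have hp' : ¬ 0 < -p := by linarith
    simp only [hp, hp', if_true, if_false, neg_neg]
    rw [← hexp₂ p x, hc]
    linear_combination (ρ p * c₂ * A p x * Real.exp (2 * p * x) * Real.exp (-(p * x))) *
      Complex.I_sq

end HalfPeriodValues
end PrimitivePotential

namespace PrimitivePotential

/-! ### Expansion at infinity and the potential. -/

section Asymptotic

variable (L : PeriodPair)

lemma hasDerivAt_weierstrassPExcept_zero : HasDerivAt (L.weierstrassPExcept 0) 0 0 :=
  hasDerivAt_zero_of_even ((L.differentiableOn_weierstrassPExcept 0).differentiableAt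
    ((isOpen_regular L).mem_nhds (by simp))) fun u => by
      simpa using L.weierstrassPExcept_neg 0 u

lemma analyticAt_weierstrassPExcept_zero : AnalyticAt ℂ (L.weierstrassPExcept 0) 0 :=
  (L.differentiableOn_weierstrassPExcept 0).analyticAt ((isOpen_regular L).mem_nhds (by simp))

lemma zetaRegular_zero : zetaRegular L 0 = 0 := by
  simp [zetaRegular]

lemma analyticAt_zetaRegular_zero : AnalyticAt ℂ (zetaRegular L) 0 :=
  (differentiableOn_zetaRegular L).analyticAt ((isOpen_regular L).mem_nhds (by simp))

/-- The function of `z` that equals `-(k z)²` for `k² = e - ℘(z)`. -/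
noncomputable def momentumSq (e z : ℂ) : ℂ := 1 + z ^ 2 * (L.weierstrassPExcept 0 z - e)

/-- The square root of `momentumSq` that equals `1` at `0`. -/
noncomputable def momentumRoot (e z : ℂ) : ℂ := momentumSq L e z ^ (1 / 2 : ℂ)

/-- The function of `z` that equals `ik - 1/z` for `k² = e - ℘(z)`, `k ∼ -i/z`. -/
noncomputable def momentumRegular (e z : ℂ) : ℂ :=
  z * (L.weierstrassPExcept 0 z - e) / (momentumRoot L e z + 1)

/-- The function `χ` in terms of the variable `z`, for `z` near `0`. -/
noncomputable def chiLocal (e w : ℂ) (k₁ k₂ x : ℝ) (z : ℂ) : ℂ :=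
  ((momentumSq L e z - (k₁ : ℂ) ^ 2 * z ^ 2) / (momentumSq L e z - (k₂ : ℂ) ^ 2 * z ^ 2)) ^
      (1 / 4 : ℂ) *
    (weierstrassSigma L (x - w + z) * weierstrassSigma L w /
      (weierstrassSigma L (x - w) * weierstrassSigma L (w - z))) *
    Complex.exp (x * (momentumRegular L e z - zetaRegular L z))

variable (e : ℂ)

lemma analyticAt_momentumSq : AnalyticAt ℂ (momentumSq L e) 0 :=
  analyticAt_const.add ((analyticAt_id.pow 2).mul
    ((analyticAt_weierstrassPExcept_zero L).sub analyticAt_const))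

lemma momentumSq_zero : momentumSq L e 0 = 1 := by simp [momentumSq]

lemma hasDerivAt_momentumSq_zero : HasDerivAt (momentumSq L e) 0 0 := by
  have h := (((hasDerivAt_id (0 : ℂ)).pow 2).mul
    ((hasDerivAt_weierstrassPExcept_zero L).sub_const e)).const_add 1
  exact h.congr_deriv (by simp)

lemma momentumRoot_zero : momentumRoot L e 0 = 1 := by simp [momentumRoot, momentumSq_zero]

lemma analyticAt_momentumRoot : AnalyticAt ℂ (momentumRoot L e) 0 :=
  (analyticAt_momentumSq L e).cpow analyticAt_const (by simp [momentumSq_zero])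

lemma hasDerivAt_momentumRoot_zero : HasDerivAt (momentumRoot L e) 0 0 := by
  have h := (hasDerivAt_momentumSq_zero L e).cpow_const (c := (1 / 2 : ℂ))
    (by simp [momentumSq_zero])
  exact h.congr_deriv (by simp)

lemma momentumRoot_sq {z : ℂ} : momentumRoot L e z ^ 2 = momentumSq L e z := by
  rw [momentumRoot, ← Complex.cpow_nat_mul]
  simp

lemma analyticAt_momentumRegular : AnalyticAt ℂ (momentumRegular L e) 0 :=
  (analyticAt_id.mul ((analyticAt_weierstrassPExcept_zero L).sub analyticAt_const)).div
    ((analyticAt_momentumRoot L e).add analyticAt_const) (by norm_num [momentumRoot_zero])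

lemma momentumRegular_zero : momentumRegular L e 0 = 0 := by simp [momentumRegular]

lemma hasDerivAt_momentumRegular_zero : HasDerivAt (momentumRegular L e) (-e / 2) 0 := by
  have h := ((hasDerivAt_id (0 : ℂ)).mul
    ((hasDerivAt_weierstrassPExcept_zero L).sub_const e)).div
      ((hasDerivAt_momentumRoot_zero L e).add_const 1) (by norm_num [momentumRoot_zero])
  refine h.congr_deriv ?_
  simp [momentumRoot_zero]
  ring

variable {e} {w : ℂ} {k₁ k₂ x : ℝ}

lemma chiLocal_zero (hw : w ∉ L.lattice) (hxw : (x : ℂ) - w ∉ L.lattice) :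
    chiLocal L e w k₁ k₂ x 0 = 1 := by
  have h1 := weierstrassSigma_ne_zero L hw
  have h2 := weierstrassSigma_ne_zero L hxw
  simp [chiLocal, momentumSq_zero, momentumRegular_zero, zetaRegular_zero]
  exact ⟨h2, h1⟩

lemma analyticAt_chiLocal (hw : w ∉ L.lattice) (hxw : (x : ℂ) - w ∉ L.lattice) :
    AnalyticAt ℂ (chiLocal L e w k₁ k₂ x) 0 := by
  have h1 := weierstrassSigma_ne_zero L hw
  have h2 := weierstrassSigma_ne_zero L hxw
  have hA := analyticAt_momentumSq L e
  have hσ : ∀ u, AnalyticAt ℂ (weierstrassSigma L) u := fun u => analyticAt_weierstrassSigma L u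
  refine (AnalyticAt.mul (AnalyticAt.cpow (AnalyticAt.div ?_ ?_ ?_) analyticAt_const ?_)
    (AnalyticAt.div ?_ ?_ ?_)).mul
    (analyticAt_const.mul ((analyticAt_momentumRegular L e).sub
      (analyticAt_zetaRegular_zero L))).cexp
  · exact hA.sub (by fun_prop)
  · exact hA.sub (by fun_prop)
  · simp [momentumSq_zero]
  · simp [momentumSq_zero]
  · exact (AnalyticAt.fun_comp (hσ _) (by fun_prop)).mul analyticAt_const
  · exact analyticAt_const.mul (AnalyticAt.fun_comp (hσ _) (by fun_prop))
  · simpa using ⟨h2, h1⟩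

/-- The fourth root and `zetaRegular` have zero derivative at 0; only the σ-quotient and
`momentumRegular` contribute at first order. -/
lemma hasDerivAt_chiLocal_zero (hw : w ∉ L.lattice) (hxw : (x : ℂ) - w ∉ L.lattice) :
    HasDerivAt (chiLocal L e w k₁ k₂ x)
      (weierstrassZeta L (x - w) + weierstrassZeta L w - x * e / 2) 0 := by
  have h1 := weierstrassSigma_ne_zero L hw
  have h2 := weierstrassSigma_ne_zero L hxw
  have hA := hasDerivAt_momentumSq_zero L e
  have hq : ∀ a : ℂ, HasDerivAt (fun z => momentumSq L e z - a ^ 2 * z ^ 2) 0 0 := by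
    intro a
    have h := hA.sub (((hasDerivAt_id (0 : ℂ)).pow 2).const_mul (a ^ 2))
    exact h.congr_deriv (by simp)
  have hr := ((hq k₁).div (hq k₂) (by simp [momentumSq_zero])).cpow_const (c := (1 / 4 : ℂ))
    (by simp [momentumSq_zero])
  have hσ₁ : HasDerivAt (fun z => weierstrassSigma L (x - w + z))
      (weierstrassZeta L (x - w) * weierstrassSigma L (x - w)) 0 :=
    HasDerivAt.comp_const_add (x - w) 0 (by simpa using hasDerivAt_weierstrassSigma L hxw)
  have hσ₂ : HasDerivAt (fun z => weierstrassSigma L (w - z))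
      (-(weierstrassZeta L w * weierstrassSigma L w)) 0 :=
    HasDerivAt.comp_const_sub w 0 (by simpa using hasDerivAt_weierstrassSigma L hw)
  have hs := (hσ₁.mul_const (weierstrassSigma L w)).div
    (hσ₂.const_mul (weierstrassSigma L (x - w))) (by simpa using ⟨h2, h1⟩)
  have hE := (((hasDerivAt_momentumRegular_zero L e).sub
    (hasDerivAt_zetaRegular L (z := 0) (by simp))).const_mul (x : ℂ)).cexp
  refine ((hr.mul hs).mul hE).congr_deriv ?_
  simp [momentumSq_zero, momentumRegular_zero, zetaRegular_zero]
  field_simp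
  ring

variable {L} {z : ℂ → ℂ} (hz : IsSpectralBranch L k₁ k₂ e z)
include hz

lemma IsSpectralBranch.tendsto_zero : Tendsto z (Bornology.cobounded ℂ) (𝓝 0) :=
  tendsto_of_mul_tendsto hz.at_infinity

lemma IsSpectralBranch.sq_mul_sq {k : ℂ} (hk : k ∈ cutPlane k₁ k₂) :
    k ^ 2 * z k ^ 2 = -momentumSq L e (z k) := by
  have h0 : z k ≠ 0 := fun h => hz.notMem_lattice k hk (h ▸ L.lattice.zero_mem)
  have h1 := sq_mul_weierstrassP L h0
  rw [hz.sq_eq k hk, momentumSq]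
  linear_combination -h1

/-- Both sides have the same square and tend to 1, so their sum is eventually nonzero and they
agree. -/
lemma IsSpectralBranch.eventually_I_mul_mul : ∀ᶠ k in Bornology.cobounded ℂ,
    Complex.I * k * z k = momentumRoot L e (z k) := by
  have h1 : Tendsto (fun k => momentumRoot L e (z k)) (Bornology.cobounded ℂ) (𝓝 1) := by
    have := (analyticAt_momentumRoot L e).continuousAt.tendsto.comp hz.tendsto_zero
    rwa [momentumRoot_zero] at this
  have h2 : Tendsto (fun k => Complex.I * (k * z k) + momentumRoot L e (z k))
      (Bornology.cobounded ℂ) (𝓝 2) := by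
    convert (hz.at_infinity.const_mul Complex.I).add h1 using 2
    rw [mul_neg, Complex.I_mul_I]
    norm_num
  filter_upwards [h2.eventually_ne two_ne_zero, eventually_mem_cutPlane_cobounded] with k hk hkD
  have h3 := hz.sq_mul_sq hkD
  rw [← momentumRoot_sq] at h3
  have h4 : (Complex.I * (k * z k) + momentumRoot L e (z k)) *
      (Complex.I * k * z k - momentumRoot L e (z k)) = 0 := by
    linear_combination k ^ 2 * z k ^ 2 * Complex.I_sq - h3
  exact sub_eq_zero.mp ((mul_eq_zero.mp h4).resolve_left hk)

/-- The poles 1/z of ik and of ζ(z) cancel in the exponent, which removes the essential singularity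
at infinity. -/
lemma IsSpectralBranch.eventually_chi_eq (w : ℂ) (x : ℝ) : ∀ᶠ k in Bornology.cobounded ℂ,
    chi L w k₁ k₂ z k x = chiLocal L e w k₁ k₂ x (z k) := by
  have h1 : Tendsto (fun k => momentumRoot L e (z k) + 1) (Bornology.cobounded ℂ) (𝓝 (1 + 1)) := by
    have := (analyticAt_momentumRoot L e).continuousAt.tendsto.comp hz.tendsto_zero
    rw [momentumRoot_zero] at this
    exact this.add_const 1
  filter_upwards [hz.eventually_I_mul_mul, eventually_mem_cutPlane_cobounded,
    h1.eventually_ne (show (1 : ℂ) + 1 ≠ 0 by norm_num)] with k hk hkD hr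
  have h0 : z k ≠ 0 := fun h => hz.notMem_lattice k hkD (h ▸ L.lattice.zero_mem)
  have h2 := hz.sq_mul_sq hkD
  have h3 : Complex.I * k = 1 / z k + momentumRegular L e (z k) := by
    have h4 := momentumRoot_sq L e (z := z k)
    rw [eq_div_of_mul_eq h0 hk, momentumRegular]
    field_simp
    rw [momentumSq] at h4
    linear_combination h4
  have h5 : (k ^ 2 + (k₁ : ℂ) ^ 2) / (k ^ 2 + (k₂ : ℂ) ^ 2) =
      (momentumSq L e (z k) - (k₁ : ℂ) ^ 2 * z k ^ 2) /
        (momentumSq L e (z k) - (k₂ : ℂ) ^ 2 * z k ^ 2) := by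
    rw [← mul_div_mul_left _ _ (neg_ne_zero.mpr (pow_ne_zero 2 h0))]
    congr 1 <;> linear_combination -h2
  rw [chi, chiLocal, lamePhi, h5, weierstrassZeta_eq, h3, mul_assoc, mul_assoc, mul_assoc,
    ← Complex.exp_add]
  congr 4
  ring

lemma IsSpectralBranch.isBigO_sq : (fun k => z k ^ 2) =O[Bornology.cobounded ℂ]
    fun k => 1 / k ^ 2 := by
  have h := ((hz.at_infinity.pow 2).isBigO_one ℂ).mul
    (isBigO_refl (fun k : ℂ => 1 / k ^ 2) (Bornology.cobounded ℂ))
  simp only [one_mul] at h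
  refine h.congr' ?_ .rfl
  filter_upwards [(hasBasis_cobounded_norm (E := ℂ)).mem_of_mem (i := 1) trivial] with k hk
  have hk' : k ≠ 0 := by
    rintro rfl
    norm_num at hk
  field_simp

lemma IsSpectralBranch.chi_isBigO (hw : w ∉ L.lattice) (hxw : (x : ℂ) - w ∉ L.lattice) :
    (fun k => chi L w k₁ k₂ z k x - (1 + Complex.I / (2 * k) *
      (-2 * weierstrassZeta L (x - w) - 2 * weierstrassZeta L w + e * x)))
      =O[Bornology.cobounded ℂ] fun k => 1 / k ^ 2 := by
  set a := weierstrassZeta L (x - w) + weierstrassZeta L w - x * e / 2 with ha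
  -- At u = z(k) the quotient u/`momentumRoot` is exactly 1/(ik), so the subtracted term is the
  -- required 1/k term; dividing by the root leaves the first order at u = 0 unchanged.
  set N := fun u => chiLocal L e w k₁ k₂ x u - (1 + u * a / momentumRoot L e u)
  have hN : AnalyticAt ℂ N 0 := (analyticAt_chiLocal L hw hxw).sub
    (analyticAt_const.add ((analyticAt_id.mul analyticAt_const).div (analyticAt_momentumRoot L e)
      (by simp [momentumRoot_zero])))
  have hN' : HasDerivAt N 0 0 := by
    have h := (hasDerivAt_chiLocal_zero L (e := e) (k₁ := k₁) (k₂ := k₂) hw hxw).sub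
      ((((hasDerivAt_id (0 : ℂ)).mul_const a).div (hasDerivAt_momentumRoot_zero L e)
        (by simp [momentumRoot_zero])).const_add 1)
    refine h.congr_deriv ?_
    simp [momentumRoot_zero, ha]
  obtain ⟨g, hg, hNg⟩ := exists_eq_sq_mul hN (by simp [N, chiLocal_zero L hw hxw]) hN'
  have h1 := hz.isBigO_sq.mul ((hg.continuousAt.tendsto.comp hz.tendsto_zero).isBigO_one ℂ)
  simp only [mul_one] at h1
  refine h1.congr' ?_ .rfl
  filter_upwards [hz.eventually_chi_eq w x, hz.eventually_I_mul_mul,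
    eventually_mem_cutPlane_cobounded, (hasBasis_cobounded_norm (E := ℂ)).mem_of_mem (i := 1)
    trivial] with k hk hkr hkD hk1
  have hk' : k ≠ 0 := by
    rintro rfl
    norm_num at hk1
  have h0 : z k ≠ 0 := fun h => hz.notMem_lattice k hkD (h ▸ L.lattice.zero_mem)
  simp only [Function.comp_apply]
  rw [← hNg, hk]
  simp only [N]
  rw [← hkr, ha]
  have hI := Complex.I_ne_zero
  field_simp
  linear_combination (2 * (-weierstrassZeta L (x - w) - weierstrassZeta L w) + x * e) *
    Complex.I_sq

end Asymptotic

section Potential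

variable {L : PeriodPair} {k₁ k₂ : ℝ} {w : ℂ}

lemma hasDerivAt_potential (e : ℂ) {x : ℝ} (hxw : (x : ℂ) - w ∉ L.lattice) :
    HasDerivAt (fun x : ℝ => -2 * weierstrassZeta L (x - w) - 2 * weierstrassZeta L w + e * x)
      (2 * L.weierstrassP (x - w) + e) x := by
  have h1 : HasDerivAt (fun u : ℂ => -2 * weierstrassZeta L (u - w) - 2 * weierstrassZeta L w +
      e * u) (2 * L.weierstrassP (x - w) + e) x := by
    have h := ((((hasDerivAt_weierstrassZeta L hxw).comp_sub_const _ w).const_mul (-2)).sub_const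
      (2 * weierstrassZeta L w)).add ((hasDerivAt_id (x : ℂ)).const_mul e)
    refine h.congr_deriv ?_
    ring
  exact h1.comp_ofReal

end Potential

end PrimitivePotential

namespace PrimitivePotential

/-! ### Rectangular lattices and existence of the half-periods. -/

section RectangularLattice

variable {ω ω' : ℝ} (hω : 0 < ω) (hω' : 0 < ω')

lemma mem_rectPeriods_lattice {u : ℂ} : u ∈ (rectPeriods ω ω' hω hω').lattice ↔
    ∃ m n : ℤ, u.re = 2 * ω * m ∧ u.im = 2 * ω' * n := by
  rw [PeriodPair.mem_lattice]
  refine exists_congr fun m => exists_congr fun n => ?_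
  rw [Complex.ext_iff]
  simp [rectPeriods, mul_comm, mul_left_comm, eq_comm]

lemma notMem_rectPeriods_of_im {u : ℂ} (m : ℤ) (hu : u.im = (2 * m + 1) * ω') :
    u ∉ (rectPeriods ω ω' hω hω').lattice := by
  rw [mem_rectPeriods_lattice]
  rintro ⟨-, n, -, hn⟩
  have h : ((2 * m + 1 : ℤ) : ℝ) = ((2 * n : ℤ) : ℝ) := by
    push_cast
    refine mul_right_cancel₀ hω'.ne' ?_
    rw [← hu, hn]
    ring
  have := Int.cast_injective h
  omega

lemma notMem_rectPeriods_of_re {u : ℂ} (m : ℤ) (hu : u.re = (2 * m + 1) * ω) :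
    u ∉ (rectPeriods ω ω' hω hω').lattice := by
  rw [mem_rectPeriods_lattice]
  rintro ⟨n, -, hn, -⟩
  have h : ((2 * m + 1 : ℤ) : ℝ) = ((2 * n : ℤ) : ℝ) := by
    push_cast
    refine mul_right_cancel₀ hω.ne' ?_
    rw [← hu, hn]
    ring
  have := Int.cast_injective h
  omega

end RectangularLattice

section RowSums

lemma hasSum_of_eq {ι : Type*} {f g : ι → ℂ} {a : ℂ} (h : HasSum f a) (hfg : ∀ i, g i = f i) :
    HasSum g a := by
  rwa [funext hfg]

/-- This is the derivative of the Mittag-Leffler expansion of π cot πz. -/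
lemma hasSum_one_div_add_int_sq_of_im_pos {z : ℂ} (hz : 0 < z.im) :
    HasSum (fun n : ℤ => 1 / (z + n) ^ 2) (Real.pi ^ 2 / Complex.sin (Real.pi * z) ^ 2) := by
  have hs : Summable fun n : ℤ => 1 / (z + n) ^ 2 := by
    refine (EisensteinSeries.linear_right_summable z 1 (k := 2) le_rfl).congr fun n => ?_
    simp
  have hsin : Complex.sin (Real.pi * z) ≠ 0 := by
    rw [Complex.sin_ne_zero_iff]
    intro n h
    have h1 := mul_left_cancel₀ (Complex.ofReal_ne_zero.mpr Real.pi_ne_zero)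
      (h.trans (mul_comm _ _))
    rw [h1] at hz
    simp at hz
  have h := iteratedDerivWithin_cot_pi_mul_eq_mul_tsum_div_pow (k := 1) le_rfl hz
  have hd : HasDerivAt (fun z : ℂ => Real.pi * Complex.cot (Real.pi * z))
      (-(Real.pi ^ 2 / Complex.sin (Real.pi * z) ^ 2)) z := by
    have h1 : HasDerivAt (fun z : ℂ => (Real.pi : ℂ) * z) Real.pi z := by
      simpa using (hasDerivAt_id z).const_mul (Real.pi : ℂ)
    have h2 := ((h1.ccos.div h1.csin hsin)).const_mul (Real.pi : ℂ)
    refine (h2.congr_deriv ?_)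
    field_simp
    linear_combination -Complex.sin_sq_add_cos_sq (Real.pi * z)
  rw [iteratedDerivWithin_one, derivWithin_of_isOpen UpperHalfPlane.isOpen_upperHalfPlaneSet hz,
    hd.deriv] at h
  convert hs.hasSum using 1
  simpa using h

lemma hasSum_one_div_add_int_sq {z : ℂ} (hz : z.im ≠ 0) :
    HasSum (fun n : ℤ => 1 / (z + n) ^ 2) (Real.pi ^ 2 / Complex.sin (Real.pi * z) ^ 2) := by
  rcases hz.lt_or_gt with h | h
  · have h1 := hasSum_one_div_add_int_sq_of_im_pos (z := -z) (by simpa using h)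
    rw [mul_neg, Complex.sin_neg, neg_sq] at h1
    refine hasSum_of_eq ((Equiv.neg ℤ).hasSum_iff.mpr h1) fun n => ?_
    simp only [Function.comp_apply, Equiv.neg_apply]
    push_cast
    congr 1
    ring
  · exact hasSum_one_div_add_int_sq_of_im_pos h

/-- The function `1 / cosh² (π y) + 1 / sinh² (π y)`. -/
noncomputable def rowTerm (y : ℝ) : ℝ :=
  1 / Real.cosh (Real.pi * y) ^ 2 + 1 / Real.sinh (Real.pi * y) ^ 2

lemma rowTerm_neg (y : ℝ) : rowTerm (-y) = rowTerm y := by simp [rowTerm]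

lemma hasSum_row {y : ℝ} (hy : y ≠ 0) :
    HasSum (fun n : ℤ => 1 / (1 / 2 + Complex.I * y + n) ^ 2 - 1 / (Complex.I * y + n) ^ 2)
      ((Real.pi ^ 2 * rowTerm y : ℝ) : ℂ) := by
  have h1 := hasSum_one_div_add_int_sq (z := 1 / 2 + Complex.I * y) (by simpa using hy)
  have h2 := hasSum_one_div_add_int_sq (z := Complex.I * y) (by simpa using hy)
  have h3 : Complex.sin (Real.pi * (1 / 2 + Complex.I * y)) = Complex.cosh (Real.pi * y) := by
    rw [show (Real.pi : ℂ) * (1 / 2 + Complex.I * y) = Real.pi * y * Complex.I + Real.pi / 2 by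
      ring, Complex.sin_add_pi_div_two, Complex.cos_mul_I]
  have h4 : Complex.sin (Real.pi * (Complex.I * y)) = Complex.sinh (Real.pi * y) * Complex.I := by
    rw [show (Real.pi : ℂ) * (Complex.I * y) = Real.pi * y * Complex.I by ring,
      Complex.sin_mul_I]
  have h5 : ((Real.pi ^ 2 * rowTerm y : ℝ) : ℂ) =
      Real.pi ^ 2 / Complex.sin (Real.pi * (1 / 2 + Complex.I * y)) ^ 2 -
        Real.pi ^ 2 / Complex.sin (Real.pi * (Complex.I * y)) ^ 2 := by
    rw [h3, h4, mul_pow, Complex.I_sq, rowTerm]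
    push_cast
    ring
  rw [h5]
  exact h1.sub h2

/-- The sum of `1 / cosh² (π y) + 1 / sinh² (π y)` over `y ∈ (ℤ + 1/2) t`. -/
noncomputable def rowSum (t : ℝ) : ℝ := ∑' n : ℤ, rowTerm ((n + 1 / 2) * t)

variable {ω ω' : ℝ} (hω : 0 < ω) (hω' : 0 < ω')

/-- In the difference the correcting terms 1/l² cancel. The sum is over pairs of integers, so it may
be carried out by rows or by columns. -/
lemma hasSum_weierstrassP_sub (L : PeriodPair) (z z' : ℂ) :
    HasSum (fun p : ℤ × ℤ => 1 / (z + (p.1 * L.ω₁ + p.2 * L.ω₂)) ^ 2 -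
      1 / (z' + (p.1 * L.ω₁ + p.2 * L.ω₂)) ^ 2) (L.weierstrassP z - L.weierstrassP z') := by
  have h := (L.hasSum_weierstrassP z).sub (L.hasSum_weierstrassP z')
  have h1 := ((Equiv.neg (ℤ × ℤ)).trans L.latticeEquivProd.symm.toEquiv).hasSum_iff.mpr h
  refine hasSum_of_eq h1 fun p => ?_
  have h2 : ((L.latticeEquivProd.symm (-p) : L.lattice) : ℂ) = -(p.1 * L.ω₁ + p.2 * L.ω₂) := by
    rw [L.latticeEquiv_symm_apply]
    simp only [Prod.fst_neg, Prod.snd_neg]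
    push_cast
    ring
  simp only [Function.comp_apply, Equiv.trans_apply, Equiv.neg_apply, LinearEquiv.coe_toEquiv, h2]
  ring

lemma int_add_half_ne_zero (n : ℤ) : (n : ℝ) + 1 / 2 ≠ 0 := by
  intro h
  have h1 : ((2 * n + 1 : ℤ) : ℝ) = ((0 : ℤ) : ℝ) := by
    push_cast
    linarith
  have := Int.cast_injective h1
  omega

/-- Summation along the period 2ω: after scaling by 2ω, row n is `hasSum_row` at height (n +
1/2)ω'/ω. -/
lemma weierstrassP_w_sub_h₃ :
    (rectPeriods ω ω' hω hω').weierstrassP (ω + Complex.I * ω') -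
      (rectPeriods ω ω' hω hω').weierstrassP (Complex.I * ω') =
    ((Real.pi / (2 * ω)) ^ 2 * rowSum (ω' / ω) : ℝ) := by
  have hω0 : (ω : ℂ) ≠ 0 := Complex.ofReal_ne_zero.mpr hω.ne'
  have h := (Equiv.prodComm ℤ ℤ).hasSum_iff.mpr (hasSum_weierstrassP_sub
    (rectPeriods ω ω' hω hω') (ω + Complex.I * ω') (Complex.I * ω'))
  have h1 := h.prod_fiberwise (g := fun n : ℤ =>
      ((1 / (2 * ω) ^ 2 * (Real.pi ^ 2 * rowTerm ((n + 1 / 2) * (ω' / ω))) : ℝ) : ℂ)) fun n => by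
    have h2 := (hasSum_row (mul_ne_zero (int_add_half_ne_zero n)
      (div_pos hω' hω).ne')).mul_left (1 / (2 * (ω : ℂ)) ^ 2)
    rw [Complex.ofReal_mul]
    push_cast at h2 ⊢
    refine hasSum_of_eq h2 fun m => ?_
    simp only [Function.comp_apply, Equiv.prodComm_apply, Prod.swap_prod_mk, rectPeriods]
    rw [mul_sub, one_div_mul_one_div, one_div_mul_one_div, ← mul_pow, ← mul_pow]
    congr 3 <;> field_simp <;> ring
  rw [← h1.tsum_eq, ← Complex.ofReal_tsum, tsum_mul_left, tsum_mul_left, rowSum]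
  congr 1
  ring

/-- Summation along the period 2iω'. The factor i² = -1 from the scaling reverses the difference and
keeps the terms positive. -/
lemma weierstrassP_h₁_sub_w :
    (rectPeriods ω ω' hω hω').weierstrassP ω -
      (rectPeriods ω ω' hω hω').weierstrassP (ω + Complex.I * ω') =
    ((Real.pi / (2 * ω')) ^ 2 * rowSum (ω / ω') : ℝ) := by
  have hω0 : (ω' : ℂ) ≠ 0 := Complex.ofReal_ne_zero.mpr hω'.ne'
  have hI := Complex.I_ne_zero
  have h := hasSum_weierstrassP_sub (rectPeriods ω ω' hω hω') ω (ω + Complex.I * ω')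
  have h1 := h.prod_fiberwise (g := fun n : ℤ =>
      ((1 / (2 * ω') ^ 2 * (Real.pi ^ 2 * rowTerm ((n + 1 / 2) * (ω / ω'))) : ℝ) : ℂ)) fun n => by
    have h2 := (hasSum_row (neg_ne_zero.mpr (mul_ne_zero (int_add_half_ne_zero n)
      (div_pos hω hω').ne'))).mul_left (1 / (2 * (ω' : ℂ)) ^ 2)
    rw [rowTerm_neg] at h2
    rw [Complex.ofReal_mul]
    push_cast at h2 ⊢
    refine hasSum_of_eq h2 fun m => ?_
    have h3 : ∀ a : ℂ, 1 / (2 * Complex.I * ω' * a) ^ 2 = -(1 / (2 * (ω' : ℂ)) ^ 2 *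
        (1 / a ^ 2)) := by
      intro a
      rw [mul_pow, mul_pow, mul_pow, Complex.I_sq]
      ring
    simp only [rectPeriods]
    rw [show (ω : ℂ) + (n * (2 * ω) + m * (2 * (Complex.I * ω'))) = 2 * Complex.I * ω' *
        (Complex.I * -((n + 1 / 2) * (ω / ω')) + m) by
          field_simp
          linear_combination (2 * n + 1) * (ω : ℂ) * Complex.I_sq,
      show (ω : ℂ) + Complex.I * ω' + (n * (2 * ω) + m * (2 * (Complex.I * ω'))) =
        2 * Complex.I * ω' * (1 / 2 + Complex.I * -((n + 1 / 2) * (ω / ω')) + m) by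
          field_simp
          linear_combination (2 * n + 1) * (ω : ℂ) * Complex.I_sq, h3, h3]
    ring
  rw [← h1.tsum_eq, ← Complex.ofReal_tsum, tsum_mul_left, tsum_mul_left, rowSum]
  congr 1
  ring

end RowSums

section RowSumAnalysis

lemma rowTerm_pos {y : ℝ} (hy : y ≠ 0) : 0 < rowTerm y := by
  have := Real.cosh_pos (Real.pi * y)
  unfold rowTerm
  positivity

lemma sq_le_sinh_sq (y : ℝ) : y ^ 2 ≤ Real.sinh y ^ 2 := by
  rw [sq_le_sq, Real.abs_sinh]
  exact Real.self_le_sinh_iff.mpr (abs_nonneg y)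

lemma rowTerm_le {y : ℝ} (hy : y ≠ 0) : rowTerm y ≤ 2 / Real.pi ^ 2 * (1 / y ^ 2) := by
  have hπ := Real.pi_pos
  have h0 : 0 < (Real.pi * y) ^ 2 := by positivity
  have h1 := sq_le_sinh_sq (Real.pi * y)
  have h2 : (Real.pi * y) ^ 2 ≤ Real.cosh (Real.pi * y) ^ 2 := by
    rw [Real.cosh_sq]
    linarith
  calc rowTerm y ≤ 1 / (Real.pi * y) ^ 2 + 1 / (Real.pi * y) ^ 2 := by
        unfold rowTerm
        gcongr
    _ = _ := by
        field_simp
        norm_num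

lemma continuousAt_rowTerm {y : ℝ} (hy : y ≠ 0) : ContinuousAt rowTerm y := by
  have h1 := (Real.cosh_pos (Real.pi * y)).ne'
  have h2 : Real.sinh (Real.pi * y) ≠ 0 := by
    rw [Ne, Real.sinh_eq_zero]
    exact mul_ne_zero Real.pi_ne_zero hy
  unfold rowTerm
  fun_prop (disch := simp_all)

lemma summable_one_div_int_add_half_sq : Summable fun n : ℤ => 1 / ((n : ℝ) + 1 / 2) ^ 2 := by
  refine ((Real.summable_one_div_int_add_rpow (1 / 2) 2).mpr (by norm_num)).congr fun n => ?_
  norm_cast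
  rw [sq_abs]

lemma rowTerm_mul_le {a t : ℝ} (ha : 0 < a) (hat : a ≤ t) (n : ℤ) :
    rowTerm ((n + 1 / 2) * t) ≤ 2 / (Real.pi ^ 2 * a ^ 2) * (1 / ((n : ℝ) + 1 / 2) ^ 2) := by
  have hn := int_add_half_ne_zero n
  have hπ := Real.pi_pos
  refine (rowTerm_le (mul_ne_zero hn (ha.trans_le hat).ne')).trans ?_
  rw [mul_pow, div_mul_div_comm, div_mul_div_comm]
  have h0 : 0 < ((n : ℝ) + 1 / 2) ^ 2 := by positivity
  rw [mul_assoc, mul_comm (a ^ 2)]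
  gcongr

lemma summable_rowTerm {t : ℝ} (ht : 0 < t) :
    Summable fun n : ℤ => rowTerm ((n + 1 / 2) * t) :=
  .of_nonneg_of_le (fun n => (rowTerm_pos (mul_ne_zero (int_add_half_ne_zero n) ht.ne')).le)
    (rowTerm_mul_le ht le_rfl) (summable_one_div_int_add_half_sq.mul_left _)

lemma rowTerm_le_rowSum {t : ℝ} (ht : 0 < t) : rowTerm (1 / 2 * t) ≤ rowSum t := by
  have := (summable_rowTerm ht).le_tsum 0 fun n _ =>
    (rowTerm_pos (mul_ne_zero (int_add_half_ne_zero n) ht.ne')).le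
  simpa [rowSum] using this

lemma rowSum_pos {t : ℝ} (ht : 0 < t) : 0 < rowSum t :=
  (rowTerm_pos (by positivity)).trans_le (rowTerm_le_rowSum ht)

lemma continuousOn_rowSum : ContinuousOn rowSum (Set.Ioi 0) := by
  intro t ht
  have ht' : 0 < t / 2 := half_pos ht
  refine ContinuousAt.continuousWithinAt ?_
  refine (continuousOn_tsum (s := Set.Ici (t / 2)) (fun n s hs => ?_)
    (summable_one_div_int_add_half_sq.mul_left (2 / (Real.pi ^ 2 * (t / 2) ^ 2)))
    fun n s hs => ?_).continuousAt (Ici_mem_nhds (half_lt_self ht))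
  · have hs0 : s ≠ 0 := (ht'.trans_le hs).ne'
    exact (ContinuousAt.comp (g := rowTerm) (f := fun s => ((n : ℝ) + 1 / 2) * s)
      (continuousAt_rowTerm (mul_ne_zero (int_add_half_ne_zero n) hs0))
      (by fun_prop)).continuousWithinAt
  · have hs0 : s ≠ 0 := (ht'.trans_le hs).ne'
    rw [Real.norm_of_nonneg (rowTerm_pos (mul_ne_zero (int_add_half_ne_zero n) hs0)).le]
    exact rowTerm_mul_le ht' hs n

/-- The ratio `(e₂ - e₃) / (e₁ - e₂)` for the rectangular lattice with `ω' / ω = t`. -/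
noncomputable def rowRatio (t : ℝ) : ℝ := t ^ 2 * rowSum t / rowSum t⁻¹

lemma rowRatio_inv {t : ℝ} (ht : 0 < t) : rowRatio t⁻¹ = (rowRatio t)⁻¹ := by
  have h1 := rowSum_pos ht
  rw [rowRatio, rowRatio, inv_inv]
  field_simp

/-- As t → ∞ the numerator t²`rowSum t` stays bounded, while `rowSum t⁻¹` blows up through the
1/sinh² part of its term n = 0. -/
lemma exists_rowRatio_lt {c : ℝ} (hc : 0 < c) : ∃ t : ℝ, 0 < t ∧ rowRatio t < c := by
  set S := ∑' n : ℤ, 1 / ((n : ℝ) + 1 / 2) ^ 2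
  have hlim : Tendsto (fun t : ℝ => 2 / Real.pi ^ 2 * S * Real.sinh (Real.pi * (1 / 2 * t⁻¹)) ^ 2)
      atTop (𝓝 0) := by
    have h1 : Tendsto (fun t : ℝ => Real.pi * (1 / 2 * t⁻¹)) atTop (𝓝 0) := by
      simpa using (tendsto_inv_atTop_zero.const_mul (1 / 2 : ℝ)).const_mul Real.pi
    have h2 := ((Real.continuous_sinh.tendsto 0).comp h1).pow 2
    simpa using h2.const_mul (2 / Real.pi ^ 2 * S)
  obtain ⟨t, hlt, ht⟩ := ((hlim.eventually_lt_const hc).and (eventually_gt_atTop 0)).exists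
  refine ⟨t, ht, lt_of_le_of_lt ?_ hlt⟩
  have hπ := Real.pi_pos
  have h1 : t ^ 2 * rowSum t ≤ 2 / Real.pi ^ 2 * S := by
    have h2 := (summable_rowTerm ht).tsum_le_tsum (rowTerm_mul_le ht le_rfl)
      (summable_one_div_int_add_half_sq.mul_left _)
    rw [tsum_mul_left] at h2
    calc t ^ 2 * rowSum t ≤ t ^ 2 * (2 / (Real.pi ^ 2 * t ^ 2) * S) := by gcongr; exact h2
      _ = _ := by field_simp
  have hti : 0 < t⁻¹ := inv_pos.mpr ht
  have hsinh : 0 < Real.sinh (Real.pi * (1 / 2 * t⁻¹)) := Real.sinh_pos_iff.mpr (by positivity)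
  have h3 : 1 / Real.sinh (Real.pi * (1 / 2 * t⁻¹)) ^ 2 ≤ rowSum t⁻¹ := by
    refine le_trans ?_ (rowTerm_le_rowSum hti)
    unfold rowTerm
    have : 0 ≤ 1 / Real.cosh (Real.pi * (1 / 2 * t⁻¹)) ^ 2 := by positivity
    linarith
  have h4 : 0 ≤ t ^ 2 * rowSum t := (mul_pos (by positivity) (rowSum_pos ht)).le
  calc rowRatio t ≤ 2 / Real.pi ^ 2 * S / (1 / Real.sinh (Real.pi * (1 / 2 * t⁻¹)) ^ 2) := by
        unfold rowRatio
        gcongr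
    _ = _ := by rw [div_div_eq_mul_div, div_one]

/-- The symmetry `rowRatio_inv` turns arbitrarily small values into arbitrarily large ones; the rest
is the intermediate value theorem. -/
lemma exists_rowRatio_eq {c : ℝ} (hc : 0 < c) : ∃ t : ℝ, 0 < t ∧ rowRatio t = c := by
  obtain ⟨a, ha, hac⟩ := exists_rowRatio_lt hc
  obtain ⟨b, hb, hbc⟩ := exists_rowRatio_lt (inv_pos.mpr hc)
  have hcont : ContinuousOn rowRatio (Set.Ioi 0) := by
    refine ((continuousOn_id.pow 2).mul continuousOn_rowSum).div
      (continuousOn_rowSum.comp (continuousOn_inv₀.mono fun t ht => ne_of_gt ht)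
        fun t ht => Set.mem_Ioi.mpr (inv_pos.mpr ht)) fun t ht => (rowSum_pos (inv_pos.mpr ht)).ne'
  have hpos : 0 < rowRatio b :=
    div_pos (mul_pos (by positivity) (rowSum_pos hb)) (rowSum_pos (inv_pos.mpr hb))
  have hbc' : c ≤ rowRatio b⁻¹ := by
    rw [rowRatio_inv hb]
    exact (le_inv_comm₀ hc hpos).mpr hbc.le
  obtain ⟨t, ht, htc⟩ := isPreconnected_Ioi.intermediate_value (Set.mem_Ioi.mpr ha)
    (Set.mem_Ioi.mpr (inv_pos.mpr hb)) hcont ⟨hac.le, hbc'⟩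
  exact ⟨t, ht, htc⟩

end RowSumAnalysis

lemma sum_eq_zero_of_cubic {g₂ g₃ a b c : ℂ} (ha : 4 * a ^ 3 - g₂ * a - g₃ = 0)
    (hb : 4 * b ^ 3 - g₂ * b - g₃ = 0) (hc : 4 * c ^ 3 - g₂ * c - g₃ = 0)
    (hab : a - b ≠ 0) (hbc : b - c ≠ 0) (hac : a - c ≠ 0) : a + b + c = 0 := by
  have h1 : 4 * (a ^ 2 + a * b + b ^ 2) - g₂ = 0 :=
    (mul_eq_zero.mp (show (a - b) * (4 * (a ^ 2 + a * b + b ^ 2) - g₂) = 0 by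
      linear_combination ha - hb)).resolve_left hab
  have h2 : 4 * (b ^ 2 + b * c + c ^ 2) - g₂ = 0 :=
    (mul_eq_zero.mp (show (b - c) * (4 * (b ^ 2 + b * c + c ^ 2) - g₂) = 0 by
      linear_combination hb - hc)).resolve_left hbc
  exact (mul_eq_zero.mp (show (a - c) * (a + b + c) = 0 by
    linear_combination (h1 - h2) / 4)).resolve_left hac

/-- The shape t fixes the ratio of the two differences and ω their size. The three values are
distinct roots of a cubic without quadratic term, so they sum to 0 and are determined by their
differences. -/
theorem exists_areHalfPeriods {k₁ k₂ : ℝ} (hk₁ : 0 < k₁) (hk₂ : k₁ < k₂) :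
    ∃ (ω ω' : ℝ) (hω : 0 < ω) (hω' : 0 < ω'), AreHalfPeriods k₁ k₂ ω ω' hω hω' := by
  have hd : 0 < k₂ ^ 2 - k₁ ^ 2 := by nlinarith
  obtain ⟨t, ht, htc⟩ := exists_rowRatio_eq (div_pos (pow_pos hk₁ 2) hd)
  have hS := rowSum_pos ht
  have hS' := rowSum_pos (inv_pos.mpr ht)
  have hπ := Real.pi_pos
  -- Solves (π/2ω)²`rowSum t` = k₁².
  set ω := Real.pi * √(rowSum t) / (2 * k₁) with hωdef
  have hω : 0 < ω := by positivity
  have hω' : 0 < t * ω := mul_pos ht hω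
  have hω2 : (2 * ω) ^ 2 * k₁ ^ 2 = Real.pi ^ 2 * rowSum t := by
    rw [hωdef]
    field_simp
    rw [Real.sq_sqrt hS.le]
  refine ⟨ω, t * ω, hω, hω', ?_⟩
  set L := rectPeriods ω (t * ω) hω hω'
  have h23 : L.weierstrassP (ω + Complex.I * (t * ω : ℝ)) -
      L.weierstrassP (Complex.I * (t * ω : ℝ)) = (k₁ : ℂ) ^ 2 := by
    rw [weierstrassP_w_sub_h₃, mul_div_cancel_right₀ _ hω.ne', div_pow, div_mul_eq_mul_div,
      ← hω2, mul_div_cancel_left₀ _ (by positivity)]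
    push_cast
    rfl
  have h12 : L.weierstrassP ω - L.weierstrassP (ω + Complex.I * (t * ω : ℝ)) =
      (k₂ : ℂ) ^ 2 - (k₁ : ℂ) ^ 2 := by
    have h : (Real.pi / (2 * (t * ω))) ^ 2 * rowSum t⁻¹ = k₂ ^ 2 - k₁ ^ 2 := by
      rw [rowRatio, div_eq_div_iff hS'.ne' hd.ne'] at htc
      rw [div_pow, div_mul_eq_mul_div, div_eq_iff (by positivity)]
      refine mul_left_cancel₀ (pow_pos hk₁ 2).ne' ?_
      linear_combination -Real.pi ^ 2 * htc - (k₂ ^ 2 - k₁ ^ 2) * t ^ 2 * hω2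
    rw [weierstrassP_h₁_sub_w, div_mul_cancel_right₀ hω.ne', h]
    push_cast
    rfl
  have hcubic : ∀ h : ℂ, 2 * h ∈ L.lattice → h ∉ L.lattice →
      4 * L.weierstrassP h ^ 3 - L.g₂ * L.weierstrassP h - L.g₃ = 0 := by
    intro h h2 hn
    rw [← L.derivWeierstrassP_sq h hn, derivWeierstrassP_half L h2]
    simp
  have hsum := sum_eq_zero_of_cubic
    (hcubic ω ((mem_rectPeriods_lattice hω hω').mpr ⟨1, 0, by simp, by simp⟩)
      (notMem_rectPeriods_of_re hω hω' 0 (by simp)))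
    (hcubic (ω + Complex.I * (t * ω : ℝ))
      ((mem_rectPeriods_lattice hω hω').mpr ⟨1, 1, by simp, by simp⟩)
      (notMem_rectPeriods_of_im hω hω' 0 (by simp)))
    (hcubic (Complex.I * (t * ω : ℝ))
      ((mem_rectPeriods_lattice hω hω').mpr ⟨0, 1, by simp, by simp⟩)
      (notMem_rectPeriods_of_im hω hω' 0 (by simp)))
    (by rw [h12]; exact_mod_cast hd.ne')
    (by rw [h23]; exact_mod_cast (pow_pos hk₁ 2).ne')
    (by
      rw [← sub_add_sub_cancel, h12, h23]
      exact_mod_cast (by nlinarith : k₂ ^ 2 - k₁ ^ 2 + k₁ ^ 2 ≠ 0))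
  have h3 : L.weierstrassP (Complex.I * (t * ω : ℝ)) = e₃ k₁ k₂ := by
    have h : ((e₃ k₁ k₂ : ℝ) : ℂ) = -((k₁ : ℂ) ^ 2 + (k₂ : ℂ) ^ 2) / 3 := by simp [e₃]
    rw [h]
    linear_combination (hsum - h12 - 2 * h23) / 3
  refine ⟨?_, ?_, h3⟩
  · rw [e₁_eq, ← h3]
    linear_combination h12 + h23
  · rw [e₂_eq, ← h3]
    linear_combination h23

end PrimitivePotential

/-! ### Assembly. -/

namespace PrimitivePotential

section RectangularLattice

variable {ω ω' : ℝ} (hω : 0 < ω) (hω' : 0 < ω')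

variable {k₁ k₂ : ℝ}

lemma AreHalfPeriods.halfPeriodValues (hk₁ : 0 < k₁) (hk₂ : k₁ < k₂)
    (h : AreHalfPeriods k₁ k₂ ω ω' hω hω') :
    HalfPeriodValues (rectPeriods ω ω' hω hω') k₁ k₂ ω (ω + Complex.I * ω') (Complex.I * ω') where
  pos := hk₁
  lt := hk₂
  two_mul_h₁ := (mem_rectPeriods_lattice hω hω').mpr ⟨1, 0, by simp, by simp⟩
  two_mul_w := (mem_rectPeriods_lattice hω hω').mpr ⟨1, 1, by simp, by simp⟩
  two_mul_h₃ := (mem_rectPeriods_lattice hω hω').mpr ⟨0, 1, by simp, by simp⟩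
  h₁_notMem := notMem_rectPeriods_of_re hω hω' 0 (by simp)
  w_notMem := notMem_rectPeriods_of_im hω hω' 0 (by simp)
  h₃_notMem := notMem_rectPeriods_of_im hω hω' 0 (by simp)
  weierstrassP_h₁ := h.1
  weierstrassP_w := h.2.1
  weierstrassP_h₃ := h.2.2

end RectangularLattice

end PrimitivePotential

open PrimitivePotential in
theorem mainTheorem1 (k₁ k₂ : ℝ) (hk₁ : 0 < k₁) (hk₂ : k₁ < k₂) :
    (∃ (ω ω' : ℝ) (hω : 0 < ω) (hω' : 0 < ω'),
      PrimitivePotential.AreHalfPeriods k₁ k₂ ω ω' hω hω') ∧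
    ∀ (ω ω' : ℝ) (hω : 0 < ω) (hω' : 0 < ω'),
      PrimitivePotential.AreHalfPeriods k₁ k₂ ω ω' hω hω' →
      (∃ z : ℂ → ℂ, PrimitivePotential.IsSpectralBranch
        (PrimitivePotential.rectPeriods ω ω' hω hω') k₁ k₂ (PrimitivePotential.e₃ k₁ k₂) z) ∧
      ∀ z : ℂ → ℂ, PrimitivePotential.IsSpectralBranch
        (PrimitivePotential.rectPeriods ω ω' hω hω') k₁ k₂ (PrimitivePotential.e₃ k₁ k₂) z →
        ∃ Q : ℝ → ℂ,
          PrimitivePotential.SolvesContourProblem k₁ k₂ (fun _ => 1) (fun _ => 1) 0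
            (PrimitivePotential.chi (PrimitivePotential.rectPeriods ω ω' hω hω')
              (ω + Complex.I * ω') k₁ k₂ z) Q ∧
          ∀ x : ℝ, HasDerivAt Q
            (2 * (PrimitivePotential.rectPeriods ω ω' hω hω').weierstrassP
                (x + Complex.I * ω' - ω) + PrimitivePotential.e₃ k₁ k₂) x := by
  refine ⟨exists_areHalfPeriods hk₁ hk₂, fun ω ω' hω hω' hper => ?_⟩
  have H := hper.halfPeriodValues hω hω' hk₁ hk₂
  have hw : ∀ x : ℝ, (x : ℂ) - (ω + Complex.I * ω') ∉ (rectPeriods ω ω' hω hω').lattice :=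
    -- The imaginary part of x - w is -ω', an odd multiple of ω', so φ has no singularity for real
    -- x.
    fun x => notMem_rectPeriods_of_im hω hω' (-1) (by simp; ring)
  refine ⟨H.exists_isSpectralBranch, fun z hz => ⟨_, ⟨H.analyticOnNhd_chi hz hw, ?_,
    fun x => (hz.chi_isBigO H.w_notMem (hw x)).mono inf_le_left, H.exists_endpoint_bound hz⟩,
    fun x => (hasDerivAt_potential _ (hw x)).congr_deriv ?_⟩⟩
  · simpa using H.exists_jumps hz hw
  -- The arguments x - w and x + iω' - ω differ by the period 2iω'.
  · rw [← weierstrassP_add_mem _ H.two_mul_h₃]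
    ring_nf
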